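/- **Setting.** Write $|z|=|t|^{1/2}+\sum_{i=1}^3|x_i|$ for $z=(t,x)\in\mathbf R\times\mathbf R^3$. Let $K:\mathbf R^{1+3}\setminus\{0\}\to\mathbf R$ be a truncated heat kernel: compactly supported, smooth away from $0$, equal to the heat kernel of $\partial_t-\Delta$ for $0<|z|\le 1$, and integrating to zero against all polynomials of parabolic degree at most $2$. For every $\epsilon\in(0,1)$ let $\zeta=\zeta^{(\epsilon)}$ be a random field on $\mathbf R\times(\epsilon^{-1}\mathbf T)^3$, $\mathbf T=\mathbf R/\mathbf Z$, (identified with a spatially periodic field on $\mathbf R^{1+3}$) that is stationary, a.s. continuous, equal in law to $-\zeta$, with $\int\mathbf E\,\zeta(0)\zeta(z)\,dz=1$ over $\mathbf R\times(\epsilon^{-1}\mathbf T)^3$, such that the restrictions of $\zeta$ to two compact sets at (parabolic) distance at least $1$ are independent, and such that $\mathbf E|\zeta^{(\epsilon)}(z)|^p$ is finite and bounded uniformly in $\epsilon$ and $z$ for each $p>1$. Put $\zeta_\epsilon(t,x)=\epsilon^{-5/2}\zeta^{(\epsilon)}(t/\epsilon^2,x/\epsilon)$ and let $\mathfrak C^{(\epsilon)}_n(z_1,\dots,z_n)$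 be the joint cumulant of $\zeta_\epsilon(z_1),\dots,\zeta_\epsilon(z_n)$. Let $k\ge1$, $\ell\ge2$ with $k+\ell$ even, and let $\pi=\{(k_1,\ell_1),\dots,(k_n,\ell_n)\}$ be a multiset of pairs of integers $k_j,\ell_j\ge1$ with $\sum_j k_j=k$, $\sum_j\ell_j=\ell$. Set $$G_\pi^{(\epsilon)}(v,w)=\prod_{j=1}^n\int\prod_{a=1}^{k_j}K(w-x_a)\prod_{b=1}^{\ell_j}K(v-y_b)\;\mathfrak C^{(\epsilon)}_{k_j+\ell_j}(x_1,\dots,x_{k_j},y_1,\dots,y_{\ell_j})\,dx\,dy .$$ For $\lambda\in(0,1]$ and $\varphi\in\mathcal C^2$ supported in $\{|z|\le1\}$ with $\|\varphi\|_{\mathcal C^2}\le1$, put $\varphi^\lambda(t,x)=\lambda^{-5}\varphi(t/\lambda^2,x/\lambda)$. The contribution of the contraction $\pi$ to the $0$-th chaos of the second order object with parameters $(k,\ell)$, the corresponding mass renormalisation constant, and the graph $R$ are $$Z=\epsilon^{\frac{k+\ell-4}2}\iint\varphi^\lambda(w)\,\big(K(w-v)-K(-v)\big)\,G_\pi^{(\epsilon)}(v,w)\,dv\,dw,\qquad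 C^{(\epsilon)}_{k,\ell,\pi}=\epsilon^{\frac{k+\ell-4}2}\int K(-v)\,G_\pi^{(\epsilon)}(v,0)\,dv,$$ $$R=\epsilon^{\frac{k+\ell-4}2}\iint\varphi^\lambda(w)\,K(-v)\,G_\pi^{(\epsilon)}(v,w)\,dv\,dw .$$ **Proposition 4.9.** Let $k,\ell,\pi$ be as above and $\delta>0$. There is $\theta\ge0$, depending only on $k,\ell,\pi,\delta$, with $\theta=0$ if and only if $k=\ell=2$ and $\pi=\{(1,1),(1,1)\}$ (the pairwise contraction), such that for every kernel $K$ and every family of noises as above there is a constant $C$ such that, for all $\epsilon\in(0,1)$, $\lambda\in(0,1]$ and all $\varphi$ as above, all the integrals above converge absolutely and $$Z-C^{(\epsilon)}_{k,\ell,\pi}\int\varphi^\lambda=-R,\qquad |R|\le C\,\epsilon^\theta\lambda^{-\delta}.$$ If $k=\ell=2$ and $\pi=\{(1,1),(1,1)\}$, the exponent $\theta=0$ cannot be improved: for every $K$, every family of noises and every $\theta>0$, there is no constant $C$ such that $|R|\le C\epsilon^\theta\lambda^{-\delta}$ for all $\epsilon\in(0,1)$, $\lambda\in(0,1]$ and all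 $\varphi$ as above. -/

import Mathlib

open MeasureTheory ProbabilityTheory Set Filter

noncomputable section

/-- Space-time `ℝ × ℝ³`; the first coordinate is time. -/
abbrev SpaceTime : Type := ℝ × (Fin 3 → ℝ)

/-- The parabolic size `|z| = |t|^{1/2} + ∑ |x_i|` of a space-time point. -/
def parabolicNorm (z : SpaceTime) : ℝ := Real.sqrt |z.1| + ∑ i, |z.2 i|

/-- The parabolic distance on `ℝ × (ℝ / L ℤ)³`, for representatives in `ℝ × ℝ³`. The norm on
`AddCircle L` of the class of a real number is its distance to `L ℤ`. -/
def torusDist (L : ℝ) (z z' : SpaceTime) : ℝ :=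
  Real.sqrt |z.1 - z'.1| + ∑ i, ‖((z.2 i - z'.2 i : ℝ) : AddCircle L)‖

/-! ### The truncated heat kernel -/

/-- The heat kernel of `∂ₜ - Δ` on `ℝ × ℝ³`. -/
def heatKernel (z : SpaceTime) : ℝ :=
  if 0 < z.1 then
    (4 * Real.pi * z.1) ^ (-(3 / 2) : ℝ) * Real.exp (-(∑ i, z.2 i ^ 2) / (4 * z.1))
  else 0

/-- Truncations `K` of the heat kernel. The value `K 0` carries no information. -/
structure IsTruncatedHeatKernel (K : SpaceTime → ℝ) : Prop where
  eq_heatKernel : ∀ z, z ≠ 0 → parabolicNorm z ≤ 1 → K z = heatKernel z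
  smooth : ContDiffOn ℝ ((⊤ : ℕ∞) : WithTop ℕ∞) K {0}ᶜ
  compactSupport : HasCompactSupport K
  annihilates : ∀ (m : ℕ) (n : Fin 3 → ℕ), 2 * m + ∑ i, n i ≤ 2 →
    ∫ z : SpaceTime, K z * (z.1 ^ m * ∏ i, z.2 i ^ n i) = 0

/-! ### Joint cumulants -/

/-- The joint cumulant `E_c(X_B)`, defined inductively over `|B|` through
`E(∏_{i ∈ B} X_i) = ∑_{partitions of B} ∏_{A in the partition} E_c(X_A)`: the cumulant of `B` itself
is what is left of the moment after all partitions other than `{B}` have been subtracted. -/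
def jointCumulant {ι Ω : Type*} [DecidableEq ι] [MeasurableSpace Ω] (P : Measure Ω)
    (X : ι → Ω → ℝ) (B : Finset ι) : ℝ :=
  ∫ ω, ∏ i ∈ B, X i ω ∂P -
    ∑ p : {p : Finpartition B // B ∉ p.parts},
      ∏ A : {A : Finset ι // A ∈ p.1.parts}, jointCumulant P X A.1
termination_by B.card
decreasing_by
  refine Finset.card_lt_card ((p.1.le A.2).lt_of_ne ?_)
  intro h
  exact p.2 (h.subst (motive := fun S => S ∈ p.1.parts) A.2)

/-! ### The noise -/

/-- A symmetric, stationary, continuous, normalised random field with finite range of dependence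
on `ℝ × (ε⁻¹ 𝕋)³`, viewed as a spatially `ε⁻¹`-periodic field on `ℝ × ℝ³`. -/
structure IsNoise {Ω : Type*} [MeasurableSpace Ω] (P : Measure Ω) (ε : ℝ)
    (ζ : SpaceTime → Ω → ℝ) : Prop where
  measurable : ∀ z, Measurable (ζ z)
  periodic : ∀ (t : ℝ) (x : Fin 3 → ℝ) (n : Fin 3 → ℤ) (ω : Ω),
    ζ (t, fun i => x i + n i * ε⁻¹) ω = ζ (t, x) ω
  symmetric : P.map (fun ω z => ζ z ω) = P.map (fun ω z => -ζ z ω)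
  stationary : ∀ h : SpaceTime, P.map (fun ω z => ζ (z + h) ω) = P.map (fun ω z => ζ z ω)
  continuous : ∀ᵐ ω ∂P, Continuous fun z => ζ z ω
  moments : ∀ p : ℝ, 1 < p → ∀ z, Integrable (fun ω => |ζ z ω| ^ p) P
  /- The covariance integrates to `1` over a fundamental domain of `ℝ × (ε⁻¹ 𝕋)³`. -/
  normalised :
    ∫ z in {z : SpaceTime | ∀ i, z.2 i ∈ Ico 0 ε⁻¹}, (∫ ω, ζ 0 ω * ζ z ω ∂P) = 1
  independent : ∀ S T : Set SpaceTime, IsCompact S → IsCompact T →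
    (∀ z ∈ S, ∀ z' ∈ T, 1 ≤ torusDist ε⁻¹ z z') →
    Indep (⨆ z ∈ S, MeasurableSpace.comap (ζ z) inferInstance)
      (⨆ z ∈ T, MeasurableSpace.comap (ζ z) inferInstance) P

/-- For each `ε ∈ (0,1)` a noise `ζ ε` on `ℝ × (ε⁻¹ 𝕋)³`, with moments bounded uniformly in `ε`. -/
structure IsNoiseFamily {Ω : Type*} [MeasurableSpace Ω] (P : Measure Ω)
    (ζ : ℝ → SpaceTime → Ω → ℝ) : Prop where
  isNoise : ∀ ε ∈ Ioo (0 : ℝ) 1, IsNoise P ε (ζ ε)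
  uniform_moments : ∀ p : ℝ, 1 < p → ∃ M : ℝ, ∀ ε ∈ Ioo (0 : ℝ) 1, ∀ z,
    ∫ ω, |ζ ε z ω| ^ p ∂P ≤ M

/-- The rescaled noise `ζ_ε(t,x) = ε^{-5/2} ζ(t/ε², x/ε)`. -/
def rescaledNoise {Ω : Type*} (ε : ℝ) (ζ : SpaceTime → Ω → ℝ) (z : SpaceTime) (ω : Ω) : ℝ :=
  ε ^ (-(5 / 2) : ℝ) * ζ (z.1 / ε ^ 2, fun i => z.2 i / ε) ω

/-! ### Test functions -/

/-- Test functions with `C²`-norm at most `1`, supported in the (parabolic) unit ball. -/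
structure IsTestFunction (φ : SpaceTime → ℝ) : Prop where
  contDiff : ContDiff ℝ 2 φ
  norm_le : ∀ j : ℕ, j ≤ 2 → ∀ z, ‖iteratedFDeriv ℝ j φ z‖ ≤ 1
  support : tsupport φ ⊆ {z | parabolicNorm z ≤ 1}

/-- `φ^r(t,x) = r^{-5} φ(t/r², x/r)`. -/
def rescaledTest (r : ℝ) (φ : SpaceTime → ℝ) (z : SpaceTime) : ℝ :=
  r ^ (-5 : ℝ) * φ (z.1 / r ^ 2, fun i => z.2 i / r)

/-! ### Pairings and graphs -/

/-- `π = {(k₁,ℓ₁), …, (kₙ,ℓₙ)}` is a pairing of `(k,ℓ)`. -/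
structure IsPairing (k l : ℕ) (π : Multiset (ℕ × ℕ)) : Prop where
  pos : ∀ b ∈ π, 1 ≤ b.1 ∧ 1 ≤ b.2
  sum_fst : (π.map Prod.fst).sum = k
  sum_snd : (π.map Prod.snd).sum = l

section Graphs

variable {Ω : Type*} [MeasurableSpace Ω] (P : Measure Ω) (η : SpaceTime → Ω → ℝ)
  (K : SpaceTime → ℝ)

/-- The integrand of one cumulant block of type `b = (b₁,b₂)`: `b₁` noise vertices `x` attached to
`w`, `b₂` noise vertices `y` attached to `v`, and the joint cumulant of the field `η` at all of
these points. -/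
def blockIntegrand (b : ℕ × ℕ) (v w : SpaceTime)
    (q : (Fin b.1 → SpaceTime) × (Fin b.2 → SpaceTime)) : ℝ :=
  (∏ i, K (w - q.1 i)) * (∏ j, K (v - q.2 j)) *
    jointCumulant P (fun i : Fin b.1 ⊕ Fin b.2 => η (Sum.elim q.1 q.2 i)) Finset.univ

/-- One cumulant block with its noise vertices integrated out. -/
def blockKernel (b : ℕ × ℕ) (v w : SpaceTime) : ℝ :=
  ∫ q, blockIntegrand P η K b v w q

/-- The cloud specified by `π`, with the kernels to `v` and `w` attached and all noise vertices
integrated out. Distinct blocks share no noise vertex, so that the integral over all of them is the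
product of the integrals over the blocks. -/
def cloudKernel (π : Multiset (ℕ × ℕ)) (v w : SpaceTime) : ℝ :=
  (π.map fun b => blockKernel P η K b v w).prod

/-- Integrand of the graph with the barred arrow `K(w-v) - K(-v)` from `v` to `w`. -/
def barredIntegrand (π : Multiset (ℕ × ℕ)) (ψ : SpaceTime → ℝ) (u : SpaceTime × SpaceTime) : ℝ :=
  ψ u.2 * (K (u.2 - u.1) - K (-u.1)) * cloudKernel P η K π u.1 u.2

/-- Integrand of the graph with the plain arrow from `v` to the origin. -/
def rootedIntegrand (π : Multiset (ℕ × ℕ)) (ψ : SpaceTime → ℝ) (u : SpaceTime × SpaceTime) : ℝ :=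
  ψ u.2 * K (-u.1) * cloudKernel P η K π u.1 u.2

/-- Integrand of the mass renormalisation constant: the plain arrow goes from `v` to the origin,
and so do the kernels of the `k` noise vertices. -/
def massIntegrand (π : Multiset (ℕ × ℕ)) (v : SpaceTime) : ℝ :=
  K (-v) * cloudKernel P η K π v 0

/-- All integrals that enter the graphs converge absolutely. -/
structure GraphsConverge (π : Multiset (ℕ × ℕ)) (ψ : SpaceTime → ℝ) : Prop where
  block : ∀ b ∈ π, ∀ v w, Integrable (blockIntegrand P η K b v w)
  barred : Integrable (barredIntegrand P η K π ψ)
  rooted : Integrable (rootedIntegrand P η K π ψ)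
  mass : Integrable (massIntegrand P η K π)

variable (ε : ℝ) (k l : ℕ) (π : Multiset (ℕ × ℕ)) (ψ : SpaceTime → ℝ)

/-- The contribution of the contraction `π` to the `0`-th chaos of the Wick renormalised object
`ℰ^{⌊(k-1)/2⌋}(Ψ^k ℐ(ℰ^{⌊l/2⌋-1} Ψ^l))` tested against `ψ`, before mass renormalisation. -/
def zerothChaos : ℝ :=
  ε ^ (((k : ℝ) + l - 4) / 2) * ∫ u, barredIntegrand P η K π ψ u

/-- The mass renormalisation constant `C_{k,l,π}`. -/
def massConstant : ℝ :=
  ε ^ (((k : ℝ) + l - 4) / 2) * ∫ v, massIntegrand P η K π v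

/-- The `0`-th chaos contribution after subtraction of the mass renormalisation constant. -/
def renormalisedZerothChaos : ℝ :=
  zerothChaos P η K ε k l π ψ - massConstant P η K ε k l π * ∫ w, ψ w

/-- The graph in which the arrow between the two inner vertices has been replaced by a plain arrow
from `v` to the origin. -/
def rootedGraph : ℝ :=
  ε ^ (((k : ℝ) + l - 4) / 2) * ∫ u, rootedIntegrand P η K π ψ u

end Graphs

end

/-!
Everything is measured with the parabolic size of the torus, `torusSize`, for which space-time has
dimension `5`; the kernel has an integrable singularity of order `3` at the origin.

**Upper bound.** Cumulants of the noise vanish unless their arguments form a cluster of parabolic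
diameter of order `ε` (`jointCumulant_noise_eq_zero`), and are bounded by moments. Fixing one vertex
of the cluster, the integral over the others smoothens the attached kernels at scale `ε`, and a
block with `n` noise vertices is bounded by `ε ^ (-n/2)` times `(ε / d) ^ a`, where `d` is the
distance of `v` and `w` (`exists_abs_blockKernel_le`). Here `a > 0` can be anything up to `1` for a
covariance block, and up to `5/2` for the other blocks. As the prefactor of the graph is
`ε ^ ((k + l)/2 - 2)`, all that matters is the total order `A` of the blocks: it is `2` for the
pairwise contraction of `(2, 2)` and at least `5/2` otherwise (`le_sum_blockOrder`). For
`A ≤ 2 + κ`, the convolution of `d ^ (-A)` with the kernel has a singularity of order at most `κ`,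
so that the graph is at most of order `ε ^ (A - 2) * r ^ (-κ)` (`exists_abs_rootedGraph_le`). The
identity between the renormalised graph and the rooted one is the translation invariance of the
clouds: the arrow from `v` to `w` integrates to the mass times the integral of the test function
(`integrable_and_integral_arrow`).

**Optimality.** The pairwise contraction has no prefactor, and is the integral of
`φ(w) K(-v) g(v - r w) ^ 2`, where `g` is the covariance of the noise convolved with `K`. As
`ε → 0`, `g` converges to the periodised correlation of the kernel with itself
(`tendsto_blockKernel_covariance`), because the covariance of the noise has integral `1` over a
period and concentrates on the lattice. That limit is of order `|t| ^ (-1/2)` in a parabolic cone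
around the negative time axis, where the kernel `K(-v)` is of order `|t| ^ (-3/2)`; the cone has
sections of volume `|t| ^ (3/2)`, so that `K(-v)` times the square of the limit has infinite
integral (`lintegral_kernel_mul_periodicCorrelation_sq`). By Fatou's lemma, the graph is unbounded
along any sequence on which `ε` and `r` tend to `0` (`not_bounded_integral_rootedIntegrand`).
Letting `ε` tend to `0` much faster than `r` contradicts a bound by `ε ^ θ * r ^ (-δ)` with `θ > 0`.
-/

/-! ### The periodic parabolic size -/

/-- The parabolic distance to `0` on `ℝ × (ℝ / ℤ)³`, as a function on `ℝ × ℝ³`. -/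
noncomputable def torusSize (z : SpaceTime) : ℝ :=
  Real.sqrt |z.1| + ∑ i, ‖((z.2 i : ℝ) : AddCircle (1 : ℝ))‖

theorem torusSize_nonneg (z : SpaceTime) : 0 ≤ torusSize z := by
  unfold torusSize; positivity

theorem torusSize_neg (z : SpaceTime) : torusSize (-z) = torusSize z := by
  simp [torusSize]

theorem torusSize_sub_comm (z w : SpaceTime) : torusSize (z - w) = torusSize (w - z) := by
  rw [← torusSize_neg, neg_sub]

theorem sqrt_abs_add_le (a b : ℝ) : Real.sqrt |a + b| ≤ Real.sqrt |a| + Real.sqrt |b| := by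
  rw [Real.sqrt_le_left (by positivity)]
  have h1 := Real.sq_sqrt (abs_nonneg a)
  have h2 := Real.sq_sqrt (abs_nonneg b)
  nlinarith [abs_add_le a b, Real.sqrt_nonneg |a|, Real.sqrt_nonneg |b|,
    mul_nonneg (Real.sqrt_nonneg |a|) (Real.sqrt_nonneg |b|)]

theorem torusSize_add_le (z w : SpaceTime) : torusSize (z + w) ≤ torusSize z + torusSize w := by
  unfold torusSize
  have h1 := sqrt_abs_add_le z.1 w.1
  have h2 : ∑ i, ‖(((z + w).2 i : ℝ) : AddCircle (1 : ℝ))‖ ≤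
      ∑ i, (‖((z.2 i : ℝ) : AddCircle (1 : ℝ))‖ + ‖((w.2 i : ℝ) : AddCircle (1 : ℝ))‖) := by
    refine Finset.sum_le_sum fun i _ => ?_
    have : (((z + w).2 i : ℝ) : AddCircle (1 : ℝ)) = (z.2 i : ℝ) + (w.2 i : ℝ) := by
      simp
    rw [this]
    exact norm_add_le _ _
  rw [Finset.sum_add_distrib] at h2
  simp only [Prod.fst_add] at *
  linarith

theorem torusSize_sub_le (x y z : SpaceTime) :
    torusSize (x - z) ≤ torusSize (x - y) + torusSize (y - z) := by
  simpa using torusSize_add_le (x - y) (y - z)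

theorem continuous_torusSize : Continuous torusSize := by
  unfold torusSize
  have h : ∀ i : Fin 3, Continuous fun z : SpaceTime => ((z.2 i : ℝ) : AddCircle (1 : ℝ)) :=
    fun i => (AddCircle.continuous_mk' 1).comp (by fun_prop)
  exact (by fun_prop : Continuous fun z : SpaceTime => Real.sqrt |z.1|).add
    (continuous_finsetSum _ fun i _ => (h i).norm)

@[fun_prop]
theorem measurable_torusSize : Measurable torusSize := continuous_torusSize.measurable

theorem norm_coe_addCircle_le (x : ℝ) : ‖(x : AddCircle (1 : ℝ))‖ ≤ |x| := by
  rw [UnitAddCircle.norm_eq]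
  simpa using round_le x 0

theorem torusSize_le_parabolicNorm (z : SpaceTime) : torusSize z ≤ parabolicNorm z := by
  unfold torusSize parabolicNorm
  gcongr
  exact norm_coe_addCircle_le _

theorem torusSize_add_int (z : SpaceTime) (n : Fin 3 → ℤ) :
    torusSize (z.1, fun i => z.2 i + n i) = torusSize z := by
  unfold torusSize
  congr 1
  refine Finset.sum_congr rfl fun i _ => ?_
  simp only [UnitAddCircle.norm_eq, round_add_intCast, Int.cast_add]
  ring_nf

theorem abs_fst_le_norm (z : SpaceTime) : |z.1| ≤ ‖z‖ := norm_fst_le z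

theorem abs_snd_le_norm (z : SpaceTime) (i : Fin 3) : |z.2 i| ≤ ‖z‖ :=
  (norm_le_pi_norm z.2 i).trans (norm_snd_le z)

theorem torusSize_le_of_norm_le {z : SpaceTime} {M : ℝ} (h : ‖z‖ ≤ M) :
    torusSize z ≤ M + 3 := by
  have hM : 0 ≤ M := (norm_nonneg z).trans h
  unfold torusSize
  have h1 : Real.sqrt |z.1| ≤ M + 1 := by
    rw [Real.sqrt_le_left (by linarith)]
    have := (abs_fst_le_norm z).trans h
    nlinarith
  have h2 : ∑ i, ‖((z.2 i : ℝ) : AddCircle (1 : ℝ))‖ ≤ ∑ _i : Fin 3, (1 / 2 : ℝ) := by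
    refine Finset.sum_le_sum fun i _ => ?_
    simpa using AddCircle.norm_le_half_period (1 : ℝ) (x := ((z.2 i : ℝ) : AddCircle (1 : ℝ)))
      one_ne_zero
  have h3 : ∑ _i : Fin 3, (1 / 2 : ℝ) = 3 / 2 := by norm_num
  linarith

/-- In one dimension, the points of an interval that are `ρ`-close to `a` modulo `ℤ` are covered by
a bounded number of intervals of length `2 ρ`. -/
theorem volume_closedBall_inter_addCircle_le (M : ℝ) (hM : 0 ≤ M) (u a ρ : ℝ) (hρ : 0 ≤ ρ) :
    volume {s : ℝ | |s - u| ≤ M ∧ ‖((s - a : ℝ) : AddCircle (1 : ℝ))‖ ≤ ρ} ≤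
      ENNReal.ofReal ((2 * M + 6) * (2 * ρ)) := by
  set I : Finset ℤ := Finset.Icc ⌊u - M - a - 1⌋ ⌈u + M - a + 1⌉
  have hsub : {s : ℝ | |s - u| ≤ M ∧ ‖((s - a : ℝ) : AddCircle (1 : ℝ))‖ ≤ ρ} ⊆
      ⋃ n ∈ I, Metric.closedBall (a + (n : ℝ)) ρ := by
    rintro s ⟨h1, h2⟩
    rw [UnitAddCircle.norm_eq] at h2
    have h3 := abs_sub_round (s - a)
    rw [abs_le] at h1 h3
    simp only [mem_iUnion, exists_prop]
    refine ⟨round (s - a), ?_, ?_⟩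
    · rw [Finset.mem_Icc]
      constructor
      · exact_mod_cast (Int.floor_le _).trans (by linarith : _ ≤ ((round (s - a) : ℤ) : ℝ))
      · exact_mod_cast (by linarith : ((round (s - a) : ℤ) : ℝ) ≤ _).trans (Int.le_ceil _)
    · rw [Metric.mem_closedBall, Real.dist_eq]
      convert h2 using 2
      ring
  have hcard : (I.card : ℝ) ≤ 2 * M + 6 := by
    have h1 : ⌊u - M - a - 1⌋ ≤ ⌈u + M - a + 1⌉ + 1 := by
      have := Int.floor_le (u - M - a - 1)
      have h' := Int.le_ceil (u + M - a + 1)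
      have : ((⌊u - M - a - 1⌋ : ℤ) : ℝ) ≤ ((⌈u + M - a + 1⌉ + 1 : ℤ) : ℝ) := by
        push_cast; linarith
      exact_mod_cast this
    have h2 : ((I.card : ℤ) : ℝ) = ((⌈u + M - a + 1⌉ + 1 - ⌊u - M - a - 1⌋ : ℤ) : ℝ) := by
      rw [Int.card_Icc_of_le _ _ h1]
    have h3 := Int.lt_floor_add_one (u - M - a - 1)
    have h4 := Int.ceil_lt_add_one (u + M - a + 1)
    push_cast at h2
    linarith
  calc _ ≤ volume (⋃ n ∈ I, Metric.closedBall (a + (n : ℝ)) ρ) := measure_mono hsub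
    _ ≤ ∑ n ∈ I, volume (Metric.closedBall (a + (n : ℝ)) ρ) := measure_biUnion_finset_le _ _
    _ = I.card * ENNReal.ofReal (2 * ρ) := by
        simp only [Real.volume_closedBall, Finset.sum_const, nsmul_eq_mul]
    _ = ENNReal.ofReal (I.card * (2 * ρ)) := by
        rw [ENNReal.ofReal_mul (Nat.cast_nonneg I.card), ENNReal.ofReal_natCast]
    _ ≤ _ := ENNReal.ofReal_le_ofReal (by gcongr)

/-- The periodic parabolic balls have volume at most of order `ρ⁵`, locally and uniformly in the
location. -/
theorem exists_volume_torusSize_le (M : ℝ) (hM : 0 ≤ M) : ∃ C : ℝ, 0 ≤ C ∧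
    ∀ (u a : SpaceTime) (ρ : ℝ), 0 < ρ →
      (volume.restrict (Metric.closedBall u M)) {x | torusSize (x - a) ≤ ρ} ≤
        ENNReal.ofReal (C * ρ ^ 5) := by
  refine ⟨16 * (2 * M + 6) ^ 3, by positivity, fun u a ρ hρ => ?_⟩
  rw [Measure.restrict_apply (measurableSet_le (by fun_prop) measurable_const)]
  have hsub : {x | torusSize (x - a) ≤ ρ} ∩ Metric.closedBall u M ⊆
      Metric.closedBall a.1 (ρ ^ 2) ×ˢ Set.univ.pi fun i =>
        {s : ℝ | |s - u.2 i| ≤ M ∧ ‖((s - a.2 i : ℝ) : AddCircle (1 : ℝ))‖ ≤ ρ} := by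
    rintro x ⟨h1, h2⟩
    simp only [mem_ofPred_eq, torusSize] at h1
    have hs : ∀ i, ‖(((x - a).2 i : ℝ) : AddCircle (1 : ℝ))‖ ≤
        ∑ i, ‖(((x - a).2 i : ℝ) : AddCircle (1 : ℝ))‖ := fun i =>
      Finset.single_le_sum (f := fun i => ‖(((x - a).2 i : ℝ) : AddCircle (1 : ℝ))‖)
        (fun _ _ => norm_nonneg _) (Finset.mem_univ i)
    rw [mem_closedBall_iff_norm] at h2
    refine ⟨?_, fun i _ => ⟨?_, ?_⟩⟩
    · rw [Metric.mem_closedBall, Real.dist_eq]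
      have h0 := (norm_nonneg _).trans (hs 0)
      have : Real.sqrt |(x - a).1| ≤ ρ := by linarith
      rw [Real.sqrt_le_left hρ.le] at this
      exact this
    · exact (abs_snd_le_norm (x - u) i).trans h2
    · have := Real.sqrt_nonneg |(x - a).1|
      exact (hs i).trans (by linarith)
  refine (measure_mono hsub).trans ?_
  rw [Measure.volume_eq_prod, Measure.prod_prod, Real.volume_closedBall, volume_pi_pi]
  calc _ ≤ ENNReal.ofReal (2 * ρ ^ 2) * ∏ _i : Fin 3, ENNReal.ofReal ((2 * M + 6) * (2 * ρ)) := by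
        gcongr with i
        exact volume_closedBall_inter_addCircle_le M hM _ _ ρ hρ.le
    _ = _ := by
        rw [Finset.prod_const, ← ENNReal.ofReal_pow (by positivity), Finset.card_univ,
          Fintype.card_fin, ← ENNReal.ofReal_mul (by positivity)]
        congr 1
        ring

/-! ### Integrals of powers under a volume growth bound -/

/-- If sublevel sets `{f ≤ ρ}` have measure at most of order `ρ⁵`, then `f^{-p}` is integrable near
the zeros of `f` for `p < 5`, with the bound that scaling predicts. -/
theorem lintegral_rpow_neg_sublevel_le {α : Type*} [MeasurableSpace α] (μ : Measure α)
    {f : α → ℝ} (hf : Measurable f) (hf0 : ∀ x, 0 ≤ f x) {C : ℝ} (hC : 0 ≤ C)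
    (hμ : ∀ ρ : ℝ, 0 < ρ → μ {x | f x ≤ ρ} ≤ ENNReal.ofReal (C * ρ ^ 5))
    {p : ℝ} (hp0 : 0 ≤ p) (hp : p < 5) {ρ : ℝ} (hρ : 0 < ρ) :
    ∫⁻ x in {x | f x ≤ ρ}, ENNReal.ofReal (f x ^ (-p)) ∂μ ≤
      ENNReal.ofReal (C * (2 ^ p * (1 - (2 : ℝ)⁻¹ ^ (5 - p))⁻¹) * ρ ^ (5 - p)) := by
  have hmeas : ∀ r : ℝ, MeasurableSet {x | f x ≤ r} := fun r => measurableSet_le hf measurable_const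
  -- Dominate by the constants that bound `f ^ (-p)` on dyadic shells.
  set g : ℕ → α → ENNReal := fun k => {x | f x ≤ (2 : ℝ)⁻¹ ^ k * ρ}.indicator
    (fun _ => ENNReal.ofReal (((2 : ℝ)⁻¹ ^ (k + 1) * ρ) ^ (-p)))
  have hpt : ∀ x ∈ {x | f x ≤ ρ}, ENNReal.ofReal (f x ^ (-p)) ≤ ∑' k, g k x := by
    intro x hx
    have hx' : f x ≤ ρ := hx
    rcases eq_or_lt_of_le (hf0 x) with h0 | h0
    -- At a zero of `f` the junk value `0 ^ (-p) = 0` is harmless, except for `0 ^ 0 = 1`.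
    · rcases eq_or_lt_of_le hp0 with hp' | hp'
      · refine le_trans ?_ (ENNReal.le_tsum 0)
        simp [g, ← hp', hx']
      · rw [← h0, Real.zero_rpow (by linarith)]
        simp
    · obtain ⟨k, hk1, hk2⟩ := exists_nat_pow_near_of_lt_one (x := f x / ρ) (y := (2 : ℝ)⁻¹)
        (by positivity) ((div_le_one hρ).2 hx') (by norm_num) (by norm_num)
      rw [div_le_iff₀ hρ] at hk2
      rw [lt_div_iff₀ hρ] at hk1
      refine le_trans ?_ (ENNReal.le_tsum k)
      simp only [g]
      rw [indicator_of_mem (by exact hk2)]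
      exact ENNReal.ofReal_le_ofReal
        (Real.rpow_le_rpow_of_nonpos (by positivity) hk1.le (by linarith))
  have hint : ∀ k, ∫⁻ x, g k x ∂μ ≤
      ENNReal.ofReal (C * 2 ^ p * ρ ^ (5 - p) * ((2 : ℝ)⁻¹ ^ (5 - p)) ^ k) := by
    intro k
    simp only [g]
    rw [lintegral_indicator_const (hmeas _)]
    refine (mul_le_mul_right (hμ _ (by positivity)) _).trans ?_
    rw [← ENNReal.ofReal_mul (by positivity)]
    refine ENNReal.ofReal_le_ofReal (le_of_eq ?_)
    have h2k : (0 : ℝ) < 2⁻¹ ^ k * ρ := by positivity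
    have e1 : ((2 : ℝ)⁻¹ ^ (k + 1) * ρ) ^ (-p) =
        2 ^ p * ((2⁻¹ ^ k * ρ) ^ (5 - p) / (2⁻¹ ^ k * ρ) ^ 5) := by
      rw [← Real.rpow_sub_natCast h2k.ne', show 5 - p - (5 : ℕ) = -p by push_cast; ring,
        show (2 : ℝ)⁻¹ ^ (k + 1) * ρ = 2⁻¹ * (2⁻¹ ^ k * ρ) by ring,
        Real.mul_rpow (by norm_num) h2k.le, Real.inv_rpow (by norm_num),
        Real.rpow_neg (by norm_num), inv_inv]
    have e2 : ((2 : ℝ)⁻¹ ^ (5 - p)) ^ k = (2⁻¹ ^ k) ^ (5 - p) := by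
      rw [← Real.rpow_natCast, ← Real.rpow_mul (by norm_num), mul_comm,
        Real.rpow_mul (by norm_num), Real.rpow_natCast]
    rw [e1, e2, Real.mul_rpow (by positivity) hρ.le]
    field_simp
  have hr : (2 : ℝ)⁻¹ ^ (5 - p) < 1 := Real.rpow_lt_one (by norm_num) (by norm_num) (by linarith)
  have hr0 : 0 ≤ (2 : ℝ)⁻¹ ^ (5 - p) := by positivity
  calc _ ≤ ∫⁻ x in {x | f x ≤ ρ}, ∑' k, g k x ∂μ := setLIntegral_mono' (hmeas ρ) hpt
    _ ≤ ∫⁻ x, ∑' k, g k x ∂μ := setLIntegral_le_lintegral _ _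
    _ = ∑' k, ∫⁻ x, g k x ∂μ := lintegral_tsum fun k =>
        (measurable_const.indicator (hmeas _)).aemeasurable
    _ ≤ ∑' k, ENNReal.ofReal (C * 2 ^ p * ρ ^ (5 - p) * ((2 : ℝ)⁻¹ ^ (5 - p)) ^ k) :=
        ENNReal.tsum_le_tsum hint
    _ = ENNReal.ofReal (∑' k, C * 2 ^ p * ρ ^ (5 - p) * ((2 : ℝ)⁻¹ ^ (5 - p)) ^ k) :=
        (ENNReal.ofReal_tsum_of_nonneg (fun k => by positivity)
          ((summable_geometric_of_lt_one hr0 hr).mul_left _)).symm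
    _ = _ := by
        rw [tsum_mul_left, tsum_geometric_of_lt_one hr0 hr]
        congr 1
        ring

/-- The counterpart of `lintegral_rpow_neg_sublevel_le` away from the zeros of `f`, for `p > 5`. -/
theorem lintegral_rpow_neg_superlevel_le {α : Type*} [MeasurableSpace α] (μ : Measure α)
    {f : α → ℝ} (hf : Measurable f) {C : ℝ} (hC : 0 ≤ C)
    (hμ : ∀ ρ : ℝ, 0 < ρ → μ {x | f x ≤ ρ} ≤ ENNReal.ofReal (C * ρ ^ 5))
    {p : ℝ} (hp : 5 < p) {ρ : ℝ} (hρ : 0 < ρ) :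
    ∫⁻ x in {x | ρ ≤ f x}, ENNReal.ofReal (f x ^ (-p)) ∂μ ≤
      ENNReal.ofReal (C * (32 * (1 - (2 : ℝ) ^ (5 - p))⁻¹) * ρ ^ (5 - p)) := by
  have hmeas : ∀ r : ℝ, MeasurableSet {x | f x ≤ r} := fun r => measurableSet_le hf measurable_const
  set g : ℕ → α → ENNReal := fun k => {x | f x ≤ (2 : ℝ) ^ (k + 1) * ρ}.indicator
    (fun _ => ENNReal.ofReal (((2 : ℝ) ^ k * ρ) ^ (-p)))
  have hpt : ∀ x ∈ {x | ρ ≤ f x}, ENNReal.ofReal (f x ^ (-p)) ≤ ∑' k, g k x := by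
    intro x hx
    have hx' : ρ ≤ f x := hx
    obtain ⟨k, hk1, hk2⟩ := exists_nat_pow_near (x := f x / ρ) (y := (2 : ℝ))
      ((one_le_div hρ).2 hx') (by norm_num)
    rw [div_lt_iff₀ hρ] at hk2
    rw [le_div_iff₀ hρ] at hk1
    refine le_trans ?_ (ENNReal.le_tsum k)
    simp only [g]
    rw [indicator_of_mem (by exact hk2.le)]
    exact ENNReal.ofReal_le_ofReal
      (Real.rpow_le_rpow_of_nonpos (by positivity) hk1 (by linarith))
  have hint : ∀ k, ∫⁻ x, g k x ∂μ ≤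
      ENNReal.ofReal (C * 32 * ρ ^ (5 - p) * ((2 : ℝ) ^ (5 - p)) ^ k) := by
    intro k
    simp only [g]
    rw [lintegral_indicator_const (hmeas _)]
    refine (mul_le_mul_right (hμ _ (by positivity)) _).trans ?_
    rw [← ENNReal.ofReal_mul (by positivity)]
    refine ENNReal.ofReal_le_ofReal (le_of_eq ?_)
    have h2k : (0 : ℝ) < 2 ^ k := by positivity
    have e1 : ((2 : ℝ) ^ k * ρ) ^ (-p) = (2 ^ k * ρ) ^ (5 - p) / (2 ^ k * ρ) ^ 5 := by
      rw [show -p = (5 - p) - (5 : ℕ) by push_cast; ring, Real.rpow_sub_natCast (by positivity)]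
    have e2 : ((2 : ℝ) ^ (5 - p)) ^ k = (2 ^ k) ^ (5 - p) := by
      rw [← Real.rpow_natCast, ← Real.rpow_mul (by norm_num), mul_comm,
        Real.rpow_mul (by norm_num), Real.rpow_natCast]
    rw [e1, e2, Real.mul_rpow (by positivity) hρ.le]
    field_simp
    ring
  have hr : (2 : ℝ) ^ (5 - p) < 1 := Real.rpow_lt_one_of_one_lt_of_neg (by norm_num) (by linarith)
  have hr0 : 0 ≤ (2 : ℝ) ^ (5 - p) := by positivity
  calc _ ≤ ∫⁻ x in {x | ρ ≤ f x}, ∑' k, g k x ∂μ :=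
        setLIntegral_mono' (measurableSet_le measurable_const hf) hpt
    _ ≤ ∫⁻ x, ∑' k, g k x ∂μ := setLIntegral_le_lintegral _ _
    _ = ∑' k, ∫⁻ x, g k x ∂μ := lintegral_tsum fun k =>
        (measurable_const.indicator (hmeas _)).aemeasurable
    _ ≤ ∑' k, ENNReal.ofReal (C * 32 * ρ ^ (5 - p) * ((2 : ℝ) ^ (5 - p)) ^ k) :=
        ENNReal.tsum_le_tsum hint
    _ = ENNReal.ofReal (∑' k, C * 32 * ρ ^ (5 - p) * ((2 : ℝ) ^ (5 - p)) ^ k) :=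
        (ENNReal.ofReal_tsum_of_nonneg (fun k => by positivity)
          ((summable_geometric_of_lt_one hr0 hr).mul_left _)).symm
    _ = _ := by
        rw [tsum_mul_left, tsum_geometric_of_lt_one hr0 hr]
        congr 1
        ring

/-- The convolution estimate for powers of two distance functions, in a space of volume growth `ρ⁵`:
split the domain into the points close to the first zero, those close to the second zero, and the
rest, on which Young's inequality applies. -/
theorem exists_lintegral_rpow_mul_rpow_le {C : ℝ} (hC : 0 ≤ C) {p q : ℝ} (hp0 : 0 ≤ p)
    (hp : p < 5) (hq0 : 0 ≤ q) (hq : q < 5) (hpq : 5 < p + q) :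
    ∃ A : ℝ, 0 ≤ A ∧ ∀ (μ : Measure SpaceTime) (f g : SpaceTime → ℝ), Measurable f → Measurable g →
      (∀ x, 0 ≤ f x) → (∀ x, 0 ≤ g x) →
      (∀ ρ : ℝ, 0 < ρ → μ {x | f x ≤ ρ} ≤ ENNReal.ofReal (C * ρ ^ 5)) →
      (∀ ρ : ℝ, 0 < ρ → μ {x | g x ≤ ρ} ≤ ENNReal.ofReal (C * ρ ^ 5)) →
      ∀ τ : ℝ, 0 < τ → (∀ x, τ ≤ f x + g x) →
        ∫⁻ x, ENNReal.ofReal (f x ^ (-p) * g x ^ (-q)) ∂μ ≤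
          ENNReal.ofReal (A * τ ^ (5 - p - q)) := by
  set A₁ : ℝ := C * (2 ^ p * (1 - (2 : ℝ)⁻¹ ^ (5 - p))⁻¹)
  set A₂ : ℝ := C * (2 ^ q * (1 - (2 : ℝ)⁻¹ ^ (5 - q))⁻¹)
  set A₃ : ℝ := C * (32 * (1 - (2 : ℝ) ^ (5 - (p + q)))⁻¹)
  have hA₁ : 0 ≤ A₁ := by
    have : (2 : ℝ)⁻¹ ^ (5 - p) ≤ 1 := Real.rpow_le_one (by norm_num) (by norm_num) (by linarith)
    have : 0 ≤ (1 - (2 : ℝ)⁻¹ ^ (5 - p))⁻¹ := inv_nonneg.2 (by linarith)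
    positivity
  have hA₂ : 0 ≤ A₂ := by
    have : (2 : ℝ)⁻¹ ^ (5 - q) ≤ 1 := Real.rpow_le_one (by norm_num) (by norm_num) (by linarith)
    have : 0 ≤ (1 - (2 : ℝ)⁻¹ ^ (5 - q))⁻¹ := inv_nonneg.2 (by linarith)
    positivity
  have hA₃ : 0 ≤ A₃ := by
    have : (2 : ℝ) ^ (5 - (p + q)) ≤ 1 :=
      Real.rpow_le_one_of_one_le_of_nonpos (by norm_num) (by linarith)
    have : 0 ≤ (1 - (2 : ℝ) ^ (5 - (p + q)))⁻¹ := inv_nonneg.2 (by linarith)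
    positivity
  refine ⟨(A₁ + A₂ + 2 * A₃) * 2⁻¹ ^ (5 - p - q), by positivity, ?_⟩
  intro μ f g hf hg hf0 hg0 hμf hμg τ hτ hfg
  set σ : ℝ := 2⁻¹ * τ with hσdef
  have hσ : 0 < σ := by positivity
  have hmeas : Measurable fun x => ENNReal.ofReal (f x ^ (-p) * g x ^ (-q)) := by fun_prop
  have hcover : (univ : Set SpaceTime) ⊆
      {x | f x ≤ σ} ∪ {x | g x ≤ σ} ∪ ({x | σ ≤ f x} ∩ {x | σ ≤ g x}) := by
    intro x _
    by_cases h1 : f x ≤ σ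
    · exact Or.inl (Or.inl h1)
    · by_cases h2 : g x ≤ σ
      · exact Or.inl (Or.inr h2)
      · exact Or.inr ⟨(not_le.1 h1).le, (not_le.1 h2).le⟩
  have h1 : ∫⁻ x in {x | f x ≤ σ}, ENNReal.ofReal (f x ^ (-p) * g x ^ (-q)) ∂μ ≤
      ENNReal.ofReal (A₁ * σ ^ (5 - p - q)) := by
    calc _ ≤ ∫⁻ x in {x | f x ≤ σ}, ENNReal.ofReal (f x ^ (-p)) * ENNReal.ofReal (σ ^ (-q)) ∂μ := by
          refine setLIntegral_mono' (measurableSet_le hf measurable_const) fun x hx => ?_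
          have hx' : f x ≤ σ := hx
          rw [← ENNReal.ofReal_mul (Real.rpow_nonneg (hf0 x) _)]
          refine ENNReal.ofReal_le_ofReal
            (mul_le_mul_of_nonneg_left ?_ (Real.rpow_nonneg (hf0 x) _))
          refine Real.rpow_le_rpow_of_nonpos hσ ?_ (by linarith)
          have := hfg x
          linarith
      _ ≤ ENNReal.ofReal (A₁ * σ ^ (5 - p)) * ENNReal.ofReal (σ ^ (-q)) := by
          rw [lintegral_mul_const _ (by fun_prop)]
          gcongr
          exact lintegral_rpow_neg_sublevel_le μ hf hf0 hC hμf hp0 hp hσ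
      _ = _ := by
          rw [← ENNReal.ofReal_mul (by positivity), mul_assoc, ← Real.rpow_add hσ,
            sub_eq_add_neg _ q]
  have h2 : ∫⁻ x in {x | g x ≤ σ}, ENNReal.ofReal (f x ^ (-p) * g x ^ (-q)) ∂μ ≤
      ENNReal.ofReal (A₂ * σ ^ (5 - p - q)) := by
    calc _ ≤ ∫⁻ x in {x | g x ≤ σ}, ENNReal.ofReal (g x ^ (-q)) * ENNReal.ofReal (σ ^ (-p)) ∂μ := by
          refine setLIntegral_mono' (measurableSet_le hg measurable_const) fun x hx => ?_
          have hx' : g x ≤ σ := hx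
          rw [← ENNReal.ofReal_mul (Real.rpow_nonneg (hg0 x) _), mul_comm]
          refine ENNReal.ofReal_le_ofReal
            (mul_le_mul_of_nonneg_left ?_ (Real.rpow_nonneg (hg0 x) _))
          refine Real.rpow_le_rpow_of_nonpos hσ ?_ (by linarith)
          have := hfg x
          linarith
      _ ≤ ENNReal.ofReal (A₂ * σ ^ (5 - q)) * ENNReal.ofReal (σ ^ (-p)) := by
          rw [lintegral_mul_const _ (by fun_prop)]
          gcongr
          exact lintegral_rpow_neg_sublevel_le μ hg hg0 hC hμg hq0 hq hσ
      _ = _ := by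
          rw [← ENNReal.ofReal_mul (by positivity), mul_assoc, ← Real.rpow_add hσ,
            show 5 - q + -p = 5 - p - q by ring]
  have h3 : ∫⁻ x in {x | σ ≤ f x} ∩ {x | σ ≤ g x}, ENNReal.ofReal (f x ^ (-p) * g x ^ (-q)) ∂μ ≤
      ENNReal.ofReal (2 * A₃ * σ ^ (5 - p - q)) := by
    calc _ ≤ ∫⁻ x in {x | σ ≤ f x} ∩ {x | σ ≤ g x},
            (ENNReal.ofReal (f x ^ (-(p + q))) + ENNReal.ofReal (g x ^ (-(p + q)))) ∂μ := by
          refine setLIntegral_mono' ((measurableSet_le measurable_const hf).inter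
            (measurableSet_le measurable_const hg)) fun x hx => ?_
          have hx1 : 0 < f x := hσ.trans_le hx.1
          have hx2 : 0 < g x := hσ.trans_le hx.2
          rw [← ENNReal.ofReal_add (by positivity) (by positivity)]
          refine ENNReal.ofReal_le_ofReal ?_
          rw [neg_add, Real.rpow_add hx1, Real.rpow_add hx2]
          rcases le_total (f x) (g x) with h | h
          · have := Real.rpow_le_rpow_of_nonpos hx1 h (by linarith : -q ≤ 0)
            have := mul_le_mul_of_nonneg_left this (Real.rpow_nonneg hx1.le (-p))
            have : 0 ≤ g x ^ (-p) * g x ^ (-q) := by positivity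
            linarith
          · have := Real.rpow_le_rpow_of_nonpos hx2 h (by linarith : -p ≤ 0)
            have := mul_le_mul_of_nonneg_right this (Real.rpow_nonneg hx2.le (-q))
            have : 0 ≤ f x ^ (-p) * f x ^ (-q) := by positivity
            linarith
      _ ≤ (∫⁻ x in {x | σ ≤ f x}, ENNReal.ofReal (f x ^ (-(p + q))) ∂μ) +
            ∫⁻ x in {x | σ ≤ g x}, ENNReal.ofReal (g x ^ (-(p + q))) ∂μ := by
          rw [lintegral_add_left (by fun_prop)]
          gcongr
          · exact inter_subset_left
          · exact inter_subset_right
      _ ≤ ENNReal.ofReal (A₃ * σ ^ (5 - (p + q))) + ENNReal.ofReal (A₃ * σ ^ (5 - (p + q))) := by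
          gcongr
          · exact lintegral_rpow_neg_superlevel_le μ hf hC hμf hpq hσ
          · exact lintegral_rpow_neg_superlevel_le μ hg hC hμg hpq hσ
      _ = _ := by
          rw [← ENNReal.ofReal_add (by positivity) (by positivity),
            show 5 - (p + q) = 5 - p - q by ring]
          congr 1
          ring
  calc _ = ∫⁻ x in univ, ENNReal.ofReal (f x ^ (-p) * g x ^ (-q)) ∂μ := by
        rw [setLIntegral_univ]
    _ ≤ _ := lintegral_mono_set hcover
    _ ≤ _ := (lintegral_union_le _ _ _).trans (add_le_add_left (lintegral_union_le _ _ _) _)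
    _ ≤ _ := add_le_add (add_le_add h1 h2) h3
    _ = _ := by
        rw [← ENNReal.ofReal_add (by positivity) (by positivity),
          ← ENNReal.ofReal_add (by positivity) (by positivity), hσdef,
          Real.mul_rpow (by norm_num) hτ.le]
        congr 1
        ring

/-- The convolution estimate for powers of the periodic parabolic size. -/
theorem exists_lintegral_torusSize_rpow_mul_rpow_le (M : ℝ) (hM : 0 ≤ M) {p q : ℝ} (hp0 : 0 ≤ p)
    (hp : p < 5) (hq0 : 0 ≤ q) (hq : q < 5) (hpq : 5 < p + q) :
    ∃ A : ℝ, 0 ≤ A ∧ ∀ u a b : SpaceTime, 0 < torusSize (a - b) →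
      ∫⁻ x in Metric.closedBall u M,
          ENNReal.ofReal (torusSize (x - a) ^ (-p) * torusSize (x - b) ^ (-q)) ≤
        ENNReal.ofReal (A * torusSize (a - b) ^ (5 - p - q)) := by
  obtain ⟨C, hC, hvol⟩ := exists_volume_torusSize_le M hM
  obtain ⟨A, hA, h⟩ := exists_lintegral_rpow_mul_rpow_le hC hp0 hp hq0 hq hpq
  refine ⟨A, hA, fun u a b hab => ?_⟩
  refine h _ (fun x => torusSize (x - a)) (fun x => torusSize (x - b)) (by fun_prop) (by fun_prop)
    (fun x => torusSize_nonneg _) (fun x => torusSize_nonneg _) (hvol u a) (hvol u b) _ hab ?_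
  intro x
  rw [torusSize_sub_comm x a]
  exact torusSize_sub_le a x b

/-- Local integrability of powers of the periodic parabolic size, with the bound that scaling
predicts. -/
theorem exists_lintegral_torusSize_rpow_le (M : ℝ) (hM : 0 ≤ M) {p : ℝ} (hp0 : 0 ≤ p)
    (hp : p < 5) :
    ∃ A : ℝ, 0 ≤ A ∧ ∀ (u a : SpaceTime) (ρ : ℝ), 0 < ρ →
      ∫⁻ x in {x | torusSize (x - a) ≤ ρ} ∩ Metric.closedBall u M,
          ENNReal.ofReal (torusSize (x - a) ^ (-p)) ≤
        ENNReal.ofReal (A * ρ ^ (5 - p)) := by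
  obtain ⟨C, hC, hvol⟩ := exists_volume_torusSize_le M hM
  refine ⟨C * (2 ^ p * (1 - (2 : ℝ)⁻¹ ^ (5 - p))⁻¹), ?_, fun u a ρ hρ => ?_⟩
  · have : (2 : ℝ)⁻¹ ^ (5 - p) ≤ 1 := Real.rpow_le_one (by norm_num) (by norm_num) (by linarith)
    have : 0 ≤ (1 - (2 : ℝ)⁻¹ ^ (5 - p))⁻¹ := inv_nonneg.2 (by linarith)
    positivity
  · have := lintegral_rpow_neg_sublevel_le (volume.restrict (Metric.closedBall u M))
      (f := fun x => torusSize (x - a)) (by fun_prop) (fun x => torusSize_nonneg _) hC (hvol u a)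
      hp0 hp hρ
    rwa [Measure.restrict_restrict (measurableSet_le (by fun_prop) measurable_const)] at this

theorem ae_torusSize_sub_pos (a : SpaceTime) : ∀ᵐ x : SpaceTime, 0 < torusSize (x - a) := by
  have h : volume {x : SpaceTime | x.1 = a.1} = 0 := by
    have : {x : SpaceTime | x.1 = a.1} = {a.1} ×ˢ univ := by ext; simp
    rw [this, Measure.volume_eq_prod, Measure.prod_prod]
    simp
  have h' : ∀ᵐ x : SpaceTime, x.1 ≠ a.1 := by
    rw [ae_iff]
    simpa using h
  filter_upwards [h'] with x hx
  have : 0 < Real.sqrt |(x - a).1| := Real.sqrt_pos.2 (abs_pos.2 (sub_ne_zero.2 hx))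
  unfold torusSize
  positivity

/-! ### Bounds on the truncated heat kernel -/

instance : (volume : Measure SpaceTime).IsAddHaarMeasure :=
  inferInstanceAs ((volume : Measure ℝ).prod (volume : Measure (Fin 3 → ℝ))).IsAddHaarMeasure

theorem continuous_parabolicNorm : Continuous parabolicNorm := by
  unfold parabolicNorm; fun_prop

theorem parabolicNorm_nonneg (z : SpaceTime) : 0 ≤ parabolicNorm z := by
  unfold parabolicNorm; positivity

theorem parabolicNorm_zero : parabolicNorm 0 = 0 := by simp [parabolicNorm]

theorem heatKernel_nonneg (z : SpaceTime) : 0 ≤ heatKernel z := by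
  unfold heatKernel
  split_ifs with h
  · have := Real.pi_pos
    positivity
  · exact le_rfl

/-- The heat kernel is bounded by the parabolic size to the power `-3`: with `σ = ∑ |xᵢ| / √t`, this
is the inequality `(1 + σ)³ ≤ 1000 exp (σ² / 12)`. -/
theorem heatKernel_le (z : SpaceTime) : heatKernel z ≤ 1000 * parabolicNorm z ^ (-3 : ℝ) := by
  have hnn := parabolicNorm_nonneg z
  unfold heatKernel
  split_ifs with h
  · set t := z.1
    set s := ∑ i, |z.2 i| with hs
    set r := Real.sqrt t with hr
    have hr0 : 0 < r := Real.sqrt_pos.2 h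
    have hrt : r ^ 2 = t := Real.sq_sqrt h.le
    have hs0 : 0 ≤ s := by positivity
    have hN : parabolicNorm z = r + s := by
      simp only [parabolicNorm]
      rw [abs_of_pos h]
    have hs2 : s ^ 2 ≤ 3 * ∑ i, z.2 i ^ 2 := by
      have := sq_sum_le_card_mul_sum_sq (s := (Finset.univ : Finset (Fin 3)))
        (f := fun i => |z.2 i|)
      simpa using this
    have h1 : (4 * Real.pi * t) ^ (-(3 / 2) : ℝ) ≤ (r ^ 3)⁻¹ := by
      have e : (r ^ 3)⁻¹ = t ^ (-(3 / 2) : ℝ) := by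
        rw [← hrt, ← Real.rpow_natCast r 2, ← Real.rpow_mul hr0.le, ← Real.rpow_natCast r 3,
          ← Real.rpow_neg hr0.le]
        norm_num
      rw [e]
      refine Real.rpow_le_rpow_of_nonpos h ?_ (by norm_num)
      nlinarith [Real.pi_gt_three]
    have h2 : (r + s) / r ≤ 10 * Real.exp ((s / r) ^ 2 / 36) := by
      have h3 := Real.add_one_le_exp ((s / r) ^ 2 / 36)
      have h4 : (r + s) / r = 1 + s / r := by field_simp
      rw [h4]
      nlinarith [sq_nonneg (s / r - 18), sq_nonneg (s / r)]
    have h3 : ((r + s) / r) ^ 3 ≤ 1000 * Real.exp ((∑ i, z.2 i ^ 2) / (4 * t)) := by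
      calc ((r + s) / r) ^ 3 ≤ (10 * Real.exp ((s / r) ^ 2 / 36)) ^ 3 := by gcongr
        _ = 1000 * Real.exp ((s / r) ^ 2 / 12) := by
            rw [mul_pow, ← Real.exp_nat_mul]
            norm_num
            ring_nf
        _ ≤ _ := by
            refine mul_le_mul_of_nonneg_left (Real.exp_le_exp.2 ?_) (by norm_num)
            rw [div_pow, hrt, div_div, div_le_div_iff₀ (by positivity) (by positivity)]
            nlinarith
    have h4 : Real.exp (-(∑ i, z.2 i ^ 2) / (4 * t)) ≤ 1000 * (r / (r + s)) ^ 3 := by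
      rw [neg_div, Real.exp_neg, inv_le_comm₀ (Real.exp_pos _) (by positivity)]
      rw [mul_inv, ← inv_pow, inv_div]
      linarith
    calc _ ≤ (r ^ 3)⁻¹ * (1000 * (r / (r + s)) ^ 3) := by gcongr
      _ = _ := by
        rw [hN, Real.rpow_neg (by positivity), show (3 : ℝ) = ((3 : ℕ) : ℝ) by norm_num,
          Real.rpow_natCast]
        field_simp
  · positivity

theorem measurable_of_isTruncatedHeatKernel {K : SpaceTime → ℝ} (hK : IsTruncatedHeatKernel K) :
    Measurable K :=
  measurable_of_continuousOn_compl_singleton 0 hK.smooth.continuousOn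

theorem exists_eq_zero_of_lt_norm {K : SpaceTime → ℝ} (hK : IsTruncatedHeatKernel K) :
    ∃ M : ℝ, 0 < M ∧ ∀ z, M < ‖z‖ → K z = 0 := by
  obtain ⟨M, hM⟩ := hK.compactSupport.isBounded.subset_closedBall 0
  refine ⟨max M 1, by positivity, fun z hz => ?_⟩
  by_contra h
  have := hM (subset_tsupport K (by simpa using h))
  rw [mem_closedBall_zero_iff] at this
  exact absurd (lt_of_le_of_lt (le_max_left M 1) hz) (not_lt.2 this)

theorem exists_bound_of_le_parabolicNorm {K : SpaceTime → ℝ} (hK : IsTruncatedHeatKernel K)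
    {r : ℝ} (hr : 0 < r) : ∃ B : ℝ, 0 < B ∧ ∀ z, r ≤ parabolicNorm z → |K z| ≤ B := by
  have hc : IsCompact (tsupport K ∩ {z | r ≤ parabolicNorm z}) :=
    IsCompact.inter_right hK.compactSupport (isClosed_le continuous_const continuous_parabolicNorm)
  obtain ⟨B, hB⟩ := hc.exists_bound_of_continuousOn (f := K) (hK.smooth.continuousOn.mono (by
    rintro z ⟨_, hz⟩ rfl
    have hz' : r ≤ parabolicNorm 0 := hz
    rw [parabolicNorm_zero] at hz'
    linarith))
  refine ⟨max B 1, by positivity, fun z hz => ?_⟩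
  by_cases h : z ∈ tsupport K
  · exact (hB z ⟨h, hz⟩).trans (le_max_left _ _)
  · rw [image_eq_zero_of_notMem_tsupport h]
    simp

theorem exists_kernel_bound {K : SpaceTime → ℝ} (hK : IsTruncatedHeatKernel K) :
    ∃ C M : ℝ, 0 < C ∧ 0 < M ∧ (∀ z, M < ‖z‖ → K z = 0) ∧
      ∀ z, 0 < torusSize z → |K z| ≤ C * torusSize z ^ (-3 : ℝ) := by
  obtain ⟨M, hM, hM0⟩ := exists_eq_zero_of_lt_norm hK
  obtain ⟨B, hB, hB0⟩ := exists_bound_of_le_parabolicNorm hK one_pos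
  refine ⟨1000 + B * (M + 3) ^ 3, M, by positivity, hM, hM0, fun z hz => ?_⟩
  have hz0 : z ≠ 0 := by
    rintro rfl
    simp [torusSize] at hz
  have hT : 0 < torusSize z ^ (-3 : ℝ) := by positivity
  have hle := torusSize_le_parabolicNorm z
  rcases le_total (parabolicNorm z) 1 with h | h
  · rw [hK.eq_heatKernel z hz0 h, abs_of_nonneg (heatKernel_nonneg z)]
    have h1 := heatKernel_le z
    have h2 := Real.rpow_le_rpow_of_nonpos hz hle (by norm_num : (-3 : ℝ) ≤ 0)
    have : 0 ≤ B * (M + 3) ^ 3 * torusSize z ^ (-3 : ℝ) := by positivity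
    nlinarith
  · by_cases hzM : M < ‖z‖
    · rw [hM0 z hzM, abs_zero]
      positivity
    · have h1 := torusSize_le_of_norm_le (not_lt.1 hzM)
      have h2 := Real.rpow_le_rpow_of_nonpos hz h1 (by norm_num : (-3 : ℝ) ≤ 0)
      have h3 : (M + 3) ^ 3 * (M + 3) ^ (-3 : ℝ) = 1 := by
        rw [Real.rpow_neg (by positivity), show (3 : ℝ) = ((3 : ℕ) : ℝ) by norm_num,
          Real.rpow_natCast]
        exact mul_inv_cancel₀ (by positivity)
      calc |K z| ≤ B := hB0 z h
        _ = B * ((M + 3) ^ 3 * (M + 3) ^ (-3 : ℝ)) := by rw [h3, mul_one]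
        _ ≤ B * ((M + 3) ^ 3 * torusSize z ^ (-3 : ℝ)) := by gcongr
        _ ≤ _ := by nlinarith

theorem kernel_abs_ae_le {K : SpaceTime → ℝ} {C M : ℝ} (hM : ∀ z, M < ‖z‖ → K z = 0)
    (hC : ∀ z, 0 < torusSize z → |K z| ≤ C * torusSize z ^ (-3 : ℝ)) (v : SpaceTime) :
    ∀ᵐ y : SpaceTime, ENNReal.ofReal |K (v - y)| ≤
      (Metric.closedBall v M).indicator
        (fun y => ENNReal.ofReal (C * torusSize (y - v) ^ (-3 : ℝ))) y := by
  filter_upwards [ae_torusSize_sub_pos v] with y hy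
  by_cases h : y ∈ Metric.closedBall v M
  · rw [indicator_of_mem h]
    refine ENNReal.ofReal_le_ofReal ?_
    rw [torusSize_sub_comm] at hy ⊢
    exact hC _ hy
  · rw [mem_closedBall_iff_norm', not_le] at h
    rw [hM _ h]
    simp

theorem integrable_of_isTruncatedHeatKernel {K : SpaceTime → ℝ} (hK : IsTruncatedHeatKernel K) :
    Integrable K := by
  obtain ⟨C, M, hC, hM, hM0, hC0⟩ := exists_kernel_bound hK
  obtain ⟨A, hA, h⟩ := exists_lintegral_torusSize_rpow_le M hM.le (p := 3) (by norm_num)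
    (by norm_num)
  refine ⟨(measurable_of_isTruncatedHeatKernel hK).aestronglyMeasurable, ?_⟩
  rw [hasFiniteIntegral_iff_norm]
  have hneg : ∫⁻ z, ENNReal.ofReal ‖K z‖ = ∫⁻ y, ENNReal.ofReal |K (0 - y)| := by
    simp only [zero_sub, Real.norm_eq_abs]
    exact (lintegral_neg_eq_self (fun y => ENNReal.ofReal |K y|)).symm
  rw [hneg]
  refine (lintegral_mono_ae (kernel_abs_ae_le hM0 hC0 0)).trans_lt ?_
  rw [lintegral_indicator Metric.isClosed_closedBall.measurableSet]
  have hsub : Metric.closedBall (0 : SpaceTime) M ⊆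
      {x | torusSize (x - 0) ≤ M + 3} ∩ Metric.closedBall 0 M := fun x hx =>
    ⟨by simpa using torusSize_le_of_norm_le (mem_closedBall_zero_iff.1 hx), hx⟩
  have h1 := (lintegral_mono_set hsub).trans (h 0 0 (M + 3) (by positivity))
  simp only [ENNReal.ofReal_mul hC.le]
  rw [lintegral_const_mul _ (by fun_prop)]
  exact ENNReal.mul_lt_top ENNReal.ofReal_lt_top (h1.trans_lt ENNReal.ofReal_lt_top)

/-- The kernel averaged over periodic parabolic balls of radius `N ε`: the singularity of order `-3`
is smoothened out at scale `ε`. -/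
theorem exists_lintegral_kernel_le {K : SpaceTime → ℝ} (hK : IsTruncatedHeatKernel K) {N : ℝ}
    (hN : 1 ≤ N) : ∃ A : ℝ, 0 < A ∧ ∀ ε : ℝ, 0 < ε → ∀ u y : SpaceTime,
      ∫⁻ x in {x | torusSize (x - y) ≤ N * ε}, ENNReal.ofReal |K (u - x)| ≤
        ENNReal.ofReal (A * ε ^ 5 * (torusSize (u - y) + ε) ^ (-3 : ℝ)) := by
  obtain ⟨C, M, hC, hM, hM0, hC0⟩ := exists_kernel_bound hK
  obtain ⟨A₁, hA₁, h1⟩ := exists_lintegral_torusSize_rpow_le M hM.le (p := 3) (by norm_num)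
    (by norm_num)
  obtain ⟨A₂, hA₂, h2⟩ := exists_volume_torusSize_le M hM.le
  refine ⟨27 * C * A₂ * N ^ 5 + 243 * C * A₁ * N ^ 5 + 1, by positivity, fun ε hε u y => ?_⟩
  have hNε : 0 < N * ε := by positivity
  set τ := torusSize (u - y) with hτ
  have hτ0 : 0 ≤ τ := torusSize_nonneg _
  set S := {x | torusSize (x - y) ≤ N * ε}
  have hS : MeasurableSet S := measurableSet_le (by fun_prop) measurable_const
  have hball : MeasurableSet (Metric.closedBall u M) := Metric.isClosed_closedBall.measurableSet
  have e3 : ∀ x : ℝ, 0 < x → x ^ (-3 : ℝ) = (x ^ 3)⁻¹ := fun x hx => by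
    rw [Real.rpow_neg hx.le, show (3 : ℝ) = ((3 : ℕ) : ℝ) by norm_num, Real.rpow_natCast]
  have hstart : ∫⁻ x in S, ENNReal.ofReal |K (u - x)| ≤
      ∫⁻ x in S ∩ Metric.closedBall u M, ENNReal.ofReal (C * torusSize (x - u) ^ (-3 : ℝ)) := by
    refine (lintegral_mono_ae (ae_restrict_of_ae (kernel_abs_ae_le hM0 hC0 u))).trans ?_
    rw [lintegral_indicator hball, Measure.restrict_restrict hball, inter_comm]
  refine hstart.trans ?_
  rcases le_total (2 * (N * ε)) τ with h | h
  -- Far from the singularity the kernel is of order `τ ^ (-3)` on the whole ball.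
  · calc _ ≤ ∫⁻ x in S ∩ Metric.closedBall u M, ENNReal.ofReal (C * (8 * τ ^ (-3 : ℝ))) := by
          refine setLIntegral_mono' (hS.inter hball) fun x hx => ENNReal.ofReal_le_ofReal ?_
          have hx1 : torusSize (x - y) ≤ N * ε := hx.1
          have h3 := torusSize_sub_le u x y
          have hlow : τ / 2 ≤ torusSize (x - u) := by
            rw [torusSize_sub_comm x u]; linarith
          have hτ' : 0 < τ := by linarith
          have := Real.rpow_le_rpow_of_nonpos (by positivity) hlow (by norm_num : (-3 : ℝ) ≤ 0)
          gcongr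
          refine this.trans (le_of_eq ?_)
          rw [e3 _ (by positivity), e3 _ hτ']
          field_simp
          norm_num
      _ = ENNReal.ofReal (C * (8 * τ ^ (-3 : ℝ))) *
            (volume.restrict (Metric.closedBall u M)) S := by
          rw [setLIntegral_const, Measure.restrict_apply hS]
      _ ≤ ENNReal.ofReal (C * (8 * τ ^ (-3 : ℝ))) * ENNReal.ofReal (A₂ * (N * ε) ^ 5) := by
          gcongr
          exact h2 u y _ hNε
      _ ≤ _ := by
          have hτ' : 0 < τ := by linarith
          rw [← ENNReal.ofReal_mul (by positivity)]
          refine ENNReal.ofReal_le_ofReal ?_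
          have : 8 * τ ^ (-3 : ℝ) ≤ 27 * (τ + ε) ^ (-3 : ℝ) := by
            rw [e3 _ hτ', e3 _ (by positivity), ← div_eq_mul_inv, ← div_eq_mul_inv,
              div_le_div_iff₀ (by positivity) (by positivity)]
            have : τ + ε ≤ 3 / 2 * τ := by nlinarith
            calc 8 * (τ + ε) ^ 3 ≤ 8 * (3 / 2 * τ) ^ 3 := by gcongr
              _ = _ := by ring
          calc C * (8 * τ ^ (-3 : ℝ)) * (A₂ * (N * ε) ^ 5)
              ≤ C * (27 * (τ + ε) ^ (-3 : ℝ)) * (A₂ * (N * ε) ^ 5) := by gcongr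
            _ = 27 * C * A₂ * N ^ 5 * (ε ^ 5 * (τ + ε) ^ (-3 : ℝ)) := by ring
            _ ≤ (27 * C * A₂ * N ^ 5 + 243 * C * A₁ * N ^ 5 + 1) *
                (ε ^ 5 * (τ + ε) ^ (-3 : ℝ)) := by
                gcongr
                have : 0 ≤ 243 * C * A₁ * N ^ 5 := by positivity
                linarith
            _ = _ := by ring
  -- Close to the singularity, integrate it over a ball of radius of order `ε`.
  · have hsub : S ∩ Metric.closedBall u M ⊆
        {x | torusSize (x - u) ≤ 3 * (N * ε)} ∩ Metric.closedBall u M := by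
      rintro x ⟨hx, hx'⟩
      refine ⟨?_, hx'⟩
      have hx1 : torusSize (x - y) ≤ N * ε := hx
      have h3 := torusSize_sub_le x y u
      rw [torusSize_sub_comm y u] at h3
      show torusSize (x - u) ≤ 3 * (N * ε)
      linarith
    calc _ ≤ ∫⁻ x in {x | torusSize (x - u) ≤ 3 * (N * ε)} ∩ Metric.closedBall u M,
            ENNReal.ofReal (C * torusSize (x - u) ^ (-3 : ℝ)) := lintegral_mono_set hsub
      _ = ENNReal.ofReal C * ∫⁻ x in {x | torusSize (x - u) ≤ 3 * (N * ε)} ∩ Metric.closedBall u M,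
            ENNReal.ofReal (torusSize (x - u) ^ (-3 : ℝ)) := by
          simp only [ENNReal.ofReal_mul hC.le]
          rw [lintegral_const_mul _ (by fun_prop)]
      _ ≤ ENNReal.ofReal C * ENNReal.ofReal (A₁ * (3 * (N * ε)) ^ (5 - 3 : ℝ)) := by
          gcongr
          exact h1 u u _ (by positivity)
      _ ≤ _ := by
          rw [← ENNReal.ofReal_mul hC.le]
          refine ENNReal.ofReal_le_ofReal ?_
          have e2 : (3 * (N * ε)) ^ (5 - 3 : ℝ) = (3 * (N * ε)) ^ 2 := by
            rw [show (5 - 3 : ℝ) = ((2 : ℕ) : ℝ) by norm_num, Real.rpow_natCast]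
          have h4 : (3 * (N * ε)) ^ 2 ≤ 243 * N ^ 5 * (ε ^ 5 * (τ + ε) ^ (-3 : ℝ)) := by
            rw [e3 _ (by positivity)]
            have h5 : (τ + ε) ^ 3 ≤ (3 * (N * ε)) ^ 3 := by
              gcongr
              nlinarith
            have h6 : (0 : ℝ) < (τ + ε) ^ 3 := by positivity
            rw [show 243 * N ^ 5 * (ε ^ 5 * ((τ + ε) ^ 3)⁻¹) =
              243 * N ^ 5 * ε ^ 5 / (τ + ε) ^ 3 by field_simp, le_div_iff₀ h6]
            calc (3 * (N * ε)) ^ 2 * (τ + ε) ^ 3 ≤ (3 * (N * ε)) ^ 2 * (3 * (N * ε)) ^ 3 := by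
                  gcongr
              _ = _ := by ring
          rw [e2]
          calc C * (A₁ * (3 * (N * ε)) ^ 2)
              ≤ C * (A₁ * (243 * N ^ 5 * (ε ^ 5 * (τ + ε) ^ (-3 : ℝ)))) := by gcongr
            _ = 243 * C * A₁ * N ^ 5 * (ε ^ 5 * (τ + ε) ^ (-3 : ℝ)) := by ring
            _ ≤ (27 * C * A₂ * N ^ 5 + 243 * C * A₁ * N ^ 5 + 1) *
                (ε ^ 5 * (τ + ε) ^ (-3 : ℝ)) := by
                gcongr
                have : 0 ≤ 27 * C * A₂ * N ^ 5 := by positivity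
                linarith
            _ = _ := by ring

/-! ### Joint cumulants -/

theorem jointCumulant_eq {ι Ω : Type*} [DecidableEq ι] [MeasurableSpace Ω] (P : Measure Ω)
    (X : ι → Ω → ℝ) (B : Finset ι) :
    jointCumulant P X B = ∫ ω, ∏ i ∈ B, X i ω ∂P -
      ∑ p : {p : Finpartition B // B ∉ p.parts}, ∏ A ∈ p.1.parts, jointCumulant P X A := by
  rw [jointCumulant]
  congr 1
  refine Finset.sum_congr rfl fun p _ => ?_
  exact Finset.prod_coe_sort p.1.parts fun A => jointCumulant P X A

theorem ssubset_of_mem_parts {ι : Type*} [DecidableEq ι] {B A : Finset ι}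
    (p : {p : Finpartition B // B ∉ p.parts}) (hA : A ∈ p.1.parts) : A ⊂ B :=
  (p.1.le hA).lt_of_ne fun h => p.2 (h ▸ hA)

theorem jointCumulant_congr {ι Ω Ω' : Type*} [DecidableEq ι] [MeasurableSpace Ω]
    [MeasurableSpace Ω'] (P : Measure Ω) (P' : Measure Ω') (X : ι → Ω → ℝ) (Y : ι → Ω' → ℝ)
    (h : ∀ A : Finset ι, ∫ ω, ∏ i ∈ A, X i ω ∂P = ∫ ω, ∏ i ∈ A, Y i ω ∂P') (B : Finset ι) :
    jointCumulant P X B = jointCumulant P' Y B := by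
  induction B using Finset.strongInduction with
  | H B ih =>
    rw [jointCumulant_eq, jointCumulant_eq, h]
    congr 1
    refine Finset.sum_congr rfl fun p _ => Finset.prod_congr rfl fun A hA => ?_
    exact ih A (ssubset_of_mem_parts p hA)

theorem measurable_jointCumulant {ι Ω α : Type*} [DecidableEq ι] [MeasurableSpace Ω]
    [MeasurableSpace α] (P : Measure Ω) (X : α → ι → Ω → ℝ)
    (h : ∀ A : Finset ι, Measurable fun z => ∫ ω, ∏ i ∈ A, X z i ω ∂P) (B : Finset ι) :
    Measurable fun z => jointCumulant P (X z) B := by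
  induction B using Finset.strongInduction with
  | H B ih =>
    simp_rw [fun z => jointCumulant_eq P (X z) B]
    refine (h B).sub (Finset.measurable_sum _ fun p _ => Finset.measurable_prod _ fun A hA => ?_)
    exact ih A (ssubset_of_mem_parts p hA)

/-- Joint cumulants obey the same bounds as the moments, up to a combinatorial constant. -/
theorem exists_abs_jointCumulant_le {ι : Type*} [DecidableEq ι] (M : ℝ) (hM : 0 ≤ M)
    (B : Finset ι) : ∃ C : ℝ, 0 ≤ C ∧ ∀ (Ω : Type*) [MeasurableSpace Ω] (P : Measure Ω)
      (X : ι → Ω → ℝ) (s : ℝ), 0 ≤ s →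
      (∀ A : Finset ι, |∫ ω, ∏ i ∈ A, X i ω ∂P| ≤ M * s ^ A.card) →
      |jointCumulant P X B| ≤ C * s ^ B.card := by
  induction B using Finset.strongInduction with
  | H B ih =>
    choose! C hC0 hC using ih
    refine ⟨M + ∑ p : {p : Finpartition B // B ∉ p.parts}, ∏ A ∈ p.1.parts, C A, ?_, ?_⟩
    · refine add_nonneg hM (Finset.sum_nonneg fun p _ => Finset.prod_nonneg fun A hA => ?_)
      exact hC0 A (ssubset_of_mem_parts p hA)
    · intro Ω _ P X s hs hX
      rw [jointCumulant_eq]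
      refine (abs_sub _ _).trans ?_
      rw [add_mul, Finset.sum_mul]
      refine add_le_add (hX B) ((Finset.abs_sum_le_sum_abs _ _).trans
        (Finset.sum_le_sum fun p _ => ?_))
      rw [Finset.abs_prod, ← p.1.sum_card_parts, ← Finset.prod_pow_eq_pow_sum,
        ← Finset.prod_mul_distrib]
      exact Finset.prod_le_prod (fun _ _ => abs_nonneg _) fun A hA =>
        hC A (ssubset_of_mem_parts p hA) Ω P X s hs hX

theorem jointCumulant_singleton {ι Ω : Type*} [DecidableEq ι] [MeasurableSpace Ω] (P : Measure Ω)
    (X : ι → Ω → ℝ) (i : ι) : jointCumulant P X {i} = ∫ ω, X i ω ∂P := by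
  rw [jointCumulant_eq]
  have : IsEmpty {p : Finpartition ({i} : Finset ι) // {i} ∉ p.parts} := by
    refine ⟨fun p => ?_⟩
    obtain ⟨t, ht, hit⟩ := p.1.exists_mem (Finset.mem_singleton_self i)
    have h1 := Finset.subset_singleton_iff.1 (p.1.subset ht)
    rcases h1 with h1 | h1
    · rw [h1] at hit
      exact absurd hit (Finset.notMem_empty i)
    · exact p.2 (h1 ▸ ht)
  simp

/-- For centred random variables the joint cumulant of two variables is the second moment. -/
theorem jointCumulant_pair {ι Ω : Type*} [DecidableEq ι] [MeasurableSpace Ω] (P : Measure Ω)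
    (X : ι → Ω → ℝ) (h0 : ∀ i, ∫ ω, X i ω ∂P = 0) (B : Finset ι) (hB : B.card = 2) :
    jointCumulant P X B = ∫ ω, ∏ i ∈ B, X i ω ∂P := by
  rw [jointCumulant_eq]
  have : ∑ p : {p : Finpartition B // B ∉ p.parts}, ∏ A ∈ p.1.parts, jointCumulant P X A = 0 := by
    refine Finset.sum_eq_zero fun p _ => ?_
    have hne : B ≠ ∅ := by
      rintro rfl
      simp at hB
    obtain ⟨A, hA⟩ := p.1.parts_nonempty hne
    refine Finset.prod_eq_zero hA ?_
    have h1 := Finset.card_lt_card (ssubset_of_mem_parts p hA)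
    have h2 := Finset.card_pos.2 (p.1.nonempty_of_mem_parts hA)
    obtain ⟨i, rfl⟩ := Finset.card_eq_one.1 (by omega : A.card = 1)
    rw [jointCumulant_singleton, h0]
  rw [this, sub_zero]

/-- The moment-cumulant formula. -/
theorem integral_prod_eq_sum_finpartition {ι Ω : Type*} [DecidableEq ι] [MeasurableSpace Ω]
    (P : Measure Ω) (X : ι → Ω → ℝ) {B : Finset ι} (hB : B.Nonempty) :
    ∫ ω, ∏ i ∈ B, X i ω ∂P =
      ∑ p : Finpartition B, ∏ A ∈ p.parts, jointCumulant P X A := by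
  classical
  have h1 : ∑ p : {p : Finpartition B // B ∉ p.parts}, ∏ A ∈ p.1.parts, jointCumulant P X A =
      ∑ p : Finpartition B with B ∉ p.parts, ∏ A ∈ p.parts, jointCumulant P X A :=
    (Finset.sum_subtype (Finset.univ.filter fun p : Finpartition B => B ∉ p.parts) (by simp)
      fun p => ∏ A ∈ p.parts, jointCumulant P X A).symm
  have h2 : ∑ p : Finpartition B with ¬ B ∉ p.parts, ∏ A ∈ p.parts, jointCumulant P X A =
      jointCumulant P X B := by
    have : (Finset.univ.filter fun p : Finpartition B => ¬ B ∉ p.parts) =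
        {Finpartition.indiscrete hB.ne_empty} := by
      ext p
      simp only [Finset.mem_filter, Finset.mem_univ, true_and, not_not, Finset.mem_singleton]
      constructor
      · intro h
        ext A
        simp only [Finpartition.indiscrete, Finset.mem_singleton]
        refine ⟨fun hA => ?_, fun hA => hA ▸ h⟩
        obtain ⟨a, ha⟩ := p.nonempty_of_mem_parts hA
        exact p.eq_of_mem_parts hA h ha (p.subset hA ha)
      · rintro rfl
        simp [Finpartition.indiscrete]
    rw [this, Finset.sum_singleton]
    simp [Finpartition.indiscrete]
  rw [← Finset.sum_filter_add_sum_filter_not Finset.univ fun p : Finpartition B => B ∉ p.parts,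
    h2, ← h1]
  have := jointCumulant_eq P X B
  linarith

/-- The union of a partition of `S` and a partition of `T`, for disjoint `S` and `T`. -/
def Finpartition.disjUnion {ι : Type*} [DecidableEq ι] {S T : Finset ι} (hST : Disjoint S T)
    (p : Finpartition S) (q : Finpartition T) : Finpartition (S ∪ T) :=
  Finpartition.ofExistsUnique (p.parts ∪ q.parts)
    (by
      intro A hA
      rcases Finset.mem_union.1 hA with h | h
      · exact (p.subset h).trans Finset.subset_union_left
      · exact (q.subset h).trans Finset.subset_union_right)
    (by
      intro a ha
      rcases Finset.mem_union.1 ha with h | h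
      · obtain ⟨t, ⟨ht, hat⟩, hu⟩ := p.existsUnique_mem h
        refine ⟨t, ⟨Finset.mem_union_left _ ht, hat⟩, ?_⟩
        rintro s ⟨hs, has⟩
        rcases Finset.mem_union.1 hs with hs | hs
        · exact hu s ⟨hs, has⟩
        · exact absurd (q.subset hs has) (Finset.disjoint_left.1 hST h)
      · obtain ⟨t, ⟨ht, hat⟩, hu⟩ := q.existsUnique_mem h
        refine ⟨t, ⟨Finset.mem_union_right _ ht, hat⟩, ?_⟩
        rintro s ⟨hs, has⟩
        rcases Finset.mem_union.1 hs with hs | hs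
        · exact absurd h (Finset.disjoint_left.1 hST (p.subset hs has))
        · exact hu s ⟨hs, has⟩)
    (by
      intro h
      rcases Finset.mem_union.1 h with h | h
      · exact p.empty_notMem_parts h
      · exact q.empty_notMem_parts h)

/-- The parts contained in `S` of a partition that refines `{S, Sᶜ}`. -/
def Finpartition.restrictParts {ι : Type*} [DecidableEq ι] {B S : Finset ι} (hS : S ⊆ B)
    (p : Finpartition B) (h : ∀ A ∈ p.parts, A ⊆ S ∨ Disjoint A S) : Finpartition S :=
  Finpartition.ofExistsUnique (p.parts.filter (· ⊆ S)) (by simp)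
    (by
      intro a ha
      obtain ⟨t, ⟨ht, hat⟩, hu⟩ := p.existsUnique_mem (hS ha)
      refine ⟨t, ⟨Finset.mem_filter.2 ⟨ht, ?_⟩, hat⟩, ?_⟩
      · exact (h t ht).resolve_right fun hd => Finset.disjoint_left.1 hd hat ha
      · rintro s ⟨hs, has⟩
        exact hu s ⟨(Finset.mem_filter.1 hs).1, has⟩)
    (by simp [p.empty_notMem_parts])

/-- Partitions of `S ∪ T` all whose parts lie either in `S` or in `T` are pairs of a partition of
`S` and a partition of `T`. -/
theorem sum_finpartition_union {ι : Type*} [DecidableEq ι] {S T : Finset ι}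
    (hST : Disjoint S T) (f : Finset ι → ℝ) :
    ∑ p : Finpartition (S ∪ T) with ∀ A ∈ p.parts, A ⊆ S ∨ A ⊆ T, ∏ A ∈ p.parts, f A =
      (∑ p : Finpartition S, ∏ A ∈ p.parts, f A) * ∑ q : Finpartition T, ∏ A ∈ q.parts, f A := by
  have hdisj : ∀ (p : Finpartition S) (q : Finpartition T), Disjoint p.parts q.parts := by
    intro p q
    rw [Finset.disjoint_left]
    intro A hp hq
    obtain ⟨a, ha⟩ := p.nonempty_of_mem_parts hp
    exact Finset.disjoint_left.1 hST (p.subset hp ha) (q.subset hq ha)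
  rw [Finset.sum_mul_sum, ← Finset.sum_product', Finset.univ_product_univ]
  symm
  refine Finset.sum_bij' (i := fun pq _ => Finpartition.disjUnion hST pq.1 pq.2)
    (j := fun p hp =>
      (Finpartition.restrictParts (S := S) Finset.subset_union_left p (fun A hA =>
        ((Finset.mem_filter.1 hp).2 A hA).imp_right fun h => (hST.mono_right h).symm),
      Finpartition.restrictParts (S := T) Finset.subset_union_right p (fun A hA =>
        ((Finset.mem_filter.1 hp).2 A hA).symm.imp_right fun h => hST.mono_left h)))
    ?_ ?_ ?_ ?_ ?_
  · rintro ⟨p, q⟩ -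
    simp only [Finset.mem_filter, Finset.mem_univ, true_and, Finpartition.disjUnion,
      Finpartition.ofExistsUnique, Finset.mem_union]
    rintro A (hA | hA)
    · exact Or.inl (p.subset hA)
    · exact Or.inr (q.subset hA)
  · intros
    exact Finset.mem_univ _
  · rintro ⟨p, q⟩ -
    refine Prod.ext (Finpartition.ext ?_) (Finpartition.ext ?_)
    · ext A
      simp only [Finpartition.restrictParts, Finpartition.disjUnion, Finpartition.ofExistsUnique,
        Finset.mem_filter, Finset.mem_union]
      constructor
      · rintro ⟨h | h, hA⟩
        · exact h
        · obtain ⟨a, ha⟩ := q.nonempty_of_mem_parts h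
          exact absurd (q.subset h ha) (Finset.disjoint_left.1 hST (hA ha))
      · exact fun h => ⟨Or.inl h, p.subset h⟩
    · ext A
      simp only [Finpartition.restrictParts, Finpartition.disjUnion, Finpartition.ofExistsUnique,
        Finset.mem_filter, Finset.mem_union]
      constructor
      · rintro ⟨h | h, hA⟩
        · obtain ⟨a, ha⟩ := p.nonempty_of_mem_parts h
          exact absurd (hA ha) (Finset.disjoint_left.1 hST (p.subset h ha))
        · exact h
      · exact fun h => ⟨Or.inr h, q.subset h⟩
  · intro p hp
    have hp' := (Finset.mem_filter.1 hp).2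
    ext A
    simp only [Finpartition.restrictParts, Finpartition.disjUnion, Finpartition.ofExistsUnique,
      Finset.mem_filter, Finset.mem_union]
    constructor
    · rintro (h | h) <;> exact h.1
    · exact fun h => (hp' A h).imp (fun h' => ⟨h, h'⟩) fun h' => ⟨h, h'⟩
  · rintro ⟨p, q⟩ -
    simp only [Finpartition.disjUnion, Finpartition.ofExistsUnique]
    rw [Finset.prod_union (hdisj p q)]

/-- Joint cumulants vanish as soon as the moments factorise along a nontrivial splitting of the
random variables. -/
theorem jointCumulant_eq_zero {ι Ω : Type*} [DecidableEq ι] [MeasurableSpace Ω] (P : Measure Ω)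
    (X : ι → Ω → ℝ) (I : Set ι) [DecidablePred (· ∈ I)]
    (h : ∀ A : Finset ι, ∫ ω, ∏ i ∈ A, X i ω ∂P =
      (∫ ω, ∏ i ∈ A with i ∈ I, X i ω ∂P) * ∫ ω, ∏ i ∈ A with i ∉ I, X i ω ∂P)
    (B : Finset ι) (h1 : (B.filter (· ∈ I)).Nonempty) (h2 : (B.filter (· ∉ I)).Nonempty) :
    jointCumulant P X B = 0 := by
  induction B using Finset.strongInduction with
  | H B ih =>
    set S := B.filter (· ∈ I)
    set T := B.filter (· ∉ I)
    have hB : S ∪ T = B := Finset.filter_union_filter_not_eq _ B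
    have hST : Disjoint S T := Finset.disjoint_filter_filter_not _ _ _
    -- By induction, partitions of `B` into proper subsets only contribute if they refine `{S, T}`.
    have hcross : ∀ A ⊂ B, ¬ (A ⊆ S ∨ A ⊆ T) → jointCumulant P X A = 0 := by
      intro A hA hn
      rw [not_or] at hn
      obtain ⟨a, haA, haS⟩ := Finset.not_subset.1 hn.1
      obtain ⟨b, hbA, hbT⟩ := Finset.not_subset.1 hn.2
      have haB := hA.1 haA
      have hbB := hA.1 hbA
      refine ih A hA ⟨b, ?_⟩ ⟨a, ?_⟩
      · refine Finset.mem_filter.2 ⟨hbA, ?_⟩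
        by_contra hb
        exact hbT (Finset.mem_filter.2 ⟨hbB, hb⟩)
      · exact Finset.mem_filter.2 ⟨haA, fun ha => haS (Finset.mem_filter.2 ⟨haB, ha⟩)⟩
    have hsum : ∑ p : {p : Finpartition B // B ∉ p.parts}, ∏ A ∈ p.1.parts, jointCumulant P X A =
        ∑ p : Finpartition B with ∀ A ∈ p.parts, A ⊆ S ∨ A ⊆ T,
          ∏ A ∈ p.parts, jointCumulant P X A := by
      have e1 : ∑ p : {p : Finpartition B // B ∉ p.parts},
          ∏ A ∈ p.1.parts, jointCumulant P X A =
          ∑ p : Finpartition B with B ∉ p.parts, ∏ A ∈ p.parts, jointCumulant P X A :=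
        (Finset.sum_subtype (Finset.univ.filter fun p : Finpartition B => B ∉ p.parts) (by simp)
          fun p => ∏ A ∈ p.parts, jointCumulant P X A).symm
      rw [e1]
      symm
      refine Finset.sum_subset ?_ ?_
      · intro p hp
        simp only [Finset.mem_filter, Finset.mem_univ, true_and] at hp ⊢
        intro hBp
        obtain ⟨a, ha⟩ := h1
        obtain ⟨b, hb⟩ := h2
        rcases hp B hBp with h' | h'
        · exact Finset.disjoint_left.1 hST (h' (Finset.mem_filter.1 hb).1) hb
        · exact Finset.disjoint_left.1 hST ha (h' (Finset.mem_filter.1 ha).1)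
      · intro p hp hp'
        simp only [Finset.mem_filter, Finset.mem_univ, true_and, not_forall] at hp hp'
        obtain ⟨A, hA, hn⟩ := hp'
        exact Finset.prod_eq_zero hA (hcross A (ssubset_of_mem_parts ⟨p, hp⟩ hA) hn)
    rw [jointCumulant_eq, hsum, h B]
    change (∫ ω, ∏ i ∈ S, X i ω ∂P) * (∫ ω, ∏ i ∈ T, X i ω ∂P) - _ = 0
    rw [integral_prod_eq_sum_finpartition P X h1, integral_prod_eq_sum_finpartition P X h2,
      ← sum_finpartition_union hST, sub_eq_zero]
    clear_value S T
    subst hB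
    rfl

/-! ### The rescaled noise -/

/-- The parabolic dilation `(t, x) ↦ (t / r², x / r)`. -/
noncomputable def dilate (r : ℝ) (z : SpaceTime) : SpaceTime := (z.1 / r ^ 2, fun i => z.2 i / r)

theorem dilate_add (r : ℝ) (z w : SpaceTime) : dilate r (z + w) = dilate r z + dilate r w := by
  refine Prod.ext ?_ (funext fun i => ?_) <;> simp [dilate, add_div]

theorem continuous_dilate (r : ℝ) : Continuous (dilate r) := by
  unfold dilate; fun_prop

theorem rescaledNoise_eq {Ω : Type*} (ε : ℝ) (ζ : SpaceTime → Ω → ℝ) (z : SpaceTime) (ω : Ω) :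
    rescaledNoise ε ζ z ω = ε ^ (-(5 / 2) : ℝ) * ζ (dilate ε z) ω := rfl

theorem norm_coe_addCircle_div {ε : ℝ} (hε : 0 < ε) (x : ℝ) :
    ‖((x / ε : ℝ) : AddCircle ε⁻¹)‖ = ‖(x : AddCircle (1 : ℝ))‖ / ε := by
  rw [AddCircle.norm_eq, UnitAddCircle.norm_eq, inv_inv, mul_div_cancel₀ x hε.ne',
    div_eq_mul_inv, ← sub_mul, abs_mul, abs_of_pos (inv_pos.2 hε), div_eq_mul_inv]

theorem torusDist_dilate {ε : ℝ} (hε : 0 < ε) (z w : SpaceTime) :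
    torusDist ε⁻¹ (dilate ε z) (dilate ε w) = torusSize (z - w) / ε := by
  unfold torusDist torusSize dilate
  rw [add_div, Finset.sum_div]
  congr 1
  · simp only
    rw [← sub_div, abs_div, abs_of_pos (by positivity : 0 < ε ^ 2), Real.sqrt_div (abs_nonneg _),
      Real.sqrt_sq hε.le]
    rfl
  · refine Finset.sum_congr rfl fun i _ => ?_
    simp only
    rw [← sub_div, norm_coe_addCircle_div hε]
    rfl

theorem measurable_rescaledNoise {Ω : Type*} [MeasurableSpace Ω] {P : Measure Ω} {ε : ℝ}
    {ζ : SpaceTime → Ω → ℝ} (hζ : IsNoise P ε ζ) (z : SpaceTime) :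
    Measurable (rescaledNoise ε ζ z) :=
  (hζ.measurable _).const_mul _

theorem rescaledNoise_periodic {Ω : Type*} [MeasurableSpace Ω] {P : Measure Ω} {ε : ℝ}
    {ζ : SpaceTime → Ω → ℝ} (hζ : IsNoise P ε ζ) (z : SpaceTime) (n : Fin 3 → ℤ) :
    rescaledNoise ε ζ (z.1, fun i => z.2 i + n i) = rescaledNoise ε ζ z := by
  funext ω
  have := hζ.periodic (z.1 / ε ^ 2) (fun i => z.2 i / ε) n ω
  simp only [rescaledNoise, add_div]
  simp only [div_eq_mul_inv] at this ⊢
  rw [this]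

/-- A modification of the noise all whose realisations are continuous. -/
theorem exists_continuous_modification {Ω : Type*} [MeasurableSpace Ω] {P : Measure Ω} {ε : ℝ}
    {ζ : SpaceTime → Ω → ℝ} (hζ : IsNoise P ε ζ) :
    ∃ ξ : SpaceTime → Ω → ℝ, Measurable (Function.uncurry ξ) ∧ ∀ᵐ ω ∂P, ∀ z, ζ z ω = ξ z ω := by
  classical
  obtain ⟨N, hN, hNm, hN0⟩ := exists_measurable_superset_of_null (ae_iff.1 hζ.continuous)
  refine ⟨fun z ω => if ω ∈ N then 0 else ζ z ω, ?_, ?_⟩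
  · refine measurable_uncurry_of_continuous_of_measurable (fun ω => ?_) fun z =>
      Measurable.ite hNm measurable_const (hζ.measurable z)
    by_cases h : ω ∈ N
    · simpa [h] using continuous_const
    · simp only [h, if_false]
      by_contra hc
      exact h (hN hc)
  · have : ∀ᵐ ω ∂P, ω ∉ N := by
      rw [ae_iff]
      simpa using hN0
    filter_upwards [this] with ω hω z
    simp [hω]

theorem measurable_moment {ι Ω α : Type*} [MeasurableSpace Ω] [MeasurableSpace α]
    {P : Measure Ω} [IsProbabilityMeasure P] {ε : ℝ} {ζ : SpaceTime → Ω → ℝ} (hζ : IsNoise P ε ζ)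
    {z : α → ι → SpaceTime} (hz : ∀ i, Measurable fun a => z a i) (A : Finset ι) :
    Measurable fun a => ∫ ω, ∏ i ∈ A, rescaledNoise ε ζ (z a i) ω ∂P := by
  obtain ⟨ξ, hξ, hae⟩ := exists_continuous_modification hζ
  have h1 : ∀ a, ∫ ω, ∏ i ∈ A, rescaledNoise ε ζ (z a i) ω ∂P =
      ∫ ω, ∏ i ∈ A, (ε ^ (-(5 / 2) : ℝ) * ξ (dilate ε (z a i)) ω) ∂P := by
    intro a
    refine integral_congr_ae ?_
    filter_upwards [hae] with ω hω
    simp only [rescaledNoise_eq, hω]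
  simp_rw [h1]
  have h2 : Measurable fun p : α × Ω =>
      ∏ i ∈ A, (ε ^ (-(5 / 2) : ℝ) * ξ (dilate ε (z p.1 i)) p.2) := by
    refine Finset.measurable_prod _ fun i _ => Measurable.const_mul ?_ _
    exact hξ.comp ((((continuous_dilate ε).measurable.comp (hz i)).comp measurable_fst).prodMk
      measurable_snd)
  exact h2.stronglyMeasurable.integral_prod_right'.measurable

theorem integral_rescaledNoise {Ω : Type*} [MeasurableSpace Ω] {P : Measure Ω} {ε : ℝ}
    {ζ : SpaceTime → Ω → ℝ} (hζ : IsNoise P ε ζ) (z : SpaceTime) :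
    ∫ ω, rescaledNoise ε ζ z ω ∂P = 0 := by
  have h1 : Measurable fun (ω : Ω) (z : SpaceTime) => ζ z ω :=
    measurable_pi_lambda _ hζ.measurable
  have h2 : Measurable fun (ω : Ω) (z : SpaceTime) => -ζ z ω :=
    measurable_pi_lambda _ fun z => (hζ.measurable z).neg
  have h3 : Measurable fun f : SpaceTime → ℝ => f (dilate ε z) := measurable_pi_apply _
  have h4 : ∫ ω, ζ (dilate ε z) ω ∂P = ∫ ω, -ζ (dilate ε z) ω ∂P := by
    calc _ = ∫ f, f (dilate ε z) ∂(P.map fun (ω : Ω) (z : SpaceTime) => ζ z ω) :=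
          (integral_map h1.aemeasurable h3.aestronglyMeasurable).symm
      _ = ∫ f, f (dilate ε z) ∂(P.map fun (ω : Ω) (z : SpaceTime) => -ζ z ω) := by
          rw [hζ.symmetric]
      _ = _ := integral_map h2.aemeasurable h3.aestronglyMeasurable
  rw [integral_neg] at h4
  simp only [rescaledNoise_eq]
  rw [integral_const_mul, show ∫ ω, ζ (dilate ε z) ω ∂P = 0 by linarith, mul_zero]

theorem moment_add {ι Ω : Type*} [MeasurableSpace Ω] {P : Measure Ω} {ε : ℝ}
    {ζ : SpaceTime → Ω → ℝ} (hζ : IsNoise P ε ζ) (z : ι → SpaceTime) (h : SpaceTime)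
    (A : Finset ι) :
    ∫ ω, ∏ i ∈ A, rescaledNoise ε ζ (z i + h) ω ∂P =
      ∫ ω, ∏ i ∈ A, rescaledNoise ε ζ (z i) ω ∂P := by
  have h1 : Measurable fun (ω : Ω) (z : SpaceTime) => ζ z ω :=
    measurable_pi_lambda _ hζ.measurable
  have h2 : Measurable fun (ω : Ω) (z : SpaceTime) => ζ (z + dilate ε h) ω :=
    measurable_pi_lambda _ fun z => hζ.measurable _
  have h3 : Measurable fun f : SpaceTime → ℝ =>
      ∏ i ∈ A, (ε ^ (-(5 / 2) : ℝ) * f (dilate ε (z i))) :=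
    Finset.measurable_prod _ fun i _ => (measurable_pi_apply _).const_mul _
  simp only [rescaledNoise_eq, dilate_add]
  calc _ = ∫ f, ∏ i ∈ A, (ε ^ (-(5 / 2) : ℝ) * f (dilate ε (z i)))
          ∂(P.map fun (ω : Ω) (z : SpaceTime) => ζ (z + dilate ε h) ω) :=
        (integral_map h2.aemeasurable h3.aestronglyMeasurable).symm
    _ = ∫ f, ∏ i ∈ A, (ε ^ (-(5 / 2) : ℝ) * f (dilate ε (z i)))
          ∂(P.map fun (ω : Ω) (z : SpaceTime) => ζ z ω) := by rw [hζ.stationary]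
    _ = _ := integral_map h1.aemeasurable h3.aestronglyMeasurable

theorem prod_le_one_add_sum_pow {ι : Type*} (A : Finset ι) (a : ι → ℝ) (ha : ∀ i, 0 ≤ a i) (n : ℕ)
    (hn : A.card ≤ n) : ∏ i ∈ A, a i ≤ 1 + ∑ i ∈ A, a i ^ n := by
  rcases A.eq_empty_or_nonempty with rfl | hA
  · simp
  · obtain ⟨j, hj, hmax⟩ := A.exists_max_image a hA
    have h1 : ∏ i ∈ A, a i ≤ a j ^ A.card := by
      rw [← Finset.prod_const]
      exact Finset.prod_le_prod (fun i _ => ha i) hmax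
    have h2 : a j ^ n ≤ ∑ i ∈ A, a i ^ n :=
      Finset.single_le_sum (f := fun i => a i ^ n) (fun i _ => by have := ha i; positivity) hj
    rcases le_total (a j) 1 with h | h
    · have h3 : a j ^ A.card ≤ 1 := pow_le_one₀ (ha j) h
      have h4 : 0 ≤ a j ^ n := by have := ha j; positivity
      linarith
    · have h3 : a j ^ A.card ≤ a j ^ n := pow_le_pow_right₀ h hn
      linarith

/-- Hölder's inequality is replaced by `prod_le_one_add_sum_pow`, with a power above the number of
factors. The exponent exceeds `1` even if there are no factors, as the moment bounds demand. -/
theorem exists_abs_moment_le (ι : Type*) [Fintype ι] {Ω : Type*} [MeasurableSpace Ω]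
    {P : Measure Ω} [IsProbabilityMeasure P] {ζ : ℝ → SpaceTime → Ω → ℝ}
    (hζ : IsNoiseFamily P ζ) :
    ∃ M : ℝ, 0 ≤ M ∧ ∀ ε ∈ Ioo (0 : ℝ) 1, ∀ (z : ι → SpaceTime) (A : Finset ι),
      |∫ ω, ∏ i ∈ A, rescaledNoise ε (ζ ε) (z i) ω ∂P| ≤
        M * (ε ^ (-(5 / 2) : ℝ)) ^ A.card := by
  set n : ℕ := Fintype.card ι + 2
  obtain ⟨M, hM⟩ := hζ.uniform_moments n (by simp only [n]; push_cast; linarith)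
  refine ⟨1 + n * |M|, by positivity, fun ε hε z A => ?_⟩
  have hs : 0 ≤ ε ^ (-(5 / 2) : ℝ) := Real.rpow_nonneg hε.1.le _
  have hint : ∀ z, Integrable (fun ω => |ζ ε z ω| ^ n) P := fun z => by
    have := (hζ.isNoise ε hε).moments n (by simp only [n]; push_cast; linarith) z
    simpa only [Real.rpow_natCast] using this
  have hA : A.card ≤ n := (Finset.card_le_univ A).trans (by simp [n])
  have h1 : |∫ ω, ∏ i ∈ A, ζ ε (dilate ε (z i)) ω ∂P| ≤
      ∫ ω, (1 + ∑ i ∈ A, |ζ ε (dilate ε (z i)) ω| ^ n) ∂P := by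
    rw [← Real.norm_eq_abs]
    refine norm_integral_le_of_norm_le ((integrable_const _).add
      (integrable_finsetSum _ fun i _ => hint _)) (Eventually.of_forall fun ω => ?_)
    rw [Real.norm_eq_abs, Finset.abs_prod]
    exact prod_le_one_add_sum_pow A _ (fun i => abs_nonneg _) n hA
  have h2 : ∫ ω, (1 + ∑ i ∈ A, |ζ ε (dilate ε (z i)) ω| ^ n) ∂P ≤ 1 + n * |M| := by
    rw [integral_add (integrable_const _) (integrable_finsetSum _ fun i _ => hint _),
      integral_finsetSum _ fun i _ => hint _]
    have : ∀ i ∈ A, ∫ ω, |ζ ε (dilate ε (z i)) ω| ^ n ∂P ≤ |M| := fun i _ => by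
      have := hM ε hε (dilate ε (z i))
      simp only [Real.rpow_natCast] at this
      exact this.trans (le_abs_self M)
    have := Finset.sum_le_sum this
    simp only [Finset.sum_const, nsmul_eq_mul] at this
    have h3 : (A.card : ℝ) * |M| ≤ n * |M| := by gcongr
    simp only [integral_const, probReal_univ, smul_eq_mul, mul_one]
    linarith
  simp only [rescaledNoise_eq, Finset.prod_mul_distrib, Finset.prod_const]
  rw [integral_const_mul, abs_mul, abs_of_nonneg (pow_nonneg hs _), mul_comm]
  gcongr
  exact h1.trans h2

/-- Moments factorise over points that are at periodic parabolic distance at least `ε`. -/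
theorem moment_factorises {ι Ω : Type*} [MeasurableSpace Ω] {P : Measure Ω} {ε : ℝ}
    (hε : 0 < ε) {ζ : SpaceTime → Ω → ℝ} (hζ : IsNoise P ε ζ) (z : ι → SpaceTime) (I : Set ι)
    [DecidablePred (· ∈ I)] (hI : ∀ i ∈ I, ∀ j ∉ I, ε ≤ torusSize (z i - z j)) (A : Finset ι) :
    ∫ ω, ∏ i ∈ A, rescaledNoise ε ζ (z i) ω ∂P =
      (∫ ω, ∏ i ∈ A with i ∈ I, rescaledNoise ε ζ (z i) ω ∂P) *
        ∫ ω, ∏ i ∈ A with i ∉ I, rescaledNoise ε ζ (z i) ω ∂P := by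
  set S : Set SpaceTime := (fun i => dilate ε (z i)) '' (A.filter (· ∈ I) : Finset ι)
  set T : Set SpaceTime := (fun i => dilate ε (z i)) '' (A.filter (· ∉ I) : Finset ι)
  have hind := hζ.independent S T ((Finset.finite_toSet _).image _).isCompact
    ((Finset.finite_toSet _).image _).isCompact (by
      rintro _ ⟨i, hi, rfl⟩ _ ⟨j, hj, rfl⟩
      rw [torusDist_dilate hε, one_le_div hε]
      exact hI i (Finset.mem_filter.1 hi).2 j (Finset.mem_filter.1 hj).2)
  have hmeas : ∀ (B : Finset ι) (U : Set SpaceTime), (∀ i ∈ B, dilate ε (z i) ∈ U) →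
      Measurable[⨆ w ∈ U, MeasurableSpace.comap (ζ w) inferInstance]
        fun ω => ∏ i ∈ B, rescaledNoise ε ζ (z i) ω := by
    intro B U hU
    refine Finset.measurable_prod _ fun i hi => Measurable.const_mul ?_ _
    refine (comap_measurable (ζ (dilate ε (z i)))).mono ?_ le_rfl
    exact le_iSup₂ (f := fun w (_ : w ∈ U) => MeasurableSpace.comap (ζ w) inferInstance)
      (dilate ε (z i)) (hU i hi)
  have hif : IndepFun (fun ω => ∏ i ∈ A with i ∈ I, rescaledNoise ε ζ (z i) ω)
      (fun ω => ∏ i ∈ A with i ∉ I, rescaledNoise ε ζ (z i) ω) P := by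
    rw [IndepFun_iff_Indep]
    refine indep_of_indep_of_le_left (indep_of_indep_of_le_right hind ?_) ?_
    · exact (hmeas _ T fun i hi => ⟨i, hi, rfl⟩).comap_le
    · exact (hmeas _ S fun i hi => ⟨i, hi, rfl⟩).comap_le
  have hm : ∀ B : Finset ι, AEStronglyMeasurable
      (fun ω => ∏ i ∈ B, rescaledNoise ε ζ (z i) ω) P := fun B =>
    (Finset.measurable_prod _ fun i _ => measurable_rescaledNoise hζ _).aestronglyMeasurable
  rw [← hif.integral_fun_mul_eq_mul_integral (hm _) (hm _)]
  refine integral_congr_ae (Eventually.of_forall fun ω => ?_)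
  exact (Finset.prod_filter_mul_prod_filter_not A (· ∈ I) _).symm

/-- The joint cumulant of `n` noise variables vanishes unless the points are within distance `n ε`
of each other: otherwise, by the pigeonhole principle, some annulus of width `ε` around one of the
points contains none of the others, and the noise inside it is independent of the noise outside. -/
theorem jointCumulant_noise_eq_zero {ι Ω : Type*} [Fintype ι] [DecidableEq ι] [MeasurableSpace Ω]
    {P : Measure Ω} {ε : ℝ} (hε : 0 < ε) {ζ : SpaceTime → Ω → ℝ} (hζ : IsNoise P ε ζ)
    (z : ι → SpaceTime) (i j : ι) (hij : Fintype.card ι * ε < torusSize (z j - z i)) :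
    jointCumulant P (fun k => rescaledNoise ε ζ (z k)) Finset.univ = 0 := by
  classical
  set d : ι → ℝ := fun k => torusSize (z k - z i)
  have hdi : d i = 0 := by simp [d, torusSize]
  -- There are `card ι` annuli before `z j` is reached. If each of them contained some `z k`, then
  -- no index would be left for `j`.
  have hgap : ∃ m : Fin (Fintype.card ι), ∀ k, ¬ ((m : ℝ) * ε ≤ d k ∧ d k < (m + 1) * ε) := by
    by_contra! hcon
    choose f hf using hcon
    have hinj : Function.Injective f := by
      intro m m' hmm
      have h1 := hf m
      have h2 := hf m'
      rw [← hmm] at h2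
      have h3 : ((m : ℕ) : ℝ) < (m' : ℕ) + 1 := lt_of_mul_lt_mul_right (h1.1.trans_lt h2.2) hε.le
      have h4 : ((m' : ℕ) : ℝ) < (m : ℕ) + 1 := lt_of_mul_lt_mul_right (h2.1.trans_lt h1.2) hε.le
      have h5 : (m : ℕ) < (m' : ℕ) + 1 := by exact_mod_cast h3
      have h6 : (m' : ℕ) < (m : ℕ) + 1 := by exact_mod_cast h4
      exact Fin.ext (by omega)
    have hsurj : Function.Surjective f :=
      ((Fintype.bijective_iff_injective_and_card f).2 ⟨hinj, by simp⟩).2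
    obtain ⟨m, rfl⟩ := hsurj j
    have h1 := (hf m).2
    have h2 : ((m : ℕ) : ℝ) + 1 ≤ Fintype.card ι := by exact_mod_cast m.2
    have h3 : ((m : ℕ) + 1 : ℝ) * ε ≤ Fintype.card ι * ε := by gcongr
    simp only [d] at h1
    linarith
  obtain ⟨m, hm⟩ := hgap
  -- The innermost annulus contains `z i` itself.
  have hm0 : 0 < ((m : ℕ) : ℝ) := by
    by_contra h0
    have h0' : ((m : ℕ) : ℝ) = 0 := le_antisymm (not_lt.1 h0) (Nat.cast_nonneg _)
    refine hm i ⟨?_, ?_⟩ <;> rw [hdi, h0'] <;> linarith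
  have hmn : ((m : ℕ) : ℝ) * ε ≤ Fintype.card ι * ε := by
    have : ((m : ℕ) : ℝ) ≤ Fintype.card ι := by exact_mod_cast m.2.le
    gcongr
  refine jointCumulant_eq_zero P _ {k | d k < m * ε} (fun A => ?_) _ ⟨i, ?_⟩ ⟨j, ?_⟩
  · refine moment_factorises hε hζ z _ (fun k hk l hl => ?_) A
    have hk' : d k < m * ε := hk
    have hl' : m * ε ≤ d l := not_lt.1 hl
    have h1 : (m + 1) * ε ≤ d l := not_lt.1 fun h => hm l ⟨hl', h⟩
    have h2 := torusSize_sub_le (z l) (z k) (z i)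
    rw [torusSize_sub_comm (z l) (z k)] at h2
    simp only [d] at h1 hk'
    linarith
  · simp only [Finset.mem_filter, Finset.mem_univ, true_and]
    show d i < m * ε
    rw [hdi]
    positivity
  · simp only [Finset.mem_filter, Finset.mem_univ, true_and]
    show ¬ d j < m * ε
    simp only [d]
    linarith

/-! ### Cumulant blocks -/

theorem measurable_comp₂ {α : Type*} [MeasurableSpace α] {f : SpaceTime → SpaceTime → ENNReal}
    (hf : Measurable (Function.uncurry f)) {a b : α → SpaceTime} (ha : Measurable a)
    (hb : Measurable b) : Measurable fun x => f (a x) (b x) :=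
  hf.comp (ha.prodMk hb)

theorem lintegral_fin_succ {n : ℕ} (F : (Fin (n + 1) → SpaceTime) → ENNReal) (hF : Measurable F) :
    ∫⁻ x, F x = ∫⁻ y : SpaceTime, ∫⁻ x : Fin n → SpaceTime, F (Fin.cons y x) := by
  have e := (volume_preserving_piFinSuccAbove (fun _ : Fin (n + 1) => SpaceTime) 0).symm
  have h1 := e.lintegral_comp hF
  rw [← h1, Measure.volume_eq_prod]
  refine (lintegral_prod _ (hF.comp e.measurable).aemeasurable).trans ?_
  simp [MeasurableEquiv.piFinSuccAbove_symm_apply, Fin.insertNthEquiv]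

theorem lintegral_prod_fin {n : ℕ} (g : SpaceTime → ENNReal) (hg : Measurable g) :
    ∫⁻ x : Fin n → SpaceTime, ∏ i, g (x i) = (∫⁻ y, g y) ^ n := by
  induction n with
  | zero => simp [volume_pi]
  | succ n ih =>
    have hm' : Measurable fun x : Fin (n + 1) → SpaceTime => ∏ i, g (x i) :=
      Finset.measurable_prod _ fun i _ => hg.comp (measurable_pi_apply i)
    rw [lintegral_fin_succ _ hm']
    have hm : Measurable fun x : Fin n → SpaceTime => ∏ i, g (x i) :=
      Finset.measurable_prod _ fun i _ => hg.comp (measurable_pi_apply i)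
    simp only [Fin.prod_univ_succ, Fin.cons_zero, Fin.cons_succ]
    simp_rw [lintegral_const_mul _ hm, ih]
    rw [lintegral_mul_const _ hg, pow_succ']

/-- The integral over a star-shaped cluster of points factorises once its centre is fixed. -/
theorem lintegral_cluster {k m : ℕ} (f g : SpaceTime → SpaceTime → ENNReal)
    (hf : Measurable (Function.uncurry f)) (hg : Measurable (Function.uncurry g))
    (h : SpaceTime → ENNReal) (hh : Measurable h) :
    ∫⁻ q : (Fin k → SpaceTime) × (Fin (m + 1) → SpaceTime),
        (∏ i, f (q.1 i) (q.2 0)) * (h (q.2 0) * ∏ j : Fin m, g (q.2 j.succ) (q.2 0)) =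
      ∫⁻ y, h y * (∫⁻ x, f x y) ^ k * (∫⁻ x, g x y) ^ m := by
  have hm1 : Measurable fun q : (Fin k → SpaceTime) × (Fin (m + 1) → SpaceTime) =>
      (∏ i, f (q.1 i) (q.2 0)) := by
    refine Finset.measurable_prod _ fun i _ => ?_
    exact measurable_comp₂ hf (by fun_prop) (by fun_prop)
  have hm2 : Measurable fun y : Fin (m + 1) → SpaceTime =>
      h (y 0) * ∏ j : Fin m, g (y j.succ) (y 0) := by
    refine (hh.comp (measurable_pi_apply 0)).mul (Finset.measurable_prod _ fun i _ => ?_)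
    exact measurable_comp₂ hg (by fun_prop) (by fun_prop)
  rw [Measure.volume_eq_prod]
  refine (lintegral_prod_symm' _ (hm1.mul (hm2.comp measurable_snd))).trans ?_
  simp only [Pi.mul_apply, Function.comp_apply]
  have hfy : ∀ y, Measurable fun x => f x y := fun y =>
    hf.comp (measurable_id.prodMk measurable_const)
  have hgy : ∀ y, Measurable fun x => g x y := fun y =>
    hg.comp (measurable_id.prodMk measurable_const)
  have h1 : ∀ y : Fin (m + 1) → SpaceTime, ∫⁻ x : Fin k → SpaceTime,
      (∏ i, f (x i) (y 0)) * (h (y 0) * ∏ j : Fin m, g (y j.succ) (y 0)) =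
      (∫⁻ x, f x (y 0)) ^ k * (h (y 0) * ∏ j : Fin m, g (y j.succ) (y 0)) := by
    intro y
    have hm : Measurable fun x : Fin k → SpaceTime => ∏ i, f (x i) (y 0) :=
      Finset.measurable_prod _ fun i _ => (hfy _).comp (measurable_pi_apply i)
    rw [lintegral_mul_const _ hm, lintegral_prod_fin (fun x => f x (y 0)) (hfy (y 0))]
  simp_rw [h1]
  have hint : Measurable fun y => ∫⁻ x, f x y := hf.lintegral_prod_left
  refine (lintegral_fin_succ _ (((hint.comp (measurable_pi_apply 0)).pow_const k).mul hm2)).trans ?_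
  refine lintegral_congr fun y => ?_
  have hm : Measurable fun x : Fin m → SpaceTime => ∏ j, g (x j) y :=
    Finset.measurable_prod _ fun i _ => (hgy _).comp (measurable_pi_apply i)
  simp only [Pi.mul_apply, Function.comp_apply, Fin.cons_zero, Fin.cons_succ]
  simp_rw [← mul_assoc]
  rw [lintegral_const_mul _ hm, lintegral_prod_fin (fun x => g x y) (hgy y)]
  ring

/-- The joint cumulant that enters a cumulant block, as a function of the noise vertices. -/
noncomputable def blockCumulant {Ω : Type*} [MeasurableSpace Ω] (P : Measure Ω)
    (η : SpaceTime → Ω → ℝ) (b : ℕ × ℕ) (q : (Fin b.1 → SpaceTime) × (Fin b.2 → SpaceTime)) : ℝ :=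
  jointCumulant P (fun i : Fin b.1 ⊕ Fin b.2 => η (Sum.elim q.1 q.2 i)) Finset.univ

theorem measurable_blockCumulant {Ω : Type*} [MeasurableSpace Ω] {P : Measure Ω}
    [IsProbabilityMeasure P] {ε : ℝ} {ζ : SpaceTime → Ω → ℝ} (hζ : IsNoise P ε ζ) (b : ℕ × ℕ) :
    Measurable (blockCumulant P (rescaledNoise ε ζ) b) := by
  refine measurable_jointCumulant P
    (fun (q : (Fin b.1 → SpaceTime) × (Fin b.2 → SpaceTime)) (i : Fin b.1 ⊕ Fin b.2) =>
    rescaledNoise ε ζ (Sum.elim q.1 q.2 i)) (fun A => ?_) _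
  refine measurable_moment hζ (z := fun (q : (Fin b.1 → SpaceTime) × (Fin b.2 → SpaceTime))
    (i : Fin b.1 ⊕ Fin b.2) => Sum.elim q.1 q.2 i) ?_ A
  rintro (i | i)
  · exact (measurable_pi_apply i).comp measurable_fst
  · exact (measurable_pi_apply i).comp measurable_snd

theorem blockCumulant_add {Ω : Type*} [MeasurableSpace Ω] {P : Measure Ω}
    {ε : ℝ} {ζ : SpaceTime → Ω → ℝ} (hζ : IsNoise P ε ζ) (b : ℕ × ℕ)
    (q : (Fin b.1 → SpaceTime) × (Fin b.2 → SpaceTime)) (h : SpaceTime) :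
    blockCumulant P (rescaledNoise ε ζ) b (fun i => q.1 i + h, fun j => q.2 j + h) =
      blockCumulant P (rescaledNoise ε ζ) b q := by
  refine jointCumulant_congr P P _ _ (fun A => ?_) _
  rw [← moment_add hζ (fun i => Sum.elim q.1 q.2 i) h A]
  refine integral_congr_ae (Eventually.of_forall fun ω => ?_)
  refine Finset.prod_congr rfl fun i _ => ?_
  rcases i with i | i <;> rfl

theorem exists_abs_blockCumulant_le {Ω : Type*} [MeasurableSpace Ω] {P : Measure Ω}
    [IsProbabilityMeasure P] {ζ : ℝ → SpaceTime → Ω → ℝ} (hζ : IsNoiseFamily P ζ) (b : ℕ × ℕ) :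
    ∃ C : ℝ, 0 ≤ C ∧ ∀ ε ∈ Ioo (0 : ℝ) 1, ∀ q,
      |blockCumulant P (rescaledNoise ε (ζ ε)) b q| ≤
        C * (ε ^ (-(5 / 2) : ℝ)) ^ (b.1 + b.2) := by
  obtain ⟨M, hM, h⟩ := exists_abs_moment_le (Fin b.1 ⊕ Fin b.2) hζ
  obtain ⟨C, hC, h'⟩ := exists_abs_jointCumulant_le M hM
    (Finset.univ : Finset (Fin b.1 ⊕ Fin b.2))
  refine ⟨C, hC, fun ε hε q => ?_⟩
  have := h' Ω P (fun i => rescaledNoise ε (ζ ε) (Sum.elim q.1 q.2 i)) (ε ^ (-(5 / 2) : ℝ))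
    (Real.rpow_nonneg hε.1.le _) (fun A => h ε hε _ A)
  simpa [blockCumulant] using this

theorem torusSize_le_of_blockCumulant_ne_zero {Ω : Type*} [MeasurableSpace Ω] {P : Measure Ω}
    {ε : ℝ} (hε : 0 < ε) {ζ : SpaceTime → Ω → ℝ} (hζ : IsNoise P ε ζ) (b : ℕ × ℕ)
    (q : (Fin b.1 → SpaceTime) × (Fin b.2 → SpaceTime))
    (hq : blockCumulant P (rescaledNoise ε ζ) b q ≠ 0) (i j : Fin b.1 ⊕ Fin b.2) :
    torusSize (Sum.elim q.1 q.2 i - Sum.elim q.1 q.2 j) ≤ ((b.1 + b.2 : ℕ) : ℝ) * ε := by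
  by_contra h
  refine hq (jointCumulant_noise_eq_zero hε hζ _ j i ?_)
  simpa using not_le.1 h

theorem blockIntegrand_eq {Ω : Type*} [MeasurableSpace Ω] (P : Measure Ω) (η : SpaceTime → Ω → ℝ)
    (K : SpaceTime → ℝ) (b : ℕ × ℕ) (v w : SpaceTime)
    (q : (Fin b.1 → SpaceTime) × (Fin b.2 → SpaceTime)) :
    blockIntegrand P η K b v w q =
      (∏ i, K (w - q.1 i)) * (∏ j, K (v - q.2 j)) * blockCumulant P η b q := rfl

/-- The support of the cumulant is covered by star-shaped clusters around the first vertex `y`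
attached to `v`, so that all other vertices can be integrated out separately. -/
theorem lintegral_blockIntegrand_le {K : SpaceTime → ℝ} (hK : IsTruncatedHeatKernel K)
    {Ω : Type*} [MeasurableSpace Ω] {P : Measure Ω} [IsProbabilityMeasure P]
    {ζ : ℝ → SpaceTime → Ω → ℝ} (hζ : IsNoiseFamily P ζ) (k m : ℕ) :
    ∃ C : ℝ, 0 ≤ C ∧ ∀ ε ∈ Ioo (0 : ℝ) 1, ∀ v w : SpaceTime,
      ∫⁻ q, ENNReal.ofReal |blockIntegrand P (rescaledNoise ε (ζ ε)) K (k, m + 1) v w q| ≤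
        ENNReal.ofReal (C * (ε ^ (-(5 / 2) : ℝ)) ^ (k + (m + 1)) * (ε ^ 5) ^ (k + m)) *
          ∫⁻ y, ENNReal.ofReal |K (v - y)| *
            ENNReal.ofReal (((torusSize (w - y) + ε) ^ (-3 : ℝ)) ^ k *
              ((torusSize (v - y) + ε) ^ (-3 : ℝ)) ^ m) := by
  obtain ⟨C, hC, hcum⟩ := exists_abs_blockCumulant_le hζ (k, m + 1)
  set N : ℝ := ((k + (m + 1) : ℕ) : ℝ) with hNdef
  have hN : 1 ≤ N := by
    rw [hNdef]
    push_cast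
    have h1 : (0 : ℝ) ≤ k := Nat.cast_nonneg k
    have h2 : (0 : ℝ) ≤ m := Nat.cast_nonneg m
    linarith
  obtain ⟨A, hA, hker⟩ := exists_lintegral_kernel_le hK hN
  refine ⟨C * A ^ (k + m), by positivity, fun ε hε v w => ?_⟩
  have hε0 : 0 < ε := hε.1
  have hKm := measurable_of_isTruncatedHeatKernel hK
  set s := ε ^ (-(5 / 2) : ℝ)
  have hs : 0 ≤ s := Real.rpow_nonneg hε0.le _
  set f : SpaceTime → SpaceTime → SpaceTime → ENNReal := fun u x y =>
    {x | torusSize (x - y) ≤ N * ε}.indicator (fun x => ENNReal.ofReal |K (u - x)|) x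
  have hf : ∀ u, Measurable (Function.uncurry (f u)) := by
    intro u
    have : Function.uncurry (f u) =
        {p : SpaceTime × SpaceTime | torusSize (p.1 - p.2) ≤ N * ε}.indicator
        (fun p => ENNReal.ofReal |K (u - p.1)|) := by
      funext p
      simp [f, Function.uncurry, indicator]
    rw [this]
    refine Measurable.indicator ?_ (measurableSet_le (by fun_prop) measurable_const)
    exact ((hKm.comp (by fun_prop)).abs).ennreal_ofReal
  have hfint : ∀ u y, ∫⁻ x, f u x y ≤
      ENNReal.ofReal (A * ε ^ 5 * (torusSize (u - y) + ε) ^ (-3 : ℝ)) := by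
    intro u y
    simp only [f]
    rw [lintegral_indicator (measurableSet_le (by fun_prop) measurable_const)]
    exact hker ε hε0 u y
  have hpt : ∀ q : (Fin k → SpaceTime) × (Fin (m + 1) → SpaceTime),
      ENNReal.ofReal |blockIntegrand P (rescaledNoise ε (ζ ε)) K (k, m + 1) v w q| ≤
      ENNReal.ofReal (C * s ^ (k + (m + 1))) * ((∏ i, f w (q.1 i) (q.2 0)) *
        (ENNReal.ofReal |K (v - q.2 0)| * ∏ j : Fin m, f v (q.2 j.succ) (q.2 0))) := by
    intro q
    rw [blockIntegrand_eq]
    by_cases hq : blockCumulant P (rescaledNoise ε (ζ ε)) (k, m + 1) q = 0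
    · rw [hq]
      simp
    · have hclose := torusSize_le_of_blockCumulant_ne_zero hε0 (hζ.isNoise ε hε) (k, m + 1) q hq
      have h1 : ∀ i, f w (q.1 i) (q.2 0) = ENNReal.ofReal |K (w - q.1 i)| := fun i => by
        have := hclose (Sum.inl i) (Sum.inr 0)
        exact indicator_of_mem (s := {x | torusSize (x - q.2 0) ≤ N * ε}) this _
      have h2 : ∀ j : Fin m, f v (q.2 j.succ) (q.2 0) = ENNReal.ofReal |K (v - q.2 j.succ)| :=
        fun j => by
          have := hclose (Sum.inr j.succ) (Sum.inr 0)
          exact indicator_of_mem (s := {x | torusSize (x - q.2 0) ≤ N * ε}) this _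
      simp_rw [h1, h2]
      rw [← ENNReal.ofReal_prod_of_nonneg fun i _ => abs_nonneg _,
        ← ENNReal.ofReal_prod_of_nonneg fun i _ => abs_nonneg _,
        ← ENNReal.ofReal_mul (abs_nonneg _), ← ENNReal.ofReal_mul (by positivity),
        ← ENNReal.ofReal_mul (by positivity)]
      refine ENNReal.ofReal_le_ofReal ?_
      rw [abs_mul, abs_mul, Finset.abs_prod, Finset.abs_prod, Fin.prod_univ_succ, mul_comm]
      exact mul_le_mul_of_nonneg_right (hcum ε hε q) (by positivity)
  have hm1 : Measurable fun q : (Fin k → SpaceTime) × (Fin (m + 1) → SpaceTime) =>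
      (∏ i, f w (q.1 i) (q.2 0)) *
        (ENNReal.ofReal |K (v - q.2 0)| * ∏ j : Fin m, f v (q.2 j.succ) (q.2 0)) := by
    refine (Finset.measurable_prod _ fun i _ => ?_).mul
      (Measurable.mul ?_ (Finset.measurable_prod _ fun i _ => ?_))
    · exact measurable_comp₂ (hf w) (by fun_prop) (by fun_prop)
    · exact ((hKm.comp (by fun_prop)).abs).ennreal_ofReal
    · exact measurable_comp₂ (hf v) (by fun_prop) (by fun_prop)
  calc _ ≤ ∫⁻ q : (Fin k → SpaceTime) × (Fin (m + 1) → SpaceTime),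
          ENNReal.ofReal (C * s ^ (k + (m + 1))) * ((∏ i, f w (q.1 i) (q.2 0)) *
            (ENNReal.ofReal |K (v - q.2 0)| * ∏ j : Fin m, f v (q.2 j.succ) (q.2 0))) :=
        lintegral_mono hpt
    _ = ENNReal.ofReal (C * s ^ (k + (m + 1))) *
          ∫⁻ y, ENNReal.ofReal |K (v - y)| * (∫⁻ x, f w x y) ^ k * (∫⁻ x, f v x y) ^ m := by
        rw [lintegral_const_mul _ hm1, lintegral_cluster (f w) (f v) (hf w) (hf v)
          (fun y => ENNReal.ofReal |K (v - y)|) ((hKm.comp (by fun_prop)).abs).ennreal_ofReal]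
    _ ≤ ENNReal.ofReal (C * s ^ (k + (m + 1))) * ∫⁻ y, ENNReal.ofReal ((A * ε ^ 5) ^ (k + m)) *
          (ENNReal.ofReal |K (v - y)| *
            ENNReal.ofReal (((torusSize (w - y) + ε) ^ (-3 : ℝ)) ^ k *
              ((torusSize (v - y) + ε) ^ (-3 : ℝ)) ^ m)) := by
        refine mul_le_mul_right (lintegral_mono fun y => ?_) _
        have h0 : ∀ u, 0 ≤ torusSize (u - y) + ε := fun u => by
          have := torusSize_nonneg (u - y)
          linarith
        calc _ ≤ ENNReal.ofReal |K (v - y)| *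
              (ENNReal.ofReal (A * ε ^ 5 * (torusSize (w - y) + ε) ^ (-3 : ℝ))) ^ k *
              (ENNReal.ofReal (A * ε ^ 5 * (torusSize (v - y) + ε) ^ (-3 : ℝ))) ^ m := by
              gcongr
              · exact hfint w y
              · exact hfint v y
          _ = _ := by
              have h1 := h0 w
              have h2 := h0 v
              rw [← ENNReal.ofReal_pow (by positivity), ← ENNReal.ofReal_pow (by positivity),
                ← ENNReal.ofReal_mul (abs_nonneg _), ← ENNReal.ofReal_mul (by positivity),
                ← ENNReal.ofReal_mul (abs_nonneg _), ← ENNReal.ofReal_mul (by positivity)]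
              congr 1
              rw [mul_pow, mul_pow, pow_add]
              ring
    _ = _ := by
        rw [lintegral_const_mul' _ _ ENNReal.ofReal_ne_top, ← mul_assoc,
          ← ENNReal.ofReal_mul (by positivity)]
        congr 2
        rw [mul_pow]
        ring

theorem add_rpow_neg_le {d ε : ℝ} (hd : 0 < d) (hε : 0 < ε) {a q : ℝ} (hq : 0 ≤ q) (hqa : q ≤ a) :
    (d + ε) ^ (-a) ≤ ε ^ (q - a) * d ^ (-q) := by
  rw [show -a = (q - a) + -q by ring, Real.rpow_add (by positivity)]
  refine mul_le_mul ?_ ?_ (by positivity) (by positivity)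
  · exact Real.rpow_le_rpow_of_nonpos hε (by linarith) (by linarith)
  · exact Real.rpow_le_rpow_of_nonpos hd (by linarith) (by linarith)

/-- The bound on a block, with the order `p + q - 2` split between the two vertices: of the kernels
smoothened at scale `ε`, those at `v` are used with total power `-p` and those at `w` with total
power `-q`. The remaining singular kernel at `v` then turns these into a convolution of the powers
`-(3 + p)` and `-q`. -/
theorem exists_abs_blockKernel_le_aux {K : SpaceTime → ℝ} (hK : IsTruncatedHeatKernel K)
    {Ω : Type*} [MeasurableSpace Ω] {P : Measure Ω} [IsProbabilityMeasure P]
    {ζ : ℝ → SpaceTime → Ω → ℝ} (hζ : IsNoiseFamily P ζ) (k m : ℕ) {p q : ℝ}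
    (hp0 : 0 ≤ p) (hp1 : p ≤ 3 * m) (hp2 : p < 2) (hq0 : 0 ≤ q) (hq1 : q ≤ 3 * k) (hq2 : q < 5)
    (hpq : 2 < p + q) :
    ∃ C : ℝ, 0 ≤ C ∧ ∀ ε ∈ Ioo (0 : ℝ) 1, ∀ v w : SpaceTime, 0 < torusSize (v - w) →
      |blockKernel P (rescaledNoise ε (ζ ε)) K (k, m + 1) v w| ≤
        C * (ε ^ (-((k + (m + 1) : ℕ) : ℝ) / 2 + (p + q - 2)) *
          torusSize (v - w) ^ (-(p + q - 2))) := by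
  obtain ⟨C, hC, h⟩ := lintegral_blockIntegrand_le hK hζ k m
  obtain ⟨CK, M, hCK, hM, hM0, hCK0⟩ := exists_kernel_bound hK
  obtain ⟨A, hA, hconv⟩ := exists_lintegral_torusSize_rpow_mul_rpow_le M hM.le
    (p := 3 + p) (q := q) (by linarith) (by linarith) hq0 hq2 (by linarith)
  refine ⟨C * CK * A, by positivity, fun ε hε v w hvw => ?_⟩
  have hε0 : 0 < ε := hε.1
  set s := ε ^ (-(5 / 2) : ℝ) with hs
  have hs0 : 0 < s := Real.rpow_pos_of_pos hε0 _
  have hball : MeasurableSet (Metric.closedBall v M) := Metric.isClosed_closedBall.measurableSet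
  set E : ℝ := ε ^ (q - 3 * k) * ε ^ (p - 3 * m) with hE
  have hE0 : 0 < E := by positivity
  have hpow : ∀ (x : ℝ) (j : ℕ), 0 < x → (x ^ (-3 : ℝ)) ^ j = x ^ (-(3 * j : ℝ)) := by
    intro x j hx
    rw [← Real.rpow_natCast, ← Real.rpow_mul hx.le]
    congr 1
    ring
  have hint : ∫⁻ y, ENNReal.ofReal |K (v - y)| *
      ENNReal.ofReal (((torusSize (w - y) + ε) ^ (-3 : ℝ)) ^ k *
        ((torusSize (v - y) + ε) ^ (-3 : ℝ)) ^ m) ≤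
      ENNReal.ofReal (CK * E) * ENNReal.ofReal (A * torusSize (v - w) ^ (5 - (3 + p) - q)) := by
    calc _ ≤ ∫⁻ y, (Metric.closedBall v M).indicator (fun y => ENNReal.ofReal (CK * E) *
            ENNReal.ofReal (torusSize (y - v) ^ (-(3 + p)) * torusSize (y - w) ^ (-q))) y := by
          refine lintegral_mono_ae ?_
          filter_upwards [kernel_abs_ae_le hM0 hCK0 v, ae_torusSize_sub_pos v,
            ae_torusSize_sub_pos w] with y h1 h2 h3
          refine (mul_le_mul_left h1 _).trans ?_
          by_cases hy : y ∈ Metric.closedBall v M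
          · rw [indicator_of_mem hy, indicator_of_mem hy,
              ← ENNReal.ofReal_mul (by positivity), ← ENNReal.ofReal_mul (by positivity)]
            refine ENNReal.ofReal_le_ofReal ?_
            rw [torusSize_sub_comm w y, torusSize_sub_comm v y, hpow _ _ (by positivity),
              hpow _ _ (by positivity)]
            have h4 := add_rpow_neg_le h3 hε0 hq0 hq1
            have h5 := add_rpow_neg_le h2 hε0 hp0 hp1
            calc _ ≤ CK * torusSize (y - v) ^ (-3 : ℝ) *
                  ((ε ^ (q - 3 * k) * torusSize (y - w) ^ (-q)) *
                    (ε ^ (p - 3 * m) * torusSize (y - v) ^ (-p))) := by gcongr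
              _ = _ := by
                  rw [neg_add, Real.rpow_add h2, hE]
                  ring
          · rw [indicator_of_notMem hy, indicator_of_notMem hy, zero_mul]
      _ = ENNReal.ofReal (CK * E) * ∫⁻ y in Metric.closedBall v M,
            ENNReal.ofReal (torusSize (y - v) ^ (-(3 + p)) * torusSize (y - w) ^ (-q)) := by
          rw [lintegral_indicator hball, lintegral_const_mul _ (by fun_prop)]
      _ ≤ _ := by
          gcongr
          exact hconv v v w hvw
  have hfin : ENNReal.ofReal |blockKernel P (rescaledNoise ε (ζ ε)) K (k, m + 1) v w| ≤
      ENNReal.ofReal (C * s ^ (k + (m + 1)) * (ε ^ 5) ^ (k + m) *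
        (CK * E * (A * torusSize (v - w) ^ (5 - (3 + p) - q)))) := by
    rw [ENNReal.ofReal_mul (p := C * s ^ (k + (m + 1)) * (ε ^ 5) ^ (k + m)) (by positivity),
      ENNReal.ofReal_mul (p := CK * E) (by positivity)]
    refine le_trans ?_ ((h ε hε v w).trans (mul_le_mul_right hint _))
    have := enorm_integral_le_lintegral_enorm (μ := volume)
      (blockIntegrand P (rescaledNoise ε (ζ ε)) K (k, m + 1) v w)
    simp only [Real.enorm_eq_ofReal_abs] at this
    exact this
  rw [ENNReal.ofReal_le_ofReal_iff (by positivity)] at hfin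
  refine hfin.trans (le_of_eq ?_)
  have e1 : 5 - (3 + p) - q = -(p + q - 2) := by ring
  have e2 : s ^ (k + (m + 1)) * (ε ^ 5) ^ (k + m) * E =
      ε ^ (-((k + (m + 1) : ℕ) : ℝ) / 2 + (p + q - 2)) := by
    rw [hs, hE, ← Real.rpow_natCast, ← Real.rpow_mul hε0.le, ← pow_mul, ← Real.rpow_natCast,
      ← Real.rpow_add hε0, ← Real.rpow_add hε0, ← Real.rpow_add hε0]
    congr 1
    push_cast
    ring
  rw [e1, ← e2]
  ring

/-- The largest order of singularity used for a cumulant block: order `1` for the covariance, and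
any order below `3`, of which `5/2` is enough, for all other blocks. -/
noncomputable def blockOrder (b : ℕ × ℕ) : ℝ := if b = (1, 1) then 1 else 5 / 2

/-- A cumulant block with `n` noise vertices is of order `ε^{-n/2}` times any power, up to the
order of the block, of the ratio of `ε` and the distance. -/
theorem exists_abs_blockKernel_le {K : SpaceTime → ℝ} (hK : IsTruncatedHeatKernel K)
    {Ω : Type*} [MeasurableSpace Ω] {P : Measure Ω} [IsProbabilityMeasure P]
    {ζ : ℝ → SpaceTime → Ω → ℝ} (hζ : IsNoiseFamily P ζ) {b : ℕ × ℕ} (hb1 : 1 ≤ b.1)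
    (hb2 : 1 ≤ b.2) {a : ℝ} (ha0 : 0 < a) (ha : a ≤ blockOrder b) :
    ∃ C : ℝ, 0 ≤ C ∧ ∀ ε ∈ Ioo (0 : ℝ) 1, ∀ v w : SpaceTime, 0 < torusSize (v - w) →
      |blockKernel P (rescaledNoise ε (ζ ε)) K b v w| ≤
        C * (ε ^ (-((b.1 + b.2 : ℕ) : ℝ) / 2 + a) * torusSize (v - w) ^ (-a)) := by
  obtain ⟨k, l⟩ := b
  obtain ⟨m, rfl⟩ : ∃ m, l = m + 1 := ⟨l - 1, by simp only at hb2; omega⟩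
  simp only at hb1
  have hk : (1 : ℝ) ≤ k := by exact_mod_cast hb1
  have hm : (0 : ℝ) ≤ m := Nat.cast_nonneg m
  unfold blockOrder at ha
  rcases Nat.eq_zero_or_pos m with hm0 | hm0
  -- With a single vertex at `v`, all of the order has to come from the kernels at `w`.
  · have hcap : a + 2 ≤ 3 * k ∧ a < 3 := by
      split_ifs at ha with h
      · constructor <;> linarith
      · have : 2 ≤ k := by
          by_contra hk2
          exact h (by rw [hm0, show k = 1 by omega])
        have : (2 : ℝ) ≤ k := by exact_mod_cast this
        constructor <;> linarith
    obtain ⟨C, hC, h⟩ := exists_abs_blockKernel_le_aux hK hζ k m (p := 0) (q := a + 2) le_rfl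
      (by linarith) (by norm_num) (by linarith) hcap.1 (by linarith [hcap.2]) (by linarith)
    refine ⟨C, hC, fun ε hε v w hvw => ?_⟩
    have := h ε hε v w hvw
    rwa [show 0 + (a + 2) - 2 = a by ring] at this
  -- Otherwise take `p = 3/2` from the kernels at `v`, which leaves at most `3` for those at `w`.
  · have hm1 : (1 : ℝ) ≤ m := by exact_mod_cast hm0
    have hcap : a ≤ 5 / 2 := by split_ifs at ha <;> linarith
    obtain ⟨C, hC, h⟩ := exists_abs_blockKernel_le_aux hK hζ k m (p := 3 / 2) (q := a + 1 / 2)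
      (by norm_num) (by linarith) (by norm_num) (by linarith) (by linarith) (by linarith)
      (by linarith)
    refine ⟨C, hC, fun ε hε v w hvw => ?_⟩
    have := h ε hε v w hvw
    rwa [show 3 / 2 + (a + 1 / 2) - 2 = a by ring] at this

/-! ### Convergence of the graphs, and the cancellation of the mass -/

instance (k : ℕ) : (volume : Measure (Fin k → SpaceTime)).IsAddLeftInvariant :=
  inferInstanceAs (Measure.pi fun _ : Fin k => (volume : Measure SpaceTime)).IsAddLeftInvariant

set_option synthInstance.maxSize 1000 in
instance (k l : ℕ) :
    (volume : Measure ((Fin k → SpaceTime) × (Fin l → SpaceTime))).IsAddLeftInvariant :=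
  Measure.prod.instIsAddLeftInvariant (μ := (volume : Measure (Fin k → SpaceTime)))
    (ν := (volume : Measure (Fin l → SpaceTime)))

section Noise

variable {K : SpaceTime → ℝ} {Ω : Type*} [MeasurableSpace Ω] {P : Measure Ω}
  {ζ : ℝ → SpaceTime → Ω → ℝ}

theorem integrable_kernel_prod (hK : Integrable K) (b : ℕ × ℕ) (v w : SpaceTime) :
    Integrable fun q : (Fin b.1 → SpaceTime) × (Fin b.2 → SpaceTime) =>
      (∏ i, K (w - q.1 i)) * (∏ j, K (v - q.2 j)) := by
  have h1 : Integrable fun x : Fin b.1 → SpaceTime => ∏ i, K (w - x i) :=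
    Integrable.fintype_prod (f := fun _ x => K (w - x)) fun _ => hK.comp_sub_left w
  have h2 : Integrable fun x : Fin b.2 → SpaceTime => ∏ i, K (v - x i) :=
    Integrable.fintype_prod (f := fun _ x => K (v - x)) fun _ => hK.comp_sub_left v
  exact h1.mul_prod h2

theorem integrable_blockIntegrand [IsProbabilityMeasure P]
    (hK : IsTruncatedHeatKernel K) (hζ : IsNoiseFamily P ζ) {ε : ℝ}
    (hε : ε ∈ Ioo (0 : ℝ) 1) (b : ℕ × ℕ) (v w : SpaceTime) :
    Integrable (blockIntegrand P (rescaledNoise ε (ζ ε)) K b v w) := by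
  obtain ⟨C, -, hC⟩ := exists_abs_blockCumulant_le hζ b
  exact (integrable_kernel_prod (integrable_of_isTruncatedHeatKernel hK) b v w).mul_bdd
    (measurable_blockCumulant (hζ.isNoise ε hε) b).aestronglyMeasurable
    (Eventually.of_forall fun q => hC ε hε q)

/-- For fixed `ε` the cumulants are bounded and the kernel is integrable. -/
theorem exists_abs_blockKernel_le_const [IsProbabilityMeasure P]
    (hK : IsTruncatedHeatKernel K) (hζ : IsNoiseFamily P ζ)
    {ε : ℝ} (hε : ε ∈ Ioo (0 : ℝ) 1) (b : ℕ × ℕ) :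
    ∃ B : ℝ, 0 ≤ B ∧ ∀ v w, |blockKernel P (rescaledNoise ε (ζ ε)) K b v w| ≤ B := by
  obtain ⟨C, hC0, hC⟩ := exists_abs_blockCumulant_le hζ b
  set S := C * (ε ^ (-(5 / 2) : ℝ)) ^ (b.1 + b.2)
  have hS : 0 ≤ S := by
    have : 0 ≤ ε ^ (-(5 / 2) : ℝ) := Real.rpow_nonneg hε.1.le _
    positivity
  have hKi := integrable_of_isTruncatedHeatKernel hK
  refine ⟨(∫ z, |K z|) ^ b.1 * (∫ z, |K z|) ^ b.2 * S, by positivity, fun v w => ?_⟩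
  have hint : ∫ q : (Fin b.1 → SpaceTime) × (Fin b.2 → SpaceTime),
      (∏ i, |K (w - q.1 i)|) * (∏ j, |K (v - q.2 j)|) * S =
      (∫ z, |K z|) ^ b.1 * (∫ z, |K z|) ^ b.2 * S := by
    rw [integral_mul_const, Measure.volume_eq_prod]
    rw [integral_prod_mul (fun x : Fin b.1 → SpaceTime => ∏ i, |K (w - x i)|)
      (fun x : Fin b.2 → SpaceTime => ∏ i, |K (v - x i)|),
      integral_fintype_prod_volume_eq_pow (fun x => |K (w - x)|),
      integral_fintype_prod_volume_eq_pow (fun x => |K (v - x)|),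
      integral_sub_left_eq_self (fun x => |K x|) volume w,
      integral_sub_left_eq_self (fun x => |K x|) volume v]
    simp
  rw [← hint, ← Real.norm_eq_abs]
  refine norm_integral_le_of_norm_le ?_ (Eventually.of_forall fun q => ?_)
  · exact (integrable_kernel_prod hKi.abs b v w).mul_const S
  · rw [blockIntegrand_eq, Real.norm_eq_abs, abs_mul, abs_mul, Finset.abs_prod, Finset.abs_prod]
    exact mul_le_mul_of_nonneg_left (hC ε hε q) (by positivity)

theorem measurable_blockKernel [IsProbabilityMeasure P]
    (hK : IsTruncatedHeatKernel K) (hζ : IsNoiseFamily P ζ) {ε : ℝ}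
    (hε : ε ∈ Ioo (0 : ℝ) 1) (b : ℕ × ℕ) :
    Measurable fun u : SpaceTime × SpaceTime =>
      blockKernel P (rescaledNoise ε (ζ ε)) K b u.1 u.2 := by
  have hKm := measurable_of_isTruncatedHeatKernel hK
  have h : Measurable fun p : (SpaceTime × SpaceTime) ×
      ((Fin b.1 → SpaceTime) × (Fin b.2 → SpaceTime)) =>
      blockIntegrand P (rescaledNoise ε (ζ ε)) K b p.1.1 p.1.2 p.2 := by
    refine (Measurable.mul ?_ ?_).mul
      ((measurable_blockCumulant (hζ.isNoise ε hε) b).comp measurable_snd)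
    · exact Finset.measurable_prod _ fun i _ => hKm.comp (by fun_prop)
    · exact Finset.measurable_prod _ fun i _ => hKm.comp (by fun_prop)
  exact h.stronglyMeasurable.integral_prod_right'.measurable

theorem blockKernel_sub (hζ : IsNoiseFamily P ζ) {ε : ℝ}
    (hε : ε ∈ Ioo (0 : ℝ) 1) (b : ℕ × ℕ) (v w : SpaceTime) :
    blockKernel P (rescaledNoise ε (ζ ε)) K b (v - w) 0 =
      blockKernel P (rescaledNoise ε (ζ ε)) K b v w := by
  unfold blockKernel
  rw [← integral_add_right_eq_self (μ := volume)
    (fun q => blockIntegrand P (rescaledNoise ε (ζ ε)) K b v w q)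
    ((fun _ => w, fun _ => w) : (Fin b.1 → SpaceTime) × (Fin b.2 → SpaceTime))]
  refine integral_congr_ae (Eventually.of_forall fun q => ?_)
  simp only [blockIntegrand_eq]
  rw [← blockCumulant_add (hζ.isNoise ε hε) b q w]
  congr 2
  · refine Finset.prod_congr rfl fun i _ => ?_
    congr 1
    simp only [Prod.fst_add, Pi.add_apply]
    abel
  · refine Finset.prod_congr rfl fun i _ => ?_
    congr 1
    simp only [Prod.snd_add, Pi.add_apply]
    abel

theorem cloudKernel_sub (hζ : IsNoiseFamily P ζ) {ε : ℝ} (hε : ε ∈ Ioo (0 : ℝ) 1)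
    (π : Multiset (ℕ × ℕ)) (v w : SpaceTime) :
    cloudKernel P (rescaledNoise ε (ζ ε)) K π (v - w) 0 =
      cloudKernel P (rescaledNoise ε (ζ ε)) K π v w := by
  unfold cloudKernel
  congr 1
  exact Multiset.map_congr rfl fun b _ => blockKernel_sub hζ hε b v w

theorem exists_abs_cloudKernel_le_const [IsProbabilityMeasure P]
    (hK : IsTruncatedHeatKernel K) (hζ : IsNoiseFamily P ζ)
    {ε : ℝ} (hε : ε ∈ Ioo (0 : ℝ) 1) (π : Multiset (ℕ × ℕ)) :
    ∃ B : ℝ, 0 ≤ B ∧ ∀ v w, |cloudKernel P (rescaledNoise ε (ζ ε)) K π v w| ≤ B := by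
  unfold cloudKernel
  induction π using Multiset.induction_on with
  | empty => exact ⟨1, zero_le_one, by simp⟩
  | cons b π ih =>
    obtain ⟨B, hB, h⟩ := ih
    obtain ⟨B', hB', h'⟩ := exists_abs_blockKernel_le_const hK hζ hε b
    refine ⟨B' * B, by positivity, fun v w => ?_⟩
    rw [Multiset.map_cons, Multiset.prod_cons, abs_mul]
    exact mul_le_mul (h' v w) (h v w) (abs_nonneg _) hB'

theorem measurable_cloudKernel [IsProbabilityMeasure P]
    (hK : IsTruncatedHeatKernel K) (hζ : IsNoiseFamily P ζ) {ε : ℝ}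
    (hε : ε ∈ Ioo (0 : ℝ) 1) (π : Multiset (ℕ × ℕ)) :
    Measurable fun u : SpaceTime × SpaceTime =>
      cloudKernel P (rescaledNoise ε (ζ ε)) K π u.1 u.2 := by
  unfold cloudKernel
  induction π using Multiset.induction_on with
  | empty => simp
  | cons b π ih =>
    simp only [Multiset.map_cons, Multiset.prod_cons]
    exact (measurable_blockKernel hK hζ hε b).mul ih

theorem integrable_massIntegrand [IsProbabilityMeasure P]
    (hK : IsTruncatedHeatKernel K) (hζ : IsNoiseFamily P ζ) {ε : ℝ}
    (hε : ε ∈ Ioo (0 : ℝ) 1) (π : Multiset (ℕ × ℕ)) :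
    Integrable (massIntegrand P (rescaledNoise ε (ζ ε)) K π) := by
  obtain ⟨B, -, hB⟩ := exists_abs_cloudKernel_le_const hK hζ hε π
  refine (integrable_of_isTruncatedHeatKernel hK).comp_neg.mul_bdd ?_
    (Eventually.of_forall fun v => hB v 0)
  exact ((measurable_cloudKernel hK hζ hε π).comp
    (by fun_prop : Measurable fun v : SpaceTime => (v, (0 : SpaceTime)))).aestronglyMeasurable

theorem integrable_rootedIntegrand [IsProbabilityMeasure P]
    (hK : IsTruncatedHeatKernel K) (hζ : IsNoiseFamily P ζ) {ε : ℝ}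
    (hε : ε ∈ Ioo (0 : ℝ) 1) (π : Multiset (ℕ × ℕ)) {ψ : SpaceTime → ℝ} (hψ : Integrable ψ) :
    Integrable (rootedIntegrand P (rescaledNoise ε (ζ ε)) K π ψ) := by
  obtain ⟨B, -, hB⟩ := exists_abs_cloudKernel_le_const hK hζ hε π
  refine Integrable.mul_bdd ?_ (measurable_cloudKernel hK hζ hε π).aestronglyMeasurable
    (Eventually.of_forall fun u => hB u.1 u.2)
  have := (integrable_of_isTruncatedHeatKernel hK).comp_neg.mul_prod hψ
  simp only [mul_comm (K (-_))] at this
  exact this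

/-- The graph with a plain arrow from `v` to `w` factorises, by stationarity, into the mass and the
integral of the test function. -/
theorem integrable_and_integral_arrow [IsProbabilityMeasure P]
    (hK : IsTruncatedHeatKernel K) (hζ : IsNoiseFamily P ζ)
    {ε : ℝ} (hε : ε ∈ Ioo (0 : ℝ) 1) (π : Multiset (ℕ × ℕ)) {ψ : SpaceTime → ℝ}
    (hψ : Integrable ψ) :
    (Integrable fun u : SpaceTime × SpaceTime =>
      ψ u.2 * K (u.2 - u.1) * cloudKernel P (rescaledNoise ε (ζ ε)) K π u.1 u.2) ∧
    ∫ u : SpaceTime × SpaceTime,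
      ψ u.2 * K (u.2 - u.1) * cloudKernel P (rescaledNoise ε (ζ ε)) K π u.1 u.2 =
      (∫ v, massIntegrand P (rescaledNoise ε (ζ ε)) K π v) * ∫ w, ψ w := by
  have hprod : Integrable (fun u : SpaceTime × SpaceTime =>
      massIntegrand P (rescaledNoise ε (ζ ε)) K π u.1 * ψ u.2) :=
    (integrable_massIntegrand hK hζ hε π).mul_prod hψ
  have hΦ : MeasurePreserving (fun z : SpaceTime × SpaceTime => (z.1 - z.2, z.2)) volume volume :=
    measurePreserving_sub_prod volume volume
  have heq : (fun u : SpaceTime × SpaceTime =>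
      ψ u.2 * K (u.2 - u.1) * cloudKernel P (rescaledNoise ε (ζ ε)) K π u.1 u.2) =
      (fun u : SpaceTime × SpaceTime =>
        massIntegrand P (rescaledNoise ε (ζ ε)) K π u.1 * ψ u.2) ∘
        fun z : SpaceTime × SpaceTime => (z.1 - z.2, z.2) := by
    funext u
    simp only [Function.comp_apply, massIntegrand, cloudKernel_sub hζ hε, neg_sub]
    ring
  rw [heq]
  refine ⟨(hΦ.integrable_comp hprod.aestronglyMeasurable).2 hprod, ?_⟩
  have h1 := integral_map (μ := (volume : Measure (SpaceTime × SpaceTime)))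
    hΦ.measurable.aemeasurable (f := fun u : SpaceTime × SpaceTime =>
        massIntegrand P (rescaledNoise ε (ζ ε)) K π u.1 * ψ u.2)
    (by rw [hΦ.map_eq]; exact hprod.aestronglyMeasurable)
  rw [hΦ.map_eq] at h1
  refine h1.symm.trans ?_
  exact integral_prod_mul (massIntegrand P (rescaledNoise ε (ζ ε)) K π) ψ

theorem barredIntegrand_eq (η : SpaceTime → Ω → ℝ) (π : Multiset (ℕ × ℕ)) (ψ : SpaceTime → ℝ) :
    barredIntegrand P η K π ψ = fun u =>
      ψ u.2 * K (u.2 - u.1) * cloudKernel P η K π u.1 u.2 - rootedIntegrand P η K π ψ u := by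
  funext u
  simp only [barredIntegrand, rootedIntegrand]
  ring

theorem graphsConverge [IsProbabilityMeasure P]
    (hK : IsTruncatedHeatKernel K) (hζ : IsNoiseFamily P ζ) {ε : ℝ}
    (hε : ε ∈ Ioo (0 : ℝ) 1) (π : Multiset (ℕ × ℕ)) {ψ : SpaceTime → ℝ} (hψ : Integrable ψ) :
    GraphsConverge P (rescaledNoise ε (ζ ε)) K π ψ where
  block b _ v w := integrable_blockIntegrand hK hζ hε b v w
  barred := by
    rw [barredIntegrand_eq]
    exact (integrable_and_integral_arrow hK hζ hε π hψ).1.sub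
      (integrable_rootedIntegrand hK hζ hε π hψ)
  rooted := integrable_rootedIntegrand hK hζ hε π hψ
  mass := integrable_massIntegrand hK hζ hε π

theorem renormalisedZerothChaos_eq [IsProbabilityMeasure P]
    (hK : IsTruncatedHeatKernel K) (hζ : IsNoiseFamily P ζ) {ε : ℝ}
    (hε : ε ∈ Ioo (0 : ℝ) 1) (k l : ℕ) (π : Multiset (ℕ × ℕ)) {ψ : SpaceTime → ℝ}
    (hψ : Integrable ψ) :
    renormalisedZerothChaos P (rescaledNoise ε (ζ ε)) K ε k l π ψ =
      -rootedGraph P (rescaledNoise ε (ζ ε)) K ε k l π ψ := by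
  unfold renormalisedZerothChaos zerothChaos massConstant rootedGraph
  obtain ⟨h1, h2⟩ := integrable_and_integral_arrow hK hζ hε π hψ
  rw [barredIntegrand_eq, integral_sub h1 (integrable_rootedIntegrand hK hζ hε π hψ), h2]
  ring

/-! ### Power counting -/

/-- The bounds on the blocks multiply; the order of the cloud can be lowered by a factor `t`. -/
theorem exists_abs_cloudKernel_le [IsProbabilityMeasure P]
    (hK : IsTruncatedHeatKernel K) (hζ : IsNoiseFamily P ζ)
    (π : Multiset (ℕ × ℕ)) (hπ : ∀ b ∈ π, 1 ≤ b.1 ∧ 1 ≤ b.2) {t : ℝ} (ht0 : 0 < t) (ht1 : t ≤ 1) :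
    ∃ C : ℝ, 0 ≤ C ∧ ∀ ε ∈ Ioo (0 : ℝ) 1, ∀ v w : SpaceTime, 0 < torusSize (v - w) →
      |cloudKernel P (rescaledNoise ε (ζ ε)) K π v w| ≤
        C * (ε ^ (-(((π.map Prod.fst).sum + (π.map Prod.snd).sum : ℕ) : ℝ) / 2 +
            t * (π.map blockOrder).sum) *
          torusSize (v - w) ^ (-(t * (π.map blockOrder).sum))) := by
  unfold cloudKernel
  induction π using Multiset.induction_on with
  | empty => exact ⟨1, zero_le_one, by simp⟩
  | cons b π ih =>
    obtain ⟨C, hC, h⟩ := ih fun b hb => hπ b (Multiset.mem_cons_of_mem hb)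
    have hb := hπ b (Multiset.mem_cons_self b π)
    have hcap : 0 < blockOrder b := by
      unfold blockOrder
      split_ifs <;> norm_num
    obtain ⟨C', hC', h'⟩ := exists_abs_blockKernel_le hK hζ hb.1 hb.2 (a := t * blockOrder b)
      (by positivity) (mul_le_of_le_one_left hcap.le ht1)
    refine ⟨C' * C, by positivity, fun ε hε v w hvw => ?_⟩
    have hε0 : 0 < ε := hε.1
    simp only [Multiset.map_cons, Multiset.prod_cons, Multiset.sum_cons, abs_mul]
    refine (mul_le_mul (h' ε hε v w hvw) (h ε hε v w hvw) (abs_nonneg _) (by positivity)).trans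
      (le_of_eq ?_)
    set S := (π.map blockOrder).sum
    set a := (π.map Prod.fst).sum
    set c := (π.map Prod.snd).sum
    rw [show -((b.1 + a + (b.2 + c) : ℕ) : ℝ) / 2 + t * (blockOrder b + S) =
      (-((b.1 + b.2 : ℕ) : ℝ) / 2 + t * blockOrder b) + (-((a + c : ℕ) : ℝ) / 2 + t * S) by
        push_cast; ring,
      Real.rpow_add hε0 (-((b.1 + b.2 : ℕ) : ℝ) / 2 + t * blockOrder b),
      show -(t * (blockOrder b + S)) = -(t * blockOrder b) + -(t * S) by ring,
      Real.rpow_add hvw]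
    ring

end Noise

theorem sum_blockOrder_nonneg (π : Multiset (ℕ × ℕ)) : 0 ≤ (π.map blockOrder).sum := by
  refine Multiset.sum_nonneg fun x hx => ?_
  obtain ⟨b, -, rfl⟩ := Multiset.mem_map.1 hx
  unfold blockOrder
  split_ifs <;> norm_num

theorem sum_blockOrder_pair : (({(1, 1), (1, 1)} : Multiset (ℕ × ℕ)).map blockOrder).sum = 2 := by
  simp only [Multiset.insert_eq_cons, Multiset.map_cons, Multiset.map_singleton,
    Multiset.sum_cons, Multiset.sum_singleton, blockOrder]
  norm_num

/-- Every pairing except for the pairwise contraction of `(2, 2)` has total order more than `2`. -/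
theorem le_sum_blockOrder {k l : ℕ} (hl : 2 ≤ l) {π : Multiset (ℕ × ℕ)} (hπ : IsPairing k l π)
    (hne : ¬ (k = 2 ∧ l = 2 ∧ π = {(1, 1), (1, 1)})) : 5 / 2 ≤ (π.map blockOrder).sum := by
  by_cases h : ∃ b ∈ π, b ≠ (1, 1)
  · obtain ⟨b, hb, hb1⟩ := h
    obtain ⟨π', rfl⟩ := Multiset.exists_cons_of_mem hb
    have := sum_blockOrder_nonneg π'
    rw [Multiset.map_cons, Multiset.sum_cons]
    simp only [blockOrder, hb1, if_false] at this ⊢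
    linarith
  · push Not at h
    obtain ⟨n, rfl⟩ : ∃ n, π = Multiset.replicate n (1, 1) :=
      ⟨_, Multiset.eq_replicate_card.2 h⟩
    have h1 := hπ.sum_fst
    have h2 := hπ.sum_snd
    simp only [Multiset.map_replicate, Multiset.sum_replicate, smul_eq_mul, mul_one] at h1 h2
    subst h1 h2
    have h3 : 3 ≤ n := by
      by_contra h3
      have : n = 2 := by omega
      subst this
      exact hne ⟨rfl, rfl, rfl⟩
    have h4 : (3 : ℝ) ≤ n := by exact_mod_cast h3
    simp only [Multiset.map_replicate, Multiset.sum_replicate, blockOrder, if_true, nsmul_eq_mul,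
      mul_one]
    linarith

/-! ### Scaling of test functions and the bound on the rooted graph -/

theorem parabolicNorm_dilate {r : ℝ} (hr : 0 < r) (z : SpaceTime) :
    parabolicNorm (dilate r z) = parabolicNorm z / r := by
  unfold parabolicNorm dilate
  rw [add_div, Finset.sum_div]
  congr 1
  · simp only
    rw [abs_div, abs_of_pos (by positivity : 0 < r ^ 2), Real.sqrt_div (abs_nonneg _),
      Real.sqrt_sq hr.le]
  · refine Finset.sum_congr rfl fun i _ => ?_
    simp only
    rw [abs_div, abs_of_pos hr]

theorem norm_le_one_of_parabolicNorm_le_one {z : SpaceTime} (hz : parabolicNorm z ≤ 1) :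
    ‖z‖ ≤ 1 := by
  unfold parabolicNorm at hz
  have h0 := Real.sqrt_nonneg |z.1|
  have h1 : ∀ i, |z.2 i| ≤ ∑ i, |z.2 i| := fun i =>
    Finset.single_le_sum (f := fun i => |z.2 i|) (fun _ _ => abs_nonneg _) (Finset.mem_univ i)
  refine max_le ?_ ((pi_norm_le_iff_of_nonneg zero_le_one).2 fun i => ?_)
  · have h2 := (abs_nonneg _).trans (h1 0)
    have h3 : Real.sqrt |z.1| ≤ 1 := by linarith
    rwa [Real.sqrt_le_left zero_le_one, one_pow] at h3
  · have := h1 i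
    rw [Real.norm_eq_abs]
    linarith

theorem IsTestFunction.abs_le_one {φ : SpaceTime → ℝ} (hφ : IsTestFunction φ) (z : SpaceTime) :
    |φ z| ≤ 1 := by
  simpa using hφ.norm_le 0 (by norm_num) z

theorem IsTestFunction.parabolicNorm_le {φ : SpaceTime → ℝ} (hφ : IsTestFunction φ)
    {z : SpaceTime} (hz : φ z ≠ 0) : parabolicNorm z ≤ 1 :=
  hφ.support (subset_tsupport φ hz)

theorem rescaledTest_eq (r : ℝ) (φ : SpaceTime → ℝ) (z : SpaceTime) :
    rescaledTest r φ z = r ^ (-5 : ℝ) * φ (dilate r z) := rfl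

theorem abs_rescaledTest_le {φ : SpaceTime → ℝ} (hφ : IsTestFunction φ) {r : ℝ} (hr : 0 < r)
    (z : SpaceTime) : |rescaledTest r φ z| ≤ r ^ (-5 : ℝ) := by
  have : 0 < r ^ (-5 : ℝ) := by positivity
  rw [rescaledTest_eq, abs_mul, abs_of_pos this]
  exact mul_le_of_le_one_right this.le (hφ.abs_le_one _)

theorem parabolicNorm_le_of_rescaledTest_ne_zero {φ : SpaceTime → ℝ} (hφ : IsTestFunction φ)
    {r : ℝ} (hr : 0 < r) {z : SpaceTime} (hz : rescaledTest r φ z ≠ 0) : parabolicNorm z ≤ r := by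
  rw [rescaledTest_eq] at hz
  have := hφ.parabolicNorm_le (right_ne_zero_of_mul hz)
  rwa [parabolicNorm_dilate hr, div_le_one hr] at this

theorem continuous_rescaledTest {φ : SpaceTime → ℝ} (hφ : IsTestFunction φ) (r : ℝ) :
    Continuous (rescaledTest r φ) :=
  (hφ.contDiff.continuous.comp (continuous_dilate r)).const_mul _

theorem integrable_rescaledTest {φ : SpaceTime → ℝ} (hφ : IsTestFunction φ) {r : ℝ}
    (hr : r ∈ Ioc (0 : ℝ) 1) : Integrable (rescaledTest r φ) := by
  refine (continuous_rescaledTest hφ r).integrable_of_hasCompactSupport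
    (HasCompactSupport.intro (isCompact_closedBall (0 : SpaceTime) 1) fun z hz => ?_)
  by_contra h
  refine hz (mem_closedBall_zero_iff.2 (norm_le_one_of_parabolicNorm_le_one ?_))
  exact (parabolicNorm_le_of_rescaledTest_ne_zero hφ hr.1 h).trans hr.2

section Noise

variable {K : SpaceTime → ℝ} {Ω : Type*} [MeasurableSpace Ω] {P : Measure Ω}
  [IsProbabilityMeasure P] {ζ : ℝ → SpaceTime → Ω → ℝ}

/-- If the cloud is of order `ε^{e-N/2}` times the distance to the power `-(2 + κ)`, then the graph
rooted at the origin is of order `ε^e` at all scales, up to a loss of `r^{-κ}`. -/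
theorem exists_lintegral_rootedIntegrand_le (hK : IsTruncatedHeatKernel K)
    (hζ : IsNoiseFamily P ζ) (π : Multiset (ℕ × ℕ)) {κ C e A : ℝ} (hκ : 0 < κ) (hκ1 : κ < 1)
    (hC : 0 ≤ C) (hA : A ≤ 2 + κ)
    (hcloud : ∀ ε ∈ Ioo (0 : ℝ) 1, ∀ v w : SpaceTime, 0 < torusSize (v - w) →
      |cloudKernel P (rescaledNoise ε (ζ ε)) K π v w| ≤ C * (ε ^ e * torusSize (v - w) ^ (-A))) :
    ∃ C' : ℝ, 0 ≤ C' ∧ ∀ ε ∈ Ioo (0 : ℝ) 1, ∀ r ∈ Ioc (0 : ℝ) 1, ∀ φ : SpaceTime → ℝ,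
      IsTestFunction φ →
      |∫ u, rootedIntegrand P (rescaledNoise ε (ζ ε)) K π (rescaledTest r φ) u| ≤
        C' * ε ^ e * r ^ (-κ) := by
  obtain ⟨CK, M, hCK, hM, hM0, hCK0⟩ := exists_kernel_bound hK
  obtain ⟨A₁, hA₁, hconv⟩ := exists_lintegral_torusSize_rpow_mul_rpow_le M hM.le
    (p := 3) (q := 2 + κ) (by norm_num) (by norm_num) (by linarith) (by linarith) (by linarith)
  obtain ⟨A₂, hA₂, hloc⟩ := exists_lintegral_torusSize_rpow_le 1 zero_le_one (p := κ) hκ.le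
    (by linarith)
  set T : ℝ := (M + 1 + 3) ^ (2 + κ - A) with hT
  have hT0 : 0 < T := by positivity
  refine ⟨CK * C * T * A₁ * A₂, by positivity, fun ε hε r hr φ hφ => ?_⟩
  have hε0 : 0 < ε := hε.1
  have hr0 : 0 < r := hr.1
  have hKm := measurable_of_isTruncatedHeatKernel hK
  set η := rescaledNoise ε (ζ ε)
  set ψ := rescaledTest r φ with hψdef
  have hψm : Measurable ψ := (continuous_rescaledTest hφ r).measurable
  have hcm := measurable_cloudKernel hK hζ hε π
  have hball : MeasurableSet (Metric.closedBall (0 : SpaceTime) M) :=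
    Metric.isClosed_closedBall.measurableSet
  -- The integral over the vertex `v`.
  have hinner : ∀ w : SpaceTime, 0 < torusSize w → ‖w‖ ≤ 1 →
      ∫⁻ v, ENNReal.ofReal |K (-v)| * ENNReal.ofReal |cloudKernel P η K π v w| ≤
        ENNReal.ofReal (CK * C * T * ε ^ e) * ENNReal.ofReal (A₁ * torusSize w ^ (-κ)) := by
    intro w hw0 hw1
    calc _ ≤ ∫⁻ v, (Metric.closedBall 0 M).indicator (fun v => ENNReal.ofReal (CK * C * T * ε ^ e) *
            ENNReal.ofReal (torusSize (v - 0) ^ (-3 : ℝ) * torusSize (v - w) ^ (-(2 + κ)))) v := by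
          refine lintegral_mono_ae ?_
          filter_upwards [kernel_abs_ae_le hM0 hCK0 0, ae_torusSize_sub_pos w,
            ae_torusSize_sub_pos 0] with v h1 h2 h3
          rw [zero_sub] at h1
          refine (mul_le_mul_left h1 _).trans ?_
          by_cases hv : v ∈ Metric.closedBall 0 M
          · rw [indicator_of_mem hv, indicator_of_mem hv,
              ← ENNReal.ofReal_mul (by positivity), ← ENNReal.ofReal_mul (by positivity)]
            refine ENNReal.ofReal_le_ofReal ?_
            have h4 : torusSize (v - w) ^ (-A) ≤ T * torusSize (v - w) ^ (-(2 + κ)) := by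
              rw [show -A = (2 + κ - A) + -(2 + κ) by ring, Real.rpow_add h2]
              refine mul_le_mul_of_nonneg_right ?_ (by positivity)
              refine Real.rpow_le_rpow h2.le ?_ (by linarith)
              refine torusSize_le_of_norm_le ((norm_sub_le _ _).trans (add_le_add ?_ hw1))
              exact mem_closedBall_zero_iff.1 hv
            calc _ ≤ CK * torusSize (v - 0) ^ (-3 : ℝ) *
                  (C * (ε ^ e * (T * torusSize (v - w) ^ (-(2 + κ))))) := by
                  refine mul_le_mul_of_nonneg_left ?_ (by positivity)
                  exact (hcloud ε hε v w h2).trans (by gcongr)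
              _ = _ := by ring
          · rw [indicator_of_notMem hv, indicator_of_notMem hv, zero_mul]
      _ = ENNReal.ofReal (CK * C * T * ε ^ e) * ∫⁻ v in Metric.closedBall 0 M,
            ENNReal.ofReal (torusSize (v - 0) ^ (-3 : ℝ) * torusSize (v - w) ^ (-(2 + κ))) := by
          rw [lintegral_indicator hball, lintegral_const_mul _ (by fun_prop)]
      _ ≤ _ := by
          have h5 : torusSize (0 - w) = torusSize w := by rw [zero_sub, torusSize_neg]
          have := hconv 0 0 w (by rwa [h5])
          rw [h5, show (5 : ℝ) - 3 - (2 + κ) = -κ by ring] at this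
          gcongr
  have hψle : ∀ w, ENNReal.ofReal |ψ w| ≤
      ({x | torusSize (x - 0) ≤ r} ∩ Metric.closedBall (0 : SpaceTime) 1).indicator
        (fun _ => ENNReal.ofReal (r ^ (-5 : ℝ))) w := by
    intro w
    by_cases h : ψ w = 0
    · rw [h]
      simp
    · have h1 := parabolicNorm_le_of_rescaledTest_ne_zero hφ hr0 h
      rw [indicator_of_mem]
      · exact ENNReal.ofReal_le_ofReal (abs_rescaledTest_le hφ hr0 w)
      · refine ⟨?_, mem_closedBall_zero_iff.2
          (norm_le_one_of_parabolicNorm_le_one (h1.trans hr.2))⟩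
        rw [mem_ofPred_eq, sub_zero]
        exact (torusSize_le_parabolicNorm w).trans h1
  have hS : MeasurableSet
      ({x : SpaceTime | torusSize (x - 0) ≤ r} ∩ Metric.closedBall (0 : SpaceTime) 1) :=
    (measurableSet_le (by fun_prop) measurable_const).inter
      Metric.isClosed_closedBall.measurableSet
  have hmeas : Measurable fun u : SpaceTime × SpaceTime =>
      ENNReal.ofReal |ψ u.2| *
        (ENNReal.ofReal |K (-u.1)| * ENNReal.ofReal |cloudKernel P η K π u.1 u.2|) := by
    refine (Measurable.mul (f := fun u : SpaceTime × SpaceTime => ENNReal.ofReal |ψ u.2|)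
      ?_ (Measurable.mul (f := fun u : SpaceTime × SpaceTime => ENNReal.ofReal |K (-u.1)|) ?_ ?_))
    · exact (hψm.comp measurable_snd).abs.ennreal_ofReal
    · exact ((hKm.comp (by fun_prop)).abs).ennreal_ofReal
    · exact hcm.abs.ennreal_ofReal
  have hfin : ENNReal.ofReal |∫ u, rootedIntegrand P η K π ψ u| ≤
      ENNReal.ofReal (CK * C * T * ε ^ e * A₁ * (r ^ (-5 : ℝ) * (A₂ * r ^ (5 - κ)))) := by
    have h0 := enorm_integral_le_lintegral_enorm (μ := (volume : Measure (SpaceTime × SpaceTime)))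
      (rootedIntegrand P η K π ψ)
    simp only [Real.enorm_eq_ofReal_abs] at h0
    refine h0.trans ?_
    calc _ = ∫⁻ u : SpaceTime × SpaceTime, ENNReal.ofReal |ψ u.2| *
            (ENNReal.ofReal |K (-u.1)| * ENNReal.ofReal |cloudKernel P η K π u.1 u.2|) := by
          refine lintegral_congr fun u => ?_
          rw [rootedIntegrand, abs_mul, abs_mul, ENNReal.ofReal_mul (by positivity),
            ENNReal.ofReal_mul (by positivity), mul_assoc]
      _ = ∫⁻ w, ∫⁻ v, ENNReal.ofReal |ψ w| *
            (ENNReal.ofReal |K (-v)| * ENNReal.ofReal |cloudKernel P η K π v w|) := by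
          rw [Measure.volume_eq_prod]
          exact lintegral_prod_symm' _ hmeas
      _ ≤ ∫⁻ w, ({x | torusSize (x - 0) ≤ r} ∩ Metric.closedBall (0 : SpaceTime) 1).indicator
            (fun w => ENNReal.ofReal (CK * C * T * ε ^ e * A₁ * r ^ (-5 : ℝ)) *
              ENNReal.ofReal (torusSize (w - 0) ^ (-κ))) w := by
          refine lintegral_mono_ae ?_
          filter_upwards [ae_torusSize_sub_pos 0] with w hw
          rw [lintegral_const_mul' _ _ ENNReal.ofReal_ne_top]
          refine (mul_le_mul_left (hψle w) _).trans ?_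
          by_cases hwS : w ∈ {x | torusSize (x - 0) ≤ r} ∩ Metric.closedBall (0 : SpaceTime) 1
          · rw [indicator_of_mem hwS, indicator_of_mem hwS]
            rw [sub_zero] at hw ⊢
            refine (mul_le_mul_right (hinner w hw (mem_closedBall_zero_iff.1 hwS.2)) _).trans ?_
            rw [← ENNReal.ofReal_mul (by positivity), ← ENNReal.ofReal_mul (by positivity),
              ← ENNReal.ofReal_mul (by positivity)]
            refine ENNReal.ofReal_le_ofReal (le_of_eq ?_)
            ring
          · rw [indicator_of_notMem hwS, indicator_of_notMem hwS, zero_mul]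
      _ = ENNReal.ofReal (CK * C * T * ε ^ e * A₁ * r ^ (-5 : ℝ)) *
            ∫⁻ w in {x | torusSize (x - 0) ≤ r} ∩ Metric.closedBall (0 : SpaceTime) 1,
              ENNReal.ofReal (torusSize (w - 0) ^ (-κ)) := by
          rw [lintegral_indicator hS, lintegral_const_mul _ (by fun_prop)]
      _ ≤ ENNReal.ofReal (CK * C * T * ε ^ e * A₁ * r ^ (-5 : ℝ)) *
            ENNReal.ofReal (A₂ * r ^ (5 - κ)) := by
          gcongr
          exact hloc 0 0 r hr0
      _ = _ := by
          rw [← ENNReal.ofReal_mul (by positivity)]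
          congr 1
          ring
  rw [ENNReal.ofReal_le_ofReal_iff (by positivity)] at hfin
  refine hfin.trans (le_of_eq ?_)
  rw [show -κ = -5 + (5 - κ) by ring, Real.rpow_add hr0]
  ring

/-- The cloud is used with order `A`, which may be less than the sum of the orders of its blocks. -/
theorem exists_abs_rootedGraph_le (hK : IsTruncatedHeatKernel K) (hζ : IsNoiseFamily P ζ)
    {k l : ℕ} {π : Multiset (ℕ × ℕ)} (hπ : IsPairing k l π) {κ A : ℝ} (hκ : 0 < κ) (hκ1 : κ < 1)
    (hA0 : 0 < A) (hA : A ≤ 2 + κ) (hAπ : A ≤ (π.map blockOrder).sum) :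
    ∃ C : ℝ, 0 ≤ C ∧ ∀ ε ∈ Ioo (0 : ℝ) 1, ∀ r ∈ Ioc (0 : ℝ) 1, ∀ φ : SpaceTime → ℝ,
      IsTestFunction φ →
      |rootedGraph P (rescaledNoise ε (ζ ε)) K ε k l π (rescaledTest r φ)| ≤
        C * ε ^ (A - 2) * r ^ (-κ) := by
  set S := (π.map blockOrder).sum
  have hS : 0 < S := hA0.trans_le hAπ
  obtain ⟨C, hC, hcloud⟩ := exists_abs_cloudKernel_le hK hζ π hπ.pos (t := A / S) (by positivity)
    ((div_le_one hS).2 hAπ)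
  simp only [hπ.sum_fst, hπ.sum_snd] at hcloud
  rw [div_mul_cancel₀ A hS.ne'] at hcloud
  obtain ⟨C', hC', h⟩ := exists_lintegral_rootedIntegrand_le hK hζ π hκ hκ1 hC hA hcloud
  refine ⟨C', hC', fun ε hε r hr φ hφ => ?_⟩
  have hε0 : 0 < ε := hε.1
  have hpos : 0 < ε ^ (((k : ℝ) + l - 4) / 2) := by positivity
  rw [rootedGraph, abs_mul, abs_of_pos hpos]
  refine (mul_le_mul_of_nonneg_left (h ε hε r hr φ hφ) hpos.le).trans (le_of_eq ?_)
  rw [show A - 2 = ((k : ℝ) + l - 4) / 2 + (-((k + l : ℕ) : ℝ) / 2 + A) by push_cast; ring,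
    Real.rpow_add hε0 (((k : ℝ) + l - 4) / 2)]
  ring

end Noise

/-! ### The covariance block -/

/-- The covariance `E η(0) η(h)` of a stationary field `η`. -/
noncomputable def noiseCovariance {Ω : Type*} [MeasurableSpace Ω] (P : Measure Ω)
    (η : SpaceTime → Ω → ℝ) (h : SpaceTime) : ℝ :=
  ∫ ω, η 0 ω * η h ω ∂P

/-- The correlation of the kernel with itself. At `z = 0`, where the product is not integrable,
it has the junk value `0`. -/
noncomputable def kernelCorrelation (K : SpaceTime → ℝ) (z : SpaceTime) : ℝ :=
  ∫ x, K x * K (z + x)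

section Noise

variable {K : SpaceTime → ℝ} {Ω : Type*} [MeasurableSpace Ω] {P : Measure Ω}
  {ζ : ℝ → SpaceTime → Ω → ℝ}

theorem blockCumulant_covariance (hζ : IsNoiseFamily P ζ) {ε : ℝ} (hε : ε ∈ Ioo (0 : ℝ) 1)
    (q : (Fin 1 → SpaceTime) × (Fin 1 → SpaceTime)) :
    blockCumulant P (rescaledNoise ε (ζ ε)) (1, 1) q =
      noiseCovariance P (rescaledNoise ε (ζ ε)) (q.2 0 - q.1 0) := by
  have hn := hζ.isNoise ε hε
  have h1 := blockCumulant_add hn (1, 1) (fun _ => 0, fun _ => q.2 0 - q.1 0) (q.1 0)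
  have h2 : ((fun _ => 0 + q.1 0, fun _ => q.2 0 - q.1 0 + q.1 0) :
      (Fin 1 → SpaceTime) × (Fin 1 → SpaceTime)) = q := by
    refine Prod.ext (funext fun i => ?_) (funext fun i => ?_)
    · rw [Subsingleton.elim i 0, zero_add]
    · rw [Subsingleton.elim i 0, sub_add_cancel]
  have h3 : blockCumulant P (rescaledNoise ε (ζ ε)) (1, 1)
      ((fun _ => 0 + q.1 0, fun _ => q.2 0 - q.1 0 + q.1 0) :
      (Fin 1 → SpaceTime) × (Fin 1 → SpaceTime)) =
      blockCumulant P (rescaledNoise ε (ζ ε)) (1, 1) (fun _ => 0, fun _ => q.2 0 - q.1 0) := h1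
  rw [h2] at h3
  rw [h3, blockCumulant, jointCumulant_pair P _ (fun i => integral_rescaledNoise hn _) _ (by simp)]
  simp [Fintype.prod_sum_type, noiseCovariance]

theorem abs_noiseCovariance_le [IsProbabilityMeasure P] (hζ : IsNoiseFamily P ζ) :
    ∃ C : ℝ, 0 ≤ C ∧ ∀ ε ∈ Ioo (0 : ℝ) 1, ∀ h,
      |noiseCovariance P (rescaledNoise ε (ζ ε)) h| ≤ C * (ε ^ 5)⁻¹ := by
  obtain ⟨C, hC, hle⟩ := exists_abs_blockCumulant_le hζ (1, 1)
  refine ⟨C, hC, fun ε hε h => ?_⟩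
  have := hle ε hε (fun _ => 0, fun _ => h)
  rw [blockCumulant_covariance hζ hε] at this
  simp only [sub_zero] at this
  refine this.trans (le_of_eq ?_)
  rw [← Real.rpow_natCast, ← Real.rpow_mul hε.1.le, ← Real.rpow_natCast ε 5,
    ← Real.rpow_neg hε.1.le]
  norm_num

theorem noiseCovariance_eq_zero (hζ : IsNoiseFamily P ζ) {ε : ℝ}
    (hε : ε ∈ Ioo (0 : ℝ) 1) {h : SpaceTime} (hh : 2 * ε < torusSize h) :
    noiseCovariance P (rescaledNoise ε (ζ ε)) h = 0 := by
  by_contra hne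
  have h1 := torusSize_le_of_blockCumulant_ne_zero hε.1 (hζ.isNoise ε hε) (1, 1)
    (fun _ => 0, fun _ => h) (by rw [blockCumulant_covariance hζ hε]; simpa using hne)
    (Sum.inr 0) (Sum.inl 0)
  simp only [Sum.elim_inr, Sum.elim_inl, sub_zero] at h1
  norm_num at h1
  linarith

theorem noiseCovariance_periodic (hζ : IsNoiseFamily P ζ) {ε : ℝ}
    (hε : ε ∈ Ioo (0 : ℝ) 1) (h : SpaceTime) (n : Fin 3 → ℤ) :
    noiseCovariance P (rescaledNoise ε (ζ ε)) (h.1, fun i => h.2 i + n i) =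
      noiseCovariance P (rescaledNoise ε (ζ ε)) h := by
  unfold noiseCovariance
  rw [rescaledNoise_periodic (hζ.isNoise ε hε)]

/-- The covariance block is the convolution of the covariance of the noise with the correlation of
the kernel with itself. -/
theorem blockKernel_covariance [IsProbabilityMeasure P] (hK : IsTruncatedHeatKernel K)
    (hζ : IsNoiseFamily P ζ) {ε : ℝ} (hε : ε ∈ Ioo (0 : ℝ) 1) (z : SpaceTime) :
    (Integrable fun h =>
      noiseCovariance P (rescaledNoise ε (ζ ε)) h * kernelCorrelation K (z - h)) ∧
    blockKernel P (rescaledNoise ε (ζ ε)) K (1, 1) z 0 =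
      ∫ h, noiseCovariance P (rescaledNoise ε (ζ ε)) h * kernelCorrelation K (z - h) := by
  set c := noiseCovariance P (rescaledNoise ε (ζ ε))
  set F : SpaceTime × SpaceTime → ℝ := fun p => K (-p.1) * K (z - p.2) * c (p.2 - p.1) with hF
  have e := (volume_preserving_funUnique (Fin 1) SpaceTime).prod
    (volume_preserving_funUnique (Fin 1) SpaceTime)
  set E := (MeasurableEquiv.funUnique (Fin 1) SpaceTime).prodCongr
    (MeasurableEquiv.funUnique (Fin 1) SpaceTime)
  have e' : MeasurePreserving E (volume : Measure ((Fin 1 → SpaceTime) × (Fin 1 → SpaceTime)))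
    (volume : Measure (SpaceTime × SpaceTime)) := e
  have hcomp : ∀ q : (Fin 1 → SpaceTime) × (Fin 1 → SpaceTime),
      blockIntegrand P (rescaledNoise ε (ζ ε)) K (1, 1) z 0 q = F (E q) := by
    intro q
    rw [blockIntegrand_eq, blockCumulant_covariance hζ hε]
    simp only [Finset.univ_unique, Finset.prod_singleton, zero_sub]
    rfl
  have hFint : Integrable F := by
    have h1 := integrable_blockIntegrand hK hζ hε (1, 1) z 0
    rw [show blockIntegrand P (rescaledNoise ε (ζ ε)) K (1, 1) z 0 = F ∘ E from funext hcomp] at h1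
    exact (e'.integrable_comp_emb E.measurableEmbedding).1 h1
  have hval : blockKernel P (rescaledNoise ε (ζ ε)) K (1, 1) z 0 = ∫ p, F p := by
    unfold blockKernel
    simp_rw [hcomp]
    exact e'.integral_comp' F
  have hs : MeasurePreserving (fun p : SpaceTime × SpaceTime => (p.1, p.1 + p.2)) volume volume :=
    measurePreserving_prod_add volume volume
  have hsm : MeasurableEmbedding (fun p : SpaceTime × SpaceTime => (p.1, p.1 + p.2)) :=
    (MeasurableEquiv.shearAddRight SpaceTime).measurableEmbedding
  set G : SpaceTime × SpaceTime → ℝ := fun p => K (-p.1) * K (z - (p.1 + p.2)) * c p.2 with hG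
  have hGF : F ∘ (fun p : SpaceTime × SpaceTime => (p.1, p.1 + p.2)) = G := by
    funext p
    simp only [hF, hG, Function.comp_apply, add_sub_cancel_left]
  have hGint : Integrable G := by
    rw [← hGF]
    exact (hs.integrable_comp_emb hsm).2 hFint
  have hGval : ∫ p, F p = ∫ p, G p := by
    rw [← hGF]
    exact (hs.integral_comp hsm F).symm
  have hinner : ∀ h, ∫ x, G (x, h) = c h * kernelCorrelation K (z - h) := by
    intro h
    simp only [hG]
    rw [integral_mul_const, mul_comm, kernelCorrelation,
      ← integral_neg_eq_self (fun x => K x * K (z - h + x))]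
    congr 1
    refine integral_congr_ae (Eventually.of_forall fun x => ?_)
    simp only
    congr 2
    abel
  have h1 := hGint.integral_prod_right
  simp only [hinner] at h1
  refine ⟨h1, ?_⟩
  rw [hval, hGval, Measure.volume_eq_prod, integral_prod_symm _ hGint]
  simp only [hinner]

end Noise

/-! ### The correlation of the kernel with itself -/

/-- A continuous cutoff, equal to `1` on the ball of radius `ρ` and to `0` outside the ball of
radius `2 ρ`. -/
noncomputable def ballCutoff (ρ : ℝ) (x : SpaceTime) : ℝ := max 0 (min 1 (2 - ‖x‖ / ρ))

/-- The part of the kernel close to its singularity. -/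
noncomputable def singularPart (K : SpaceTime → ℝ) (ρ : ℝ) (x : SpaceTime) : ℝ :=
  ballCutoff ρ x * K x

/-- The kernel with its singularity cut out. -/
noncomputable def regularPart (K : SpaceTime → ℝ) (ρ : ℝ) (x : SpaceTime) : ℝ :=
  (1 - ballCutoff ρ x) * K x

/-- The contributions to the correlation of `K` with itself in which at least one of the two kernels
is away from its singularity. -/
noncomputable def regularCorrelation (K : SpaceTime → ℝ) (ρ : ℝ) (z : SpaceTime) : ℝ :=
  (∫ x, K x * regularPart K ρ (z + x)) + ∫ x, singularPart K ρ x * regularPart K ρ (x - z)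

theorem continuous_ballCutoff (ρ : ℝ) : Continuous (ballCutoff ρ) := by
  unfold ballCutoff; fun_prop

theorem ballCutoff_nonneg (ρ : ℝ) (x : SpaceTime) : 0 ≤ ballCutoff ρ x := le_max_left _ _

theorem ballCutoff_le_one (ρ : ℝ) (x : SpaceTime) : ballCutoff ρ x ≤ 1 :=
  max_le zero_le_one (min_le_left _ _)

theorem ballCutoff_eq_one {ρ : ℝ} (hρ : 0 < ρ) {x : SpaceTime} (hx : ‖x‖ ≤ ρ) :
    ballCutoff ρ x = 1 := by
  have : ‖x‖ / ρ ≤ 1 := (div_le_one hρ).2 hx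
  rw [ballCutoff, min_eq_left (by linarith), max_eq_right zero_le_one]

theorem ballCutoff_eq_zero {ρ : ℝ} (hρ : 0 < ρ) {x : SpaceTime} (hx : 2 * ρ ≤ ‖x‖) :
    ballCutoff ρ x = 0 := by
  have : 2 ≤ ‖x‖ / ρ := (le_div_iff₀ hρ).2 hx
  rw [ballCutoff, min_eq_right (by linarith), max_eq_left (by linarith)]

theorem singularPart_add_regularPart (K : SpaceTime → ℝ) (ρ : ℝ) (x : SpaceTime) :
    singularPart K ρ x + regularPart K ρ x = K x := by
  unfold singularPart regularPart; ring

theorem continuous_integral_mul_of_bounded {f : SpaceTime → ℝ} (hf : Integrable f)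
    {g : SpaceTime → SpaceTime → ℝ} {C : ℝ} (hg : ∀ z x, |g z x| ≤ C)
    (hgz : ∀ z, Continuous (g z)) (hgx : ∀ x, Continuous fun z => g z x) :
    Continuous fun z => ∫ x, f x * g z x := by
  refine continuous_of_dominated (bound := fun x => |f x| * C)
    (fun z => hf.aestronglyMeasurable.mul (hgz z).aestronglyMeasurable)
    (fun z => Eventually.of_forall fun x => ?_) (hf.abs.mul_const C)
    (Eventually.of_forall fun x => continuous_const.mul (hgx x))
  rw [Real.norm_eq_abs, abs_mul]
  exact mul_le_mul_of_nonneg_left (hg z x) (abs_nonneg _)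

section Kernel

variable {K : SpaceTime → ℝ}

theorem continuous_regularPart (hK : IsTruncatedHeatKernel K) {ρ : ℝ} (hρ : 0 < ρ) :
    Continuous (regularPart K ρ) := by
  refine continuous_iff_continuousAt.2 fun x => ?_
  by_cases hx : x = 0
  · have : regularPart K ρ =ᶠ[nhds x] fun _ => 0 := by
      rw [hx]
      filter_upwards [Metric.closedBall_mem_nhds (0 : SpaceTime) hρ] with y hy
      rw [regularPart, ballCutoff_eq_one hρ (mem_closedBall_zero_iff.1 hy), sub_self, zero_mul]
    exact continuousAt_const.congr this.symm
  · exact (continuous_const.sub (continuous_ballCutoff ρ)).continuousAt.mul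
      (hK.smooth.continuousOn.continuousAt (isOpen_compl_singleton.mem_nhds hx))

theorem exists_abs_regularPart_le (hK : IsTruncatedHeatKernel K) {ρ : ℝ} (hρ : 0 < ρ) :
    ∃ C, ∀ x, |regularPart K ρ x| ≤ C :=
  (continuous_regularPart hK hρ).bounded_above_of_compact_support hK.compactSupport.mul_left

theorem integrable_singularPart (hK : IsTruncatedHeatKernel K) (ρ : ℝ) :
    Integrable (singularPart K ρ) :=
  (integrable_of_isTruncatedHeatKernel hK).bdd_mul (c := 1)
    (continuous_ballCutoff ρ).aestronglyMeasurable (Eventually.of_forall fun x => by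
      rw [Real.norm_eq_abs, abs_of_nonneg (ballCutoff_nonneg ρ x)]
      exact ballCutoff_le_one ρ x)

theorem continuous_regularCorrelation (hK : IsTruncatedHeatKernel K) {ρ : ℝ} (hρ : 0 < ρ) :
    Continuous (regularCorrelation K ρ) := by
  obtain ⟨C, hC⟩ := exists_abs_regularPart_le hK hρ
  have hc := continuous_regularPart hK hρ
  exact (continuous_integral_mul_of_bounded (integrable_of_isTruncatedHeatKernel hK)
    (g := fun z x => regularPart K ρ (z + x)) (fun z x => hC _)
    (fun z => by fun_prop) (fun x => by fun_prop)).add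
    (continuous_integral_mul_of_bounded (integrable_singularPart hK ρ)
    (g := fun z x => regularPart K ρ (x - z)) (fun z x => hC _)
    (fun z => by fun_prop) (fun x => by fun_prop))

theorem singularPart_mul_eq_zero (K : SpaceTime → ℝ) {ρ : ℝ} (hρ : 0 < ρ) {z : SpaceTime}
    (hz : 4 * ρ ≤ ‖z‖) (x : SpaceTime) : singularPart K ρ x * singularPart K ρ (z + x) = 0 := by
  rcases le_or_gt (2 * ρ) ‖x‖ with hx | hx
  · rw [singularPart, ballCutoff_eq_zero hρ hx, zero_mul, zero_mul]
  · have h1 : 2 * ρ ≤ ‖z + x‖ := by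
      have := norm_sub_le (z + x) x
      rw [add_sub_cancel_right] at this
      linarith
    rw [singularPart, singularPart, ballCutoff_eq_zero hρ h1, zero_mul, mul_zero]

/-- The products in which at least one of the two kernels is away from its singularity. -/
theorem integrable_regular_products (hK : IsTruncatedHeatKernel K) {ρ : ℝ} (hρ : 0 < ρ)
    (z : SpaceTime) :
    (Integrable fun x => K x * regularPart K ρ (z + x)) ∧
      Integrable fun x => regularPart K ρ x * singularPart K ρ (z + x) := by
  obtain ⟨C, hC⟩ := exists_abs_regularPart_le hK hρ
  have hc := continuous_regularPart hK hρ
  refine ⟨(integrable_of_isTruncatedHeatKernel hK).mul_bdd (c := C) ?_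
    (Eventually.of_forall fun x => hC _),
    ((integrable_singularPart hK ρ).comp_add_left z).bdd_mul (c := C) ?_
    (Eventually.of_forall fun x => hC _)⟩
  · exact (hc.comp (continuous_const.add continuous_id)).aestronglyMeasurable
  · exact hc.aestronglyMeasurable

theorem kernel_mul_kernel_eq (K : SpaceTime → ℝ) (ρ : ℝ) (z x : SpaceTime) :
    K x * K (z + x) = K x * regularPart K ρ (z + x) + regularPart K ρ x * singularPart K ρ (z + x) +
      singularPart K ρ x * singularPart K ρ (z + x) := by
  have h1 := singularPart_add_regularPart K ρ x
  have h2 := singularPart_add_regularPart K ρ (z + x)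
  conv_lhs => rw [← h2]
  rw [← h1]
  ring

theorem integrable_kernel_mul_kernel (hK : IsTruncatedHeatKernel K) {z : SpaceTime} (hz : z ≠ 0) :
    Integrable fun x => K x * K (z + x) := by
  have hρ : 0 < ‖z‖ / 4 := by positivity
  obtain ⟨h1, h2⟩ := integrable_regular_products hK hρ z
  refine (h1.add h2).congr (Eventually.of_forall fun x => ?_)
  simp only [Pi.add_apply]
  rw [kernel_mul_kernel_eq K (‖z‖ / 4), singularPart_mul_eq_zero K hρ (by linarith), add_zero]

theorem integrable_singularPart_mul (hK : IsTruncatedHeatKernel K) {ρ : ℝ} (hρ : 0 < ρ)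
    {z : SpaceTime} (hz : z ≠ 0) :
    Integrable fun x => singularPart K ρ x * singularPart K ρ (z + x) := by
  obtain ⟨h1, h2⟩ := integrable_regular_products hK hρ z
  refine (((integrable_kernel_mul_kernel hK hz).sub h1).sub h2).congr
    (Eventually.of_forall fun x => ?_)
  simp only [Pi.sub_apply]
  rw [kernel_mul_kernel_eq K ρ]
  ring

theorem kernelCorrelation_eq (hK : IsTruncatedHeatKernel K) {ρ : ℝ} (hρ : 0 < ρ)
    {z : SpaceTime} (hz : z ≠ 0) :
    kernelCorrelation K z =
      regularCorrelation K ρ z + ∫ x, singularPart K ρ x * singularPart K ρ (z + x) := by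
  obtain ⟨h1, h2⟩ := integrable_regular_products hK hρ z
  unfold kernelCorrelation regularCorrelation
  simp_rw [kernel_mul_kernel_eq K ρ z]
  have h12 : Integrable fun x => K x * regularPart K ρ (z + x) +
    regularPart K ρ x * singularPart K ρ (z + x) := h1.add h2
  rw [integral_add h12 (integrable_singularPart_mul hK hρ hz), integral_add h1 h2]
  congr 2
  rw [← integral_add_left_eq_self (fun x => singularPart K ρ x * regularPart K ρ (x - z)) z]
  refine integral_congr_ae (Eventually.of_forall fun x => ?_)
  simp only [add_sub_cancel_left]
  ring

theorem continuousAt_kernelCorrelation (hK : IsTruncatedHeatKernel K) {z : SpaceTime}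
    (hz : z ≠ 0) : ContinuousAt (kernelCorrelation K) z := by
  have hρ : 0 < ‖z‖ / 8 := by positivity
  refine (continuous_regularCorrelation hK hρ).continuousAt.congr ?_
  have h0 : ‖z‖ / 2 < ‖z‖ := by linarith
  filter_upwards [continuous_norm.continuousAt.eventually (lt_mem_nhds h0)] with y hy
  have hy0 : y ≠ 0 := by
    rintro rfl
    rw [norm_zero] at hy
    linarith
  rw [kernelCorrelation_eq hK hρ hy0]
  simp_rw [singularPart_mul_eq_zero K hρ (by linarith : 4 * (‖z‖ / 8) ≤ ‖y‖)]
  simp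

theorem kernelCorrelation_eq_zero {M : ℝ} (hM : ∀ z, M < ‖z‖ → K z = 0) {z : SpaceTime}
    (hz : 2 * M < ‖z‖) : kernelCorrelation K z = 0 := by
  unfold kernelCorrelation
  have : ∀ x, K x * K (z + x) = 0 := by
    intro x
    rcases lt_or_ge M ‖x‖ with hx | hx
    · rw [hM x hx, zero_mul]
    · rw [hM (z + x), mul_zero]
      have := norm_sub_le (z + x) x
      rw [add_sub_cancel_right] at this
      linarith
  simp [this]

end Kernel

/-! ### Periodisation -/

/-- The vectors by which the noise is periodic. -/
def latticePoint (m : Fin 3 → ℤ) : SpaceTime := (0, fun i => (m i : ℝ))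

/-- The periodisation in space of the correlation of the kernel with itself: the covariance of the
convolution of white noise with `K`. -/
noncomputable def periodicCorrelation (K : SpaceTime → ℝ) (z : SpaceTime) : ℝ :=
  ∑' m, kernelCorrelation K (z - latticePoint m)

theorem latticePoint_zero : latticePoint 0 = 0 := by
  simp [latticePoint, Prod.ext_iff, funext_iff]

theorem latticePoint_add (m n : Fin 3 → ℤ) :
    latticePoint (m + n) = latticePoint m + latticePoint n := by
  simp [latticePoint, Prod.ext_iff, funext_iff]

theorem norm_latticePoint (m : Fin 3 → ℤ) : ‖latticePoint m‖ = ‖m‖ := by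
  have h : ‖fun i => (m i : ℝ)‖ = ‖m‖ := by
    simp only [Pi.norm_def]
    congr 2
  rw [latticePoint, Prod.norm_def, norm_zero, h]
  exact max_eq_right (norm_nonneg _)

theorem finite_norm_le (R : ℝ) : {m : Fin 3 → ℤ | ‖m‖ ≤ R}.Finite := by
  have := (isCompact_closedBall (0 : Fin 3 → ℤ) R).finite_of_discrete
  refine this.subset fun m hm => mem_closedBall_zero_iff.2 hm

theorem torusSize_add_latticePoint (z : SpaceTime) (m : Fin 3 → ℤ) :
    torusSize (z + latticePoint m) = torusSize z := by
  rw [← torusSize_add_int z m]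
  simp [latticePoint, Prod.add_def, Pi.add_def]

section Kernel

variable {K : SpaceTime → ℝ}

theorem periodicCorrelation_add_latticePoint (K : SpaceTime → ℝ) (z : SpaceTime)
    (n : Fin 3 → ℤ) : periodicCorrelation K (z + latticePoint n) = periodicCorrelation K z := by
  unfold periodicCorrelation
  rw [← (Equiv.addRight n).tsum_eq]
  refine tsum_congr fun m => ?_
  rw [Equiv.coe_addRight, latticePoint_add]
  congr 1
  abel

theorem periodicCorrelation_eq_sum {M : ℝ} (hM : ∀ z, M < ‖z‖ → K z = 0) {R : ℝ} {z : SpaceTime}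
    (hz : ‖z‖ + 2 * M ≤ R) : periodicCorrelation K z =
      ∑ m ∈ (finite_norm_le R).toFinset, kernelCorrelation K (z - latticePoint m) := by
  refine tsum_eq_sum fun m hm => kernelCorrelation_eq_zero hM ?_
  have hm' : R < ‖m‖ := by simpa using hm
  have := norm_sub_norm_le (latticePoint m) z
  rw [norm_latticePoint, norm_sub_rev] at this
  linarith

theorem continuousAt_periodicCorrelation (hK : IsTruncatedHeatKernel K) {z : SpaceTime}
    (hz : 0 < torusSize z) : ContinuousAt (periodicCorrelation K) z := by
  obtain ⟨M, _, hM0⟩ := exists_eq_zero_of_lt_norm hK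
  set R := ‖z‖ + 1 + 2 * M
  have hc : ContinuousAt (fun y =>
      ∑ m ∈ (finite_norm_le R).toFinset, kernelCorrelation K (y - latticePoint m)) z := by
    refine tendsto_finsetSum _ fun m _ => ?_
    refine ContinuousAt.comp (f := fun y => y - latticePoint m) (g := kernelCorrelation K)
      (continuousAt_kernelCorrelation hK fun h => ?_) (by fun_prop)
    rw [sub_eq_zero] at h
    rw [h, ← zero_add (latticePoint m), torusSize_add_latticePoint] at hz
    simp [torusSize] at hz
  refine hc.congr ?_
  filter_upwards [continuous_norm.continuousAt.eventually (gt_mem_nhds (lt_add_one ‖z‖))] with y hy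
  exact (periodicCorrelation_eq_sum hM0 (by simp only [R]; linarith)).symm

/-- Close to the origin, the periodised correlation differs from its most singular contribution by a
bounded function. -/
theorem exists_singular_le_periodicCorrelation (hK : IsTruncatedHeatKernel K) {ρ : ℝ}
    (hρ : 0 < ρ) : ∃ D : ℝ, 0 < D ∧ ∀ᶠ z in nhds (0 : SpaceTime), z ≠ 0 →
      (∫ x, singularPart K ρ x * singularPart K ρ (z + x)) - D ≤ periodicCorrelation K z := by
  obtain ⟨M, hM, hM0⟩ := exists_eq_zero_of_lt_norm hK
  set S := (finite_norm_le (1 + 2 * M)).toFinset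
  have h0S : (0 : Fin 3 → ℤ) ∈ S := by
    simp only [S, Finite.mem_toFinset, mem_ofPred_eq, norm_zero]
    positivity
  set f : SpaceTime → ℝ := fun z => regularCorrelation K ρ z +
    ∑ m ∈ S.erase 0, kernelCorrelation K (z - latticePoint m) with hf
  have hc : ContinuousAt f 0 := by
    refine (continuous_regularCorrelation hK hρ).continuousAt.add
      (tendsto_finsetSum _ fun m hm => ?_)
    refine ContinuousAt.comp (f := fun y => y - latticePoint m) (g := kernelCorrelation K)
      (continuousAt_kernelCorrelation hK fun h => ?_) (by fun_prop)
    rw [zero_sub, neg_eq_zero] at h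
    have h1 := norm_latticePoint m
    rw [h, norm_zero] at h1
    exact (Finset.mem_erase.1 hm).1 (norm_eq_zero.1 h1.symm)
  refine ⟨|f 0| + 1, by positivity, ?_⟩
  have hlow : -(|f 0| + 1) < f 0 := by
    have := neg_abs_le (f 0)
    linarith
  filter_upwards [hc.eventually (lt_mem_nhds hlow), Metric.closedBall_mem_nhds 0 one_pos] with
    z hz hz1 hz0
  have hz2 := mem_closedBall_zero_iff.1 hz1
  rw [periodicCorrelation_eq_sum hM0 (R := 1 + 2 * M) (by linarith),
    ← Finset.add_sum_erase _ _ h0S, latticePoint_zero, sub_zero, kernelCorrelation_eq hK hρ hz0]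
  simp only [hf] at hz
  linarith

end Kernel

/-! ### The white noise limit of the covariance block -/

/-- The fundamental domain of the spatial periodicity. -/
def unitCell : Set SpaceTime := {h | ∀ i, h.2 i ∈ Ico (0 : ℝ) 1}

theorem measurableSet_unitCell : MeasurableSet unitCell := by
  have : unitCell = ⋂ i, {h : SpaceTime | h.2 i ∈ Ico (0 : ℝ) 1} := by
    ext h; simp [unitCell]
  rw [this]
  exact MeasurableSet.iInter fun i => measurableSet_Ico.preimage (by fun_prop)

theorem hasSum_setIntegral_unitCell {f : SpaceTime → ℝ} (hf : Integrable f) :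
    HasSum (fun m => ∫ h in unitCell, f (h + latticePoint m)) (∫ h, f h) := by
  set s : (Fin 3 → ℤ) → Set SpaceTime := fun m => (fun h => h + latticePoint m) '' unitCell
  have hpre : ∀ m h, h ∈ s m ↔ (fun i => ⌊h.2 i⌋) = m := by
    intro m h
    change h ∈ (fun h => h + latticePoint m) '' unitCell ↔ _
    rw [image_add_right]
    simp only [mem_preimage, unitCell, mem_ofPred_eq, funext_iff]
    refine forall_congr' fun i => ?_
    rw [Int.floor_eq_iff]
    simp only [latticePoint, Prod.snd_add, Prod.snd_neg, Pi.add_apply, Pi.neg_apply, mem_Ico]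
    constructor <;> rintro ⟨h1, h2⟩ <;> constructor <;> linarith
  have hmeas : ∀ m, MeasurableSet (s m) := fun m =>
    (measurableEmbedding_addRight (latticePoint m)).measurableSet_image.2 measurableSet_unitCell
  have hdisj : Pairwise (Function.onFun Disjoint s) := by
    intro m n hmn
    refine Set.disjoint_left.2 fun h h1 h2 => hmn ?_
    rw [← (hpre m h).1 h1, (hpre n h).1 h2]
  have huniv : ⋃ m, s m = univ := eq_univ_of_forall fun h => mem_iUnion.2 ⟨_, (hpre _ h).2 rfl⟩
  have h1 := hasSum_integral_iUnion hmeas hdisj (f := f) (μ := volume) hf.integrableOn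
  rw [huniv, setIntegral_univ] at h1
  have h2 : (fun m => ∫ h in unitCell, f (h + latticePoint m)) = fun m => ∫ h in s m, f h :=
    funext fun m =>
      ((measurePreserving_add_right volume (latticePoint m)).setIntegral_image_emb
        (measurableEmbedding_addRight _) f unitCell).symm
  rwa [h2]

theorem measurableEmbedding_dilate {r : ℝ} (hr : 0 < r) : MeasurableEmbedding (dilate r) := by
  refine (continuous_dilate r).measurableEmbedding fun z w h => ?_
  simp only [dilate, Prod.mk.injEq, funext_iff] at h
  have h2 : r ^ 2 ≠ 0 := by positivity
  refine Prod.ext ((div_left_inj' h2).1 h.1) (funext fun i => (div_left_inj' hr.ne').1 (h.2 i))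

theorem map_dilate_volume {r : ℝ} (hr : 0 < r) :
    (volume : Measure SpaceTime).map (dilate r) = ENNReal.ofReal (r ^ 5) • volume := by
  have h1 := Measure.map_addHaar_smul (volume : Measure ℝ) (r := (r ^ 2)⁻¹) (by positivity)
  have h2 := Measure.map_addHaar_smul (volume : Measure (Fin 3 → ℝ)) (r := r⁻¹) (by positivity)
  have h3 : dilate r = Prod.map ((r ^ 2)⁻¹ • · : ℝ → ℝ) (r⁻¹ • · : (Fin 3 → ℝ) → _) := by
    funext z
    refine Prod.ext ?_ (funext fun i => ?_) <;> simp [dilate, div_eq_inv_mul]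
  rw [h3, Measure.volume_eq_prod, ← Measure.map_prod_map _ _ (by fun_prop) (by fun_prop), h1, h2,
    Measure.prod_smul_left, Measure.prod_smul_right, smul_smul,
    ← ENNReal.ofReal_mul (by positivity)]
  congr 2
  simp only [Module.finrank_self, Module.finrank_fintype_fun_eq_card, Fintype.card_fin, pow_one,
    inv_inv, inv_pow]
  rw [abs_of_pos (by positivity), abs_of_pos (by positivity)]
  ring

theorem exists_norm_sub_latticePoint_le {h : SpaceTime} {ρ : ℝ} (hρ : ρ ≤ 2)
    (hh : torusSize h ≤ ρ) : ∃ m, ‖h - latticePoint m‖ ≤ 2 * ρ := by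
  have hρ0 : 0 ≤ ρ := (torusSize_nonneg h).trans hh
  unfold torusSize at hh
  have h1 : ∀ i, ‖((h.2 i : ℝ) : AddCircle (1 : ℝ))‖ ≤ ρ := fun i => by
    have := Finset.single_le_sum (f := fun i => ‖((h.2 i : ℝ) : AddCircle (1 : ℝ))‖)
      (fun _ _ => norm_nonneg _) (Finset.mem_univ i)
    have h0 := Real.sqrt_nonneg |h.1|
    linarith
  have h2 : Real.sqrt |h.1| ≤ ρ := by
    have : 0 ≤ ∑ i, ‖((h.2 i : ℝ) : AddCircle (1 : ℝ))‖ := by positivity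
    linarith
  refine ⟨fun i => round (h.2 i), ?_⟩
  refine max_le ?_ ((pi_norm_le_iff_of_nonneg (by positivity)).2 fun i => ?_)
  · rw [Real.sqrt_le_left hρ0] at h2
    simp only [latticePoint, Prod.fst_sub, sub_zero, Real.norm_eq_abs]
    nlinarith
  · have := h1 i
    rw [UnitAddCircle.norm_eq] at this
    simp only [latticePoint, Prod.snd_sub, Pi.sub_apply, Real.norm_eq_abs]
    linarith

theorem norm_le_of_mem_unitCell {h : SpaceTime} (hF : h ∈ unitCell) (hh : torusSize h ≤ 2) :
    ‖h‖ ≤ 4 := by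
  refine max_le ?_ ((pi_norm_le_iff_of_nonneg (by norm_num)).2 fun i => ?_)
  · have h2 : Real.sqrt |h.1| ≤ 2 := by
      unfold torusSize at hh
      have : 0 ≤ ∑ i, ‖((h.2 i : ℝ) : AddCircle (1 : ℝ))‖ := by positivity
      linarith
    rw [Real.sqrt_le_left (by norm_num)] at h2
    rw [Real.norm_eq_abs]
    linarith
  · have := hF i
    rw [Real.norm_eq_abs, abs_of_nonneg this.1]
    linarith [this.2]

section Noise

variable {K : SpaceTime → ℝ} {Ω : Type*} [MeasurableSpace Ω] {P : Measure Ω}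
  {ζ : ℝ → SpaceTime → Ω → ℝ}

theorem setIntegral_noiseCovariance (hζ : IsNoiseFamily P ζ) {ε : ℝ} (hε : ε ∈ Ioo (0 : ℝ) 1) :
    ∫ h in unitCell, noiseCovariance P (rescaledNoise ε (ζ ε)) h = 1 := by
  have hε0 : 0 < ε := hε.1
  have h1 : ∀ h, noiseCovariance P (rescaledNoise ε (ζ ε)) h =
      (ε ^ 5)⁻¹ * ∫ ω, ζ ε 0 ω * ζ ε (dilate ε h) ω ∂P := by
    intro h
    unfold noiseCovariance
    rw [← integral_const_mul]
    refine integral_congr_ae (Eventually.of_forall fun ω => ?_)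
    have h0 : dilate ε 0 = 0 := by simp [dilate, Prod.ext_iff, funext_iff]
    have h5 : (ε ^ 5)⁻¹ = ε ^ (-(5 / 2) : ℝ) * ε ^ (-(5 / 2) : ℝ) := by
      rw [← Real.rpow_add hε0, ← Real.rpow_natCast, ← Real.rpow_neg hε0.le]
      norm_num
    simp only [rescaledNoise_eq, h0]
    rw [h5]
    ring
  have h2 : unitCell = dilate ε ⁻¹' {z : SpaceTime | ∀ i, z.2 i ∈ Ico 0 ε⁻¹} := by
    ext h
    simp only [unitCell, dilate, mem_preimage, mem_ofPred_eq, mem_Ico]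
    refine forall_congr' fun i => ?_
    rw [le_div_iff₀ hε0, zero_mul, div_lt_iff₀ hε0, inv_mul_cancel₀ hε0.ne']
  simp_rw [h1]
  rw [integral_const_mul, h2, ← (measurableEmbedding_dilate hε0).setIntegral_map
    (fun z => ∫ ω, ζ ε 0 ω * ζ ε z ω ∂P), map_dilate_volume hε0, Measure.restrict_smul,
    integral_smul_measure, (hζ.isNoise ε hε).normalised, ENNReal.toReal_ofReal (by positivity),
    smul_eq_mul, mul_one, inv_mul_cancel₀ (by positivity)]

theorem integrableOn_noiseCovariance (hζ : IsNoiseFamily P ζ) {ε : ℝ} (hε : ε ∈ Ioo (0 : ℝ) 1) :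
    IntegrableOn (noiseCovariance P (rescaledNoise ε (ζ ε))) unitCell := by
  by_contra h
  have := setIntegral_noiseCovariance hζ hε
  rw [integral_undef h] at this
  exact zero_ne_one this

/-- The covariance block in terms of a single period of the noise. -/
theorem blockKernel_covariance_eq_setIntegral [IsProbabilityMeasure P]
    (hK : IsTruncatedHeatKernel K) (hζ : IsNoiseFamily P ζ) {ε : ℝ} (hε : ε ∈ Ioo (0 : ℝ) 1)
    (z : SpaceTime) :
    IntegrableOn (fun h => noiseCovariance P (rescaledNoise ε (ζ ε)) h *
      periodicCorrelation K (z - h)) unitCell ∧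
    blockKernel P (rescaledNoise ε (ζ ε)) K (1, 1) z 0 =
      ∫ h in unitCell, noiseCovariance P (rescaledNoise ε (ζ ε)) h *
        periodicCorrelation K (z - h) := by
  obtain ⟨M, hM, hM0⟩ := exists_eq_zero_of_lt_norm hK
  obtain ⟨hint, heq⟩ := blockKernel_covariance hK hζ hε z
  set c := noiseCovariance P (rescaledNoise ε (ζ ε)) with hc
  set S := (finite_norm_le (‖z‖ + 4 + 2 * M)).toFinset
  have hcper : ∀ h m, c (h + latticePoint m) = c h := fun h m => by
    rw [hc, ← noiseCovariance_periodic hζ hε h m]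
    simp [latticePoint, Prod.add_def, Pi.add_def]
  have hnorm : ∀ h ∈ unitCell, c h ≠ 0 → ‖h‖ ≤ 4 := by
    intro h hF hch
    refine norm_le_of_mem_unitCell hF (le_of_not_gt fun h2 => hch ?_)
    exact noiseCovariance_eq_zero hζ hε (by linarith [hε.2])
  have hterm : ∀ h m, c (h + latticePoint m) * kernelCorrelation K (z - (h + latticePoint m)) =
      c h * kernelCorrelation K (z - h - latticePoint m) := fun h m => by
    rw [hcper, sub_add_eq_sub_sub]
  have hintm : ∀ m, IntegrableOn (fun h => c h * kernelCorrelation K (z - h - latticePoint m))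
      unitCell := fun m => by
    simp_rw [← hterm]
    exact (hint.comp_add_right (latticePoint m)).integrableOn
  have hper : ∀ h ∈ unitCell, ∑ m ∈ S, c h * kernelCorrelation K (z - h - latticePoint m) =
      c h * periodicCorrelation K (z - h) := by
    intro h hF
    by_cases hch : c h = 0
    · simp [hch]
    · rw [periodicCorrelation_eq_sum hM0 (R := ‖z‖ + 4 + 2 * M), Finset.mul_sum]
      have := norm_sub_le z h
      linarith [hnorm h hF hch]
  refine ⟨(integrable_finsetSum S fun m _ => hintm m).congr ?_, ?_⟩
  · exact (ae_restrict_iff' measurableSet_unitCell).2 (Eventually.of_forall hper)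
  · rw [heq, ← (hasSum_setIntegral_unitCell hint).tsum_eq]
    simp_rw [hterm]
    rw [← setIntegral_congr_fun measurableSet_unitCell hper,
      integral_finsetSum S fun m _ => hintm m]
    refine tsum_eq_sum fun m hm => setIntegral_eq_zero_of_forall_eq_zero fun h hF => ?_
    by_cases hch : c h = 0
    · rw [hch, zero_mul]
    · rw [kernelCorrelation_eq_zero hM0, mul_zero]
      have hm' : ‖z‖ + 4 + 2 * M < ‖m‖ := by simpa [S] using hm
      have h1 := norm_sub_norm_le (latticePoint m) (z - h)
      have h2 := norm_sub_le z h
      rw [norm_latticePoint, norm_sub_rev (latticePoint m)] at h1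
      linarith [hnorm h hF hch]

/-- As `ε → 0` the covariance block converges to the periodised correlation of the kernel with
itself, locally uniformly away from the lattice. -/
theorem tendsto_blockKernel_covariance [IsProbabilityMeasure P] (hK : IsTruncatedHeatKernel K)
    (hζ : IsNoiseFamily P ζ) {ε : ℕ → ℝ} (hε : ∀ n, ε n ∈ Ioo (0 : ℝ) 1)
    (hε0 : Tendsto ε atTop (nhds 0)) {z : ℕ → SpaceTime} {z₀ : SpaceTime}
    (hz : Tendsto z atTop (nhds z₀)) (hz₀ : 0 < torusSize z₀) :
    Tendsto (fun n => blockKernel P (rescaledNoise (ε n) (ζ (ε n))) K (1, 1) (z n) 0) atTop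
      (nhds (periodicCorrelation K z₀)) := by
  obtain ⟨C₁, hC₁, hcov⟩ := abs_noiseCovariance_le hζ
  obtain ⟨C₂, hC₂, hvol⟩ := exists_volume_torusSize_le 4 (by norm_num)
  -- The covariance of the noise is of order `ε ^ (-5)` and lives on a part of the cell of volume
  -- `ε ^ 5`, all of which is close to the lattice.
  rw [Metric.tendsto_atTop]
  intro a ha
  set b := a / (32 * C₁ * C₂ + 1) with hb
  have hb0 : 0 < b := by positivity
  obtain ⟨d, hd, hcont⟩ := Metric.continuousAt_iff.1 (continuousAt_periodicCorrelation hK hz₀) b hb0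
  have hev : ∀ᶠ n in atTop, dist (z n) z₀ < d / 2 ∧ ε n < d / 8 :=
    (hz.eventually (Metric.ball_mem_nhds z₀ (half_pos hd))).and
      (hε0.eventually (gt_mem_nhds (by positivity)))
  obtain ⟨N, hN⟩ := eventually_atTop.1 hev
  refine ⟨N, fun n hn => ?_⟩
  obtain ⟨hzn, hεn⟩ := hN n hn
  have hpos : 0 < ε n := (hε n).1
  have hlt1 : ε n < 1 := (hε n).2
  obtain ⟨hint, heq⟩ := blockKernel_covariance_eq_setIntegral hK hζ (hε n) (z n)
  have hcint := integrableOn_noiseCovariance hζ (hε n)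
  have hone := setIntegral_noiseCovariance hζ (hε n)
  have hcb := hcov (ε n) (hε n)
  have hc0 := fun h => noiseCovariance_eq_zero hζ (hε n) (h := h)
  set c := noiseCovariance P (rescaledNoise (ε n) (ζ (ε n)))
  set T : Set SpaceTime := {h | torusSize (h - 0) ≤ 2 * ε n} with hT
  have hTm : MeasurableSet T := measurableSet_le (by fun_prop) measurable_const
  have hsub : unitCell ∩ T ⊆ T ∩ Metric.closedBall 0 4 := by
    rintro h ⟨hF, hh⟩
    refine ⟨hh, mem_closedBall_zero_iff.2 (norm_le_of_mem_unitCell hF ?_)⟩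
    simp only [hT, mem_ofPred_eq, sub_zero] at hh
    linarith
  have hμ : volume (unitCell ∩ T) ≤ ENNReal.ofReal (C₂ * (2 * ε n) ^ 5) := by
    have := hvol 0 0 (2 * ε n) (by positivity)
    rw [Measure.restrict_apply hTm] at this
    exact (measure_mono hsub).trans this
  have hdiff : blockKernel P (rescaledNoise (ε n) (ζ (ε n))) K (1, 1) (z n) 0 -
      periodicCorrelation K z₀ = ∫ h in unitCell ∩ T, c h *
        (periodicCorrelation K (z n - h) - periodicCorrelation K z₀) := by
    rw [← setIntegral_eq_of_subset_of_forall_sdiff_eq_zero measurableSet_unitCell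
      inter_subset_left]
    · simp_rw [mul_sub]
      rw [integral_sub hint (hcint.mul_const _), integral_mul_const, hone, one_mul, heq]
    · rintro h ⟨hF, hh⟩
      have : ¬ torusSize (h - 0) ≤ 2 * ε n := fun h' => hh ⟨hF, h'⟩
      rw [sub_zero, not_le] at this
      rw [hc0 h this, zero_mul]
  rw [Real.dist_eq, hdiff]
  have hbound : ∀ h ∈ unitCell ∩ T, ‖c h *
      (periodicCorrelation K (z n - h) - periodicCorrelation K z₀)‖ ≤
      C₁ * (ε n ^ 5)⁻¹ * b := by
    rintro h ⟨-, hh⟩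
    simp only [hT, mem_ofPred_eq, sub_zero] at hh
    obtain ⟨m, hm⟩ := exists_norm_sub_latticePoint_le (by linarith) hh
    have h1 : dist (z n - h + latticePoint m) z₀ < d := by
      calc dist (z n - h + latticePoint m) z₀ = ‖(z n - z₀) - (h - latticePoint m)‖ := by
            rw [dist_eq_norm]
            congr 1
            abel
        _ ≤ ‖z n - z₀‖ + ‖h - latticePoint m‖ := norm_sub_le _ _
        _ < d := by
            rw [dist_eq_norm] at hzn
            linarith
    have h2 := (hcont h1).le
    rw [periodicCorrelation_add_latticePoint, Real.dist_eq] at h2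
    rw [Real.norm_eq_abs, abs_mul]
    exact mul_le_mul (hcb h) h2 (abs_nonneg _) (by positivity)
  have hfin := norm_setIntegral_le_of_norm_le_const (hμ.trans_lt ENNReal.ofReal_lt_top) hbound
  rw [Real.norm_eq_abs] at hfin
  have hreal : volume.real (unitCell ∩ T) ≤ C₂ * (2 * ε n) ^ 5 :=
    ENNReal.toReal_le_of_le_ofReal (by positivity) hμ
  calc _ ≤ C₁ * (ε n ^ 5)⁻¹ * b * (C₂ * (2 * ε n) ^ 5) := hfin.trans (by gcongr)
    _ = 32 * C₁ * C₂ * b := by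
        field_simp
        ring
    _ < (32 * C₁ * C₂ + 1) * b := by nlinarith
    _ = a := by
        rw [hb]
        field_simp

end Noise

/-! ### The logarithmic divergence of the pairwise contraction -/

/-- In a parabolic cone around the positive time axis the heat kernel is of order `t^{-3/2}`. -/
theorem exists_le_heatKernel : ∃ c : ℝ, 0 < c ∧ ∀ s : ℝ, 0 < s → ∀ y : SpaceTime,
    y.1 ∈ Icc (s ^ 2) (3 * s ^ 2) → (∀ i, |y.2 i| ≤ 2 * s) → c / s ^ 3 ≤ heatKernel y := by
  refine ⟨(12 * Real.pi) ^ (-(3 / 2) : ℝ) * Real.exp (-3), by positivity, fun s hs y hy hy2 => ?_⟩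
  have hy0 : 0 < y.1 := lt_of_lt_of_le (by positivity) hy.1
  have hπ := Real.pi_pos
  rw [heatKernel, if_pos hy0]
  have h1 : (12 * Real.pi) ^ (-(3 / 2) : ℝ) / s ^ 3 = (12 * Real.pi * s ^ 2) ^ (-(3 / 2) : ℝ) := by
    rw [Real.mul_rpow (x := 12 * Real.pi) (y := s ^ 2) (by positivity) (by positivity),
      ← Real.rpow_natCast s 2,
      ← Real.rpow_mul hs.le, div_eq_mul_inv, ← Real.rpow_natCast s 3, ← Real.rpow_neg hs.le]
    norm_num
  have h2 : ∑ i, y.2 i ^ 2 ≤ 12 * s ^ 2 := by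
    have : ∀ i, y.2 i ^ 2 ≤ 4 * s ^ 2 := fun i => by
      have := sq_le_sq' (by linarith [neg_abs_le (y.2 i), hy2 i]) ((le_abs_self _).trans (hy2 i))
      linarith
    calc _ ≤ ∑ _i : Fin 3, 4 * s ^ 2 := Finset.sum_le_sum fun i _ => this i
      _ = _ := by simp; ring
  rw [mul_div_right_comm, h1]
  refine mul_le_mul ?_ (Real.exp_le_exp.2 ?_) (Real.exp_pos _).le (by positivity)
  · exact Real.rpow_le_rpow_of_nonpos (by positivity) (by nlinarith [hy.2]) (by norm_num)
  · rw [neg_div, neg_le_neg_iff, div_le_iff₀ (by positivity)]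
    linarith [hy.1]

theorem parabolicNorm_le_one_of_norm_le {z : SpaceTime} (hz : ‖z‖ ≤ 1 / 10) :
    parabolicNorm z ≤ 1 := by
  have h1 := (abs_fst_le_norm z).trans hz
  have h2 : Real.sqrt |z.1| ≤ 7 / 10 := by
    rw [Real.sqrt_le_left (by norm_num)]
    linarith
  have h3 : ∑ i, |z.2 i| ≤ ∑ _i : Fin 3, (1 / 10 : ℝ) :=
    Finset.sum_le_sum fun i _ => (abs_snd_le_norm z i).trans hz
  simp at h3
  unfold parabolicNorm
  linarith

theorem volume_parabolic_box {a b s : ℝ} (hs : 0 ≤ s) (hab : a ≤ b) :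
    volume {x : SpaceTime | x.1 ∈ Icc a b ∧ ∀ i, |x.2 i| ≤ s} =
      ENNReal.ofReal ((b - a) * (2 * s) ^ 3) := by
  have h : {x : SpaceTime | x.1 ∈ Icc a b ∧ ∀ i, |x.2 i| ≤ s} =
      Icc a b ×ˢ Set.univ.pi fun _ : Fin 3 => Icc (-s) s := by
    ext x
    simp only [mem_ofPred_eq, mem_prod, Set.mem_pi, mem_univ, true_implies, abs_le, mem_Icc]
  rw [h, Measure.volume_eq_prod, Measure.prod_prod, volume_pi_pi]
  simp only [Real.volume_Icc, Finset.prod_const, Finset.card_univ, Fintype.card_fin]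
  rw [← ENNReal.ofReal_pow (by linarith), ← ENNReal.ofReal_mul (by linarith)]
  congr 2
  ring

section Kernel

variable {K : SpaceTime → ℝ}

theorem singularPart_nonneg (hK : IsTruncatedHeatKernel K) {x : SpaceTime} (hx : x ≠ 0) :
    0 ≤ singularPart K (1 / 20) x := by
  unfold singularPart
  rcases le_total (1 / 10) ‖x‖ with h | h
  · rw [ballCutoff_eq_zero (by norm_num) (by linarith), zero_mul]
  · rw [hK.eq_heatKernel x hx (parabolicNorm_le_one_of_norm_le h)]
    exact mul_nonneg (ballCutoff_nonneg _ _) (heatKernel_nonneg _)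

theorem exists_le_singularPart (hK : IsTruncatedHeatKernel K) :
    ∃ c : ℝ, 0 < c ∧ ∀ s ∈ Ioc (0 : ℝ) (1 / 40), ∀ y : SpaceTime,
    y.1 ∈ Icc (s ^ 2) (3 * s ^ 2) → (∀ i, |y.2 i| ≤ 2 * s) →
      c / s ^ 3 ≤ singularPart K (1 / 20) y := by
  obtain ⟨c, hc, h⟩ := exists_le_heatKernel
  refine ⟨c, hc, fun s hs y hy1 hy2 => ?_⟩
  have hs0 : 0 < s := hs.1
  have hs2 : s ≤ 1 / 40 := hs.2
  have hy0 : 0 < y.1 := lt_of_lt_of_le (by positivity) hy1.1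
  have hn : ‖y‖ ≤ 1 / 20 := by
    refine max_le ?_ ((pi_norm_le_iff_of_nonneg (by norm_num)).2 fun i => ?_)
    · rw [Real.norm_eq_abs, abs_of_pos hy0]
      nlinarith [hy1.2]
    · rw [Real.norm_eq_abs]
      linarith [hy2 i]
  have hne : y ≠ 0 := by
    rintro rfl
    exact lt_irrefl _ hy0
  rw [singularPart, ballCutoff_eq_one (by norm_num) hn, one_mul,
    hK.eq_heatKernel y hne (parabolicNorm_le_one_of_norm_le (by linarith))]
  exact h s hs0 y hy1 hy2

/-- In a parabolic cone around the negative time axis the correlation of the kernel with itself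
is at least of order `|t|^{-1/2}`. -/
theorem exists_le_integral_singularPart (hK : IsTruncatedHeatKernel K) :
    ∃ c : ℝ, 0 < c ∧ ∀ s ∈ Ioc (0 : ℝ) (1 / 40), ∀ v : SpaceTime,
      v.1 = -s ^ 2 → (∀ i, |v.2 i| ≤ s) →
      c / s ≤ ∫ x, singularPart K (1 / 20) x * singularPart K (1 / 20) (v + x) := by
  obtain ⟨c, hc, h⟩ := exists_le_singularPart hK
  refine ⟨8 * c ^ 2, by positivity, fun s hs v hv1 hv2 => ?_⟩
  have hs0 : 0 < s := hs.1
  have hv0 : v ≠ 0 := by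
    rintro rfl
    have : 0 < s ^ 2 := by positivity
    rw [Prod.fst_zero] at hv1
    linarith
  have hint := integrable_singularPart_mul hK (ρ := 1 / 20) (by norm_num) hv0
  -- On this box, both `x` and `v + x` lie in the cone where the heat kernel is of order `s ^ (-3)`.
  set E : Set SpaceTime := {x | x.1 ∈ Icc (2 * s ^ 2) (3 * s ^ 2) ∧ ∀ i, |x.2 i| ≤ s} with hE
  have hvol : volume E = ENNReal.ofReal (s ^ 2 * (2 * s) ^ 3) := by
    rw [hE, volume_parabolic_box hs0.le (by nlinarith)]
    congr 2
    ring
  have hEm : MeasurableSet E := by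
    have : E = {x | x.1 ∈ Icc (2 * s ^ 2) (3 * s ^ 2)} ∩ ⋂ i, {x | |x.2 i| ≤ s} := by
      ext x
      simp [hE]
    rw [this]
    exact (measurableSet_Icc.preimage measurable_fst).inter
      (MeasurableSet.iInter fun i => measurableSet_le (by fun_prop) measurable_const)
  have hlow : ∀ x ∈ E, c / s ^ 3 * (c / s ^ 3) ≤
      singularPart K (1 / 20) x * singularPart K (1 / 20) (v + x) := by
    rintro x ⟨hx1, hx2⟩
    have h1 := h s hs x ⟨by nlinarith [hx1.1], hx1.2⟩ fun i => by linarith [hx2 i]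
    have h2 := h s hs (v + x) (by
      rw [Prod.fst_add, hv1]
      constructor <;> nlinarith [hx1.1, hx1.2]) fun i => by
        rw [Prod.snd_add, Pi.add_apply]
        linarith [abs_add_le (v.2 i) (x.2 i), hx2 i, hv2 i]
    have h3 : 0 ≤ c / s ^ 3 := by positivity
    exact mul_le_mul h1 h2 h3 (h3.trans h1)
  have hge := setIntegral_ge_of_const_le_real hEm (by rw [hvol]; exact ENNReal.ofReal_ne_top) hlow
    hint.integrableOn
  have hnn : 0 ≤ᵐ[volume] fun x => singularPart K (1 / 20) x * singularPart K (1 / 20) (v + x) := by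
    filter_upwards [ae_torusSize_sub_pos 0, ae_torusSize_sub_pos (-v)] with x h1 h2
    have hpos : ∀ z : SpaceTime, 0 < torusSize z → z ≠ 0 := by
      rintro z hz rfl
      simp [torusSize] at hz
    rw [sub_zero] at h1
    rw [sub_neg_eq_add, add_comm] at h2
    exact mul_nonneg (singularPart_nonneg hK (hpos _ h1)) (singularPart_nonneg hK (hpos _ h2))
  refine le_trans (le_of_eq ?_) (hge.trans (setIntegral_le_integral hint hnn))
  rw [Measure.real, hvol, ENNReal.toReal_ofReal (by positivity)]
  field_simp
  ring

theorem lintegral_inv_neg_eq_top {a : ℝ} (ha : 0 < a) :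
    ∫⁻ t in Ioo (-a) 0, ENNReal.ofReal (-t)⁻¹ = ⊤ := by
  by_contra hne
  have h1 : IntegrableOn (fun t : ℝ => t⁻¹) (Ioo (-a) 0) := by
    refine ⟨measurable_inv.aestronglyMeasurable, ?_⟩
    rw [hasFiniteIntegral_iff_norm]
    refine lt_of_le_of_lt (le_of_eq ?_) (lt_top_iff_ne_top.2 hne)
    refine setLIntegral_congr_fun measurableSet_Ioo fun t ht => ?_
    rw [Real.norm_eq_abs, abs_inv, abs_of_neg ht.2]
  have h2 : IntervalIntegrable (fun t : ℝ => t⁻¹) volume (-a) 0 := by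
    rw [intervalIntegrable_iff_integrableOn_Ioo_of_le (by linarith)]
    exact h1
  rw [intervalIntegrable_inv_iff] at h2
  rcases h2 with h2 | h2
  · linarith
  · exact h2 right_mem_uIcc

/-- The limiting pairwise contraction, rooted at the origin, diverges logarithmically: its integrand
is of parabolic order `-5` in a cone around the negative time axis. -/
theorem lintegral_kernel_mul_periodicCorrelation_sq (hK : IsTruncatedHeatKernel K) :
    ∫⁻ v, ENNReal.ofReal (K (-v)) * ENNReal.ofReal (periodicCorrelation K v ^ 2) = ⊤ := by
  obtain ⟨c₁, hc₁, h1⟩ := exists_le_singularPart hK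
  obtain ⟨c₂, hc₂, h2⟩ := exists_le_integral_singularPart hK
  obtain ⟨D, hD, h3⟩ := exists_singular_le_periodicCorrelation hK (ρ := 1 / 20) (by norm_num)
  obtain ⟨d, hd, h4⟩ := Metric.eventually_nhds_iff.1 h3
  -- The height of the cone; below it `D` is at most half of `c₂ / √|t|`.
  set s₀ := min (min (1 / 40) (d / 2)) (c₂ / (2 * D)) with hs₀
  have hs₀pos : 0 < s₀ := by positivity
  set c := c₁ * (c₂ / 2) ^ 2 * 8 with hc
  have hcpos : 0 < c := by positivity
  set G : ℝ × (Fin 3 → ℝ) → ENNReal := fun v =>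
    {v : ℝ × (Fin 3 → ℝ) | v.1 ∈ Ioo (-s₀ ^ 2) 0 ∧ ∀ i, |v.2 i| ≤ Real.sqrt (-v.1)}.indicator
      (fun v => ENNReal.ofReal (c / 8 / Real.sqrt (-v.1) ^ 5)) v with hG
  have hset : MeasurableSet
      {v : ℝ × (Fin 3 → ℝ) | v.1 ∈ Ioo (-s₀ ^ 2) 0 ∧ ∀ i, |v.2 i| ≤ Real.sqrt (-v.1)} := by
    have : {v : ℝ × (Fin 3 → ℝ) | v.1 ∈ Ioo (-s₀ ^ 2) 0 ∧ ∀ i, |v.2 i| ≤ Real.sqrt (-v.1)} =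
        {v | v.1 ∈ Ioo (-s₀ ^ 2) 0} ∩ ⋂ i, {v | |v.2 i| ≤ Real.sqrt (-v.1)} := by
      ext x
      simp
    rw [this]
    exact (measurableSet_Ioo.preimage measurable_fst).inter
      (MeasurableSet.iInter fun i => measurableSet_le (by fun_prop) (by fun_prop))
  have hGm : Measurable G := Measurable.indicator (by fun_prop) hset
  have hle : ∀ v, G v ≤ ENNReal.ofReal (K (-v)) * ENNReal.ofReal (periodicCorrelation K v ^ 2) := by
    intro v
    refine Set.indicator_le (g := fun v : SpaceTime =>
      ENNReal.ofReal (K (-v)) * ENNReal.ofReal (periodicCorrelation K v ^ 2)) (fun v hv => ?_) v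
    obtain ⟨hv1, hv2⟩ := hv
    have hneg : 0 < -v.1 := by linarith [hv1.2]
    set s := Real.sqrt (-v.1) with hs
    have hspos : 0 < s := Real.sqrt_pos.2 hneg
    have hsq : s ^ 2 = -v.1 := Real.sq_sqrt hneg.le
    have hss₀ : s ≤ s₀ := by
      refine Real.sqrt_le_iff.2 ⟨hs₀pos.le, ?_⟩
      linarith [hv1.1]
    have hs1 : s ≤ 1 / 40 := hss₀.trans ((min_le_left _ _).trans (min_le_left _ _))
    have hs2 : s ≤ d / 2 := hss₀.trans ((min_le_left _ _).trans (min_le_right _ _))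
    have hs3 : s ≤ c₂ / (2 * D) := hss₀.trans (min_le_right _ _)
    have hv0 : v ≠ 0 := by
      rintro rfl
      simp at hneg
    have hdist : dist v 0 < d := by
      rw [dist_zero_right]
      refine lt_of_le_of_lt (max_le ?_ ((pi_norm_le_iff_of_nonneg hspos.le).2 hv2)) (by linarith)
      rw [Real.norm_eq_abs, abs_of_neg hv1.2, ← hsq]
      nlinarith
    have hA := h2 s ⟨hspos, hs1⟩ v (by linarith) hv2
    have hQ : c₂ / 2 / s ≤ periodicCorrelation K v := by
      have h5 := h4 hdist hv0
      have h6 : D ≤ c₂ / 2 / s := by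
        rw [le_div_iff₀ (by positivity)] at hs3 ⊢
        linarith
      have h7 : c₂ / s = c₂ / 2 / s + c₂ / 2 / s := by ring
      linarith
    have hKv : c₁ / s ^ 3 ≤ K (-v) := by
      have h5 := h1 s ⟨hspos, hs1⟩ (-v) (by
        rw [Prod.fst_neg]
        constructor <;> nlinarith) (fun i => by
          rw [Prod.snd_neg, Pi.neg_apply, abs_neg]
          linarith [hv2 i])
      rw [singularPart] at h5
      have h6 := ballCutoff_le_one (1 / 20) (-v)
      have h7 := ballCutoff_nonneg (1 / 20) (-v)
      have h8 : 0 < c₁ / s ^ 3 := by positivity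
      have h9 : 0 < K (-v) := by
        by_contra h10
        linarith [mul_nonpos_of_nonneg_of_nonpos h7 (not_lt.1 h10)]
      exact h5.trans (mul_le_of_le_one_left h9.le h6)
    rw [← ENNReal.ofReal_mul ((by positivity : 0 ≤ c₁ / s ^ 3).trans hKv)]
    refine ENNReal.ofReal_le_ofReal ?_
    calc c / 8 / s ^ 5 = c₁ / s ^ 3 * (c₂ / 2 / s) ^ 2 := by
          rw [hc]
          field_simp
      _ ≤ K (-v) * periodicCorrelation K v ^ 2 := by
          have h9 : (c₂ / 2 / s) ^ 2 ≤ periodicCorrelation K v ^ 2 := by gcongr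
          exact mul_le_mul hKv h9 (by positivity) ((by positivity : 0 ≤ c₁ / s ^ 3).trans hKv)
  have hinner : ∀ t : ℝ, ∫⁻ ξ, G (t, ξ) =
      (Ioo (-s₀ ^ 2) 0).indicator (fun t => ENNReal.ofReal c * ENNReal.ofReal (-t)⁻¹) t := by
    intro t
    by_cases ht : t ∈ Ioo (-s₀ ^ 2) 0
    · have hneg : 0 < -t := by linarith [ht.2]
      set s := Real.sqrt (-t) with hs
      have hspos : 0 < s := Real.sqrt_pos.2 hneg
      have hsq : s ^ 2 = -t := Real.sq_sqrt hneg.le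
      have hfun : (fun ξ => G (t, ξ)) = (Set.univ.pi fun _ : Fin 3 => Icc (-s) s).indicator
          fun _ => ENNReal.ofReal (c / 8 / s ^ 5) := by
        funext ξ
        simp only [hG, indicator, mem_ofPred_eq, ht, true_and, Set.mem_pi, mem_univ, true_implies,
          abs_le, mem_Icc]
        rfl
      rw [indicator_of_mem ht, hfun, lintegral_indicator
        (MeasurableSet.univ_pi fun _ => measurableSet_Icc), setLIntegral_const, volume_pi_pi]
      simp only [Real.volume_Icc, Finset.prod_const, Finset.card_univ, Fintype.card_fin]
      rw [← ENNReal.ofReal_pow (by linarith), ← ENNReal.ofReal_mul (by positivity),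
        ← ENNReal.ofReal_mul hcpos.le, ← hsq]
      congr 1
      field_simp
      ring
    · rw [indicator_of_notMem ht]
      refine (lintegral_congr fun ξ => ?_).trans lintegral_zero
      rw [hG]
      exact indicator_of_notMem (fun h => ht h.1) _
  refine top_le_iff.1 (le_trans (le_of_eq ?_) (lintegral_mono hle))
  rw [Measure.volume_eq_prod, lintegral_prod _ hGm.aemeasurable]
  simp_rw [hinner]
  rw [lintegral_indicator measurableSet_Ioo, lintegral_const_mul _ (by fun_prop),
    lintegral_inv_neg_eq_top (by positivity), ENNReal.mul_top]
  simpa using hcpos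

end Kernel

/-! ### Optimality for the pairwise contraction -/

theorem exists_isTestFunction_pos : ∃ φ : SpaceTime → ℝ, IsTestFunction φ ∧ (∀ z, 0 ≤ φ z) ∧
    ∀ z ∈ Metric.ball (0 : SpaceTime) (1 / 10), 0 < φ z := by
  let f : ContDiffBump (0 : SpaceTime) := ⟨1 / 20, 1 / 10, by norm_num, by norm_num⟩
  have hf : ContDiff ℝ 2 f := f.contDiff
  have hb : ∀ j : ℕ, j ≤ 2 → ∃ B, ∀ z, ‖iteratedFDeriv ℝ j f z‖ ≤ B := fun j hj =>
    (hf.continuous_iteratedFDeriv (by exact_mod_cast hj)).bounded_above_of_compact_support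
      (f.hasCompactSupport.iteratedFDeriv j)
  choose! B hB using hb
  set c := (1 + |B 0| + |B 1| + |B 2|)⁻¹ with hc
  have hcpos : 0 < c := by positivity
  refine ⟨fun z => c • f z, ⟨hf.const_smul c, fun j hj z => ?_, ?_⟩, fun z => ?_,
    fun z hz => ?_⟩
  · rw [iteratedFDeriv_const_smul_apply' (hf.of_le (by exact_mod_cast hj)).contDiffAt, norm_smul,
      Real.norm_of_nonneg hcpos.le, hc, inv_mul_le_one₀ (by positivity)]
    refine (hB j hj z).trans ((le_abs_self _).trans ?_)
    have h0 := abs_nonneg (B 0)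
    have h1 := abs_nonneg (B 1)
    have h2 := abs_nonneg (B 2)
    interval_cases j <;> linarith
  · refine (closure_mono (Function.support_const_smul_subset c f)).trans ?_
    change tsupport f ⊆ _
    rw [f.tsupport_eq]
    exact fun z hz => parabolicNorm_le_one_of_norm_le (mem_closedBall_zero_iff.1 hz)
  · exact smul_nonneg hcpos.le f.nonneg
  · exact smul_pos hcpos (f.pos_of_mem_ball hz)

theorem dilate_inv_dilate {r : ℝ} (hr : 0 < r) (z : SpaceTime) :
    dilate r⁻¹ (dilate r z) = z := by
  refine Prod.ext ?_ (funext fun i => ?_) <;> simp only [dilate] <;> field_simp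

theorem lintegral_rescaledTest_mul {r : ℝ} (hr : 0 < r) (φ : SpaceTime → ℝ)
    (H : SpaceTime → ENNReal) :
    ∫⁻ w, ENNReal.ofReal (rescaledTest r φ w) * H w =
      ∫⁻ w, ENNReal.ofReal (φ w) * H (dilate r⁻¹ w) := by
  have h1 : ∀ w, ENNReal.ofReal (rescaledTest r φ w) * H w = ENNReal.ofReal (r ^ (-5 : ℝ)) *
      (fun w => ENNReal.ofReal (φ w) * H (dilate r⁻¹ w)) (dilate r w) := by
    intro w
    rw [rescaledTest_eq, ENNReal.ofReal_mul (by positivity), mul_assoc]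
    simp only [dilate_inv_dilate hr]
  simp_rw [h1]
  rw [lintegral_const_mul' _ _ ENNReal.ofReal_ne_top,
    ← (measurableEmbedding_dilate hr).lintegral_map
      (fun w => ENNReal.ofReal (φ w) * H (dilate r⁻¹ w)), map_dilate_volume hr,
    lintegral_smul_measure,
    smul_eq_mul, ← mul_assoc, ← ENNReal.ofReal_mul (by positivity), Real.rpow_neg hr.le,
    show (5 : ℝ) = ((5 : ℕ) : ℝ) by norm_num, Real.rpow_natCast, inv_mul_cancel₀ (by positivity),
    ENNReal.ofReal_one, one_mul]

theorem lintegral_rescaledTest_mul_prod {r : ℝ} (hr : 0 < r) {φ : SpaceTime → ℝ}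
    (hφ : Measurable φ) {X : SpaceTime × SpaceTime → ENNReal} (hX : Measurable X) :
    ∫⁻ u : SpaceTime × SpaceTime, ENNReal.ofReal (rescaledTest r φ u.2) * X u =
      ∫⁻ w, ENNReal.ofReal (φ w) * ∫⁻ v, X (v, dilate r⁻¹ w) := by
  have hψ : Measurable (rescaledTest r φ) :=
    (hφ.comp (continuous_dilate r).measurable).const_mul _
  have hm : Measurable fun u : SpaceTime × SpaceTime =>
      ENNReal.ofReal (rescaledTest r φ u.2) * X u :=
    (hψ.comp measurable_snd).ennreal_ofReal.mul hX
  rw [← lintegral_rescaledTest_mul hr φ fun w => ∫⁻ v, X (v, w), Measure.volume_eq_prod,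
    lintegral_prod_symm' _ hm]
  exact lintegral_congr fun w =>
    lintegral_const_mul' (ENNReal.ofReal (rescaledTest r φ w)) (fun v => X (v, w))
      ENNReal.ofReal_ne_top

section Noise

variable {K : SpaceTime → ℝ} {Ω : Type*} [MeasurableSpace Ω] {P : Measure Ω}
  [IsProbabilityMeasure P] {ζ : ℝ → SpaceTime → Ω → ℝ}

/-- The negative part of the kernel is bounded, so that its contribution is controlled by the local
integrability of the square of the covariance block. -/
theorem exists_lintegral_negPart_le (hK : IsTruncatedHeatKernel K) (hζ : IsNoiseFamily P ζ) :
    ∃ D : ℝ, 0 ≤ D ∧ ∀ ε ∈ Ioo (0 : ℝ) 1, ∀ w : SpaceTime, ‖w‖ ≤ 1 →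
      ∫⁻ v, ENNReal.ofReal (-K (-v)) *
        ENNReal.ofReal (blockKernel P (rescaledNoise ε (ζ ε)) K (1, 1) v w ^ 2) ≤
          ENNReal.ofReal D := by
  obtain ⟨M, hM, hM0⟩ := exists_eq_zero_of_lt_norm hK
  obtain ⟨B, hB, hB0⟩ := exists_bound_of_le_parabolicNorm hK one_pos
  obtain ⟨C, hC, hg⟩ := exists_abs_blockKernel_le hK hζ (b := (1, 1)) le_rfl le_rfl (a := 1)
    one_pos (by simp [blockOrder])
  obtain ⟨A, hA, hconv⟩ := exists_lintegral_torusSize_rpow_le M hM.le (p := 2) (by norm_num)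
    (by norm_num)
  refine ⟨B * C ^ 2 * (A * (M + 1 + 3) ^ (5 - 2 : ℝ)), by positivity, fun ε hε w hw => ?_⟩
  set E : Set SpaceTime := {x | torusSize (x - w) ≤ M + 1 + 3} ∩ Metric.closedBall 0 M
  have hE : MeasurableSet E :=
    (measurableSet_le (by fun_prop) measurable_const).inter Metric.isClosed_closedBall.measurableSet
  calc _ ≤ ∫⁻ v, E.indicator (fun v => ENNReal.ofReal (B * C ^ 2) *
          ENNReal.ofReal (torusSize (v - w) ^ (-2 : ℝ))) v := by
        refine lintegral_mono_ae ?_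
        filter_upwards [ae_torusSize_sub_pos w, ae_torusSize_sub_pos 0] with v h1 h2
        have hv0 : -v ≠ 0 := by
          intro h
          rw [neg_eq_zero] at h
          subst h
          simp [torusSize] at h2
        by_cases hneg : 0 ≤ K (-v)
        · rw [ENNReal.ofReal_of_nonpos (by linarith), zero_mul]
          exact zero_le
        · have hvM : ‖v‖ ≤ M := by
            by_contra h
            rw [← norm_neg, not_le] at h
            exact hneg (hM0 _ h).ge
          have hvE : v ∈ E := ⟨torusSize_le_of_norm_le ((norm_sub_le _ _).trans
            (add_le_add hvM hw)), mem_closedBall_zero_iff.2 hvM⟩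
          have hKB : -K (-v) ≤ B := by
            refine (neg_le_abs _).trans (hB0 _ (le_of_not_ge fun h => hneg ?_))
            rw [hK.eq_heatKernel _ hv0 h]
            exact heatKernel_nonneg _
          have hgv := hg ε hε v w h1
          norm_num at hgv
          rw [indicator_of_mem hvE, ← ENNReal.ofReal_mul (by linarith [not_le.1 hneg]),
            ← ENNReal.ofReal_mul (by positivity)]
          refine ENNReal.ofReal_le_ofReal ?_
          have h3 : blockKernel P (rescaledNoise ε (ζ ε)) K (1, 1) v w ^ 2 ≤
              (C * torusSize (v - w) ^ (-1 : ℝ)) ^ 2 := by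
            rw [← sq_abs]
            gcongr
          have h4 : (torusSize (v - w) ^ (-1 : ℝ)) ^ 2 = torusSize (v - w) ^ (-2 : ℝ) := by
            rw [← Real.rpow_natCast, ← Real.rpow_mul h1.le]
            norm_num
          rw [mul_pow, h4] at h3
          calc _ ≤ B * (C ^ 2 * torusSize (v - w) ^ (-2 : ℝ)) :=
                mul_le_mul hKB h3 (sq_nonneg _) hB.le
            _ = _ := by ring
    _ = ENNReal.ofReal (B * C ^ 2) * ∫⁻ v in E, ENNReal.ofReal (torusSize (v - w) ^ (-2 : ℝ)) := by
        rw [lintegral_indicator hE, lintegral_const_mul _ (by fun_prop)]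
    _ ≤ ENNReal.ofReal (B * C ^ 2) * ENNReal.ofReal (A * (M + 1 + 3) ^ (5 - 2 : ℝ)) := by
        gcongr
        exact hconv 0 w _ (by positivity)
    _ = _ := (ENNReal.ofReal_mul (by positivity)).symm

/-- The positive part of the integral that defines the pairwise contraction is controlled by the
integral itself, since the kernel is nonnegative close to its singularity. -/
theorem exists_lintegral_posPart_le (hK : IsTruncatedHeatKernel K) (hζ : IsNoiseFamily P ζ)
    {φ : SpaceTime → ℝ} (hφ : IsTestFunction φ) (hφ0 : ∀ z, 0 ≤ φ z) :
    ∃ D : ENNReal, D ≠ ⊤ ∧ ∀ ε ∈ Ioo (0 : ℝ) 1, ∀ r ∈ Ioc (0 : ℝ) 1,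
      ∫⁻ w, ENNReal.ofReal (φ w) * ∫⁻ v, ENNReal.ofReal (K (-v)) * ENNReal.ofReal
        (blockKernel P (rescaledNoise ε (ζ ε)) K (1, 1) v (dilate r⁻¹ w) ^ 2) ≤
      ENNReal.ofReal |∫ u, rootedIntegrand P (rescaledNoise ε (ζ ε)) K {(1, 1), (1, 1)}
        (rescaledTest r φ) u| + D := by
  obtain ⟨D, hD, hneg⟩ := exists_lintegral_negPart_le hK hζ
  have hφint : Integrable φ := by
    have h1 := integrable_rescaledTest hφ (r := 1) ⟨one_pos, le_rfl⟩
    refine h1.congr (Eventually.of_forall fun z => ?_)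
    simp [rescaledTest]
  refine ⟨(∫⁻ w, ENNReal.ofReal (φ w)) * ENNReal.ofReal D,
    ENNReal.mul_ne_top hφint.lintegral_lt_top.ne ENNReal.ofReal_ne_top, fun ε hε r hr => ?_⟩
  have hKm := measurable_of_isTruncatedHeatKernel hK
  have hgm := measurable_blockKernel hK hζ hε (1, 1)
  set g := blockKernel P (rescaledNoise ε (ζ ε)) K (1, 1) with hg
  set F := rootedIntegrand P (rescaledNoise ε (ζ ε)) K {(1, 1), (1, 1)} (rescaledTest r φ) with hF
  have hFint : Integrable F := integrable_rootedIntegrand hK hζ hε _ (integrable_rescaledTest hφ hr)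
  have hFeq : ∀ u, F u = rescaledTest r φ u.2 * (K (-u.1) * g u.1 u.2 ^ 2) := by
    intro u
    simp only [hF, rootedIntegrand, cloudKernel, Multiset.insert_eq_cons, Multiset.map_cons,
      Multiset.map_singleton, Multiset.prod_cons, Multiset.prod_singleton]
    ring
  have hψ0 : ∀ z, 0 ≤ rescaledTest r φ z := fun z => by
    have := hr.1
    have := hφ0 (dilate r z)
    rw [rescaledTest_eq]
    positivity
  have hX : ∀ k : SpaceTime → ℝ, Measurable k → Measurable fun u : SpaceTime × SpaceTime =>
      ENNReal.ofReal (k u.1) * ENNReal.ofReal (g u.1 u.2 ^ 2) := fun k hk =>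
    (hk.comp measurable_fst).ennreal_ofReal.mul (hgm.pow_const 2).ennreal_ofReal
  have hpos : ∫⁻ u, ENNReal.ofReal (F u) = ∫⁻ w, ENNReal.ofReal (φ w) * ∫⁻ v,
      ENNReal.ofReal (K (-v)) * ENNReal.ofReal (g v (dilate r⁻¹ w) ^ 2) := by
    rw [← lintegral_rescaledTest_mul_prod hr.1 hφ.contDiff.continuous.measurable
      (hX (fun v => K (-v)) (hKm.comp measurable_neg))]
    refine lintegral_congr fun u => ?_
    rw [hFeq, ENNReal.ofReal_mul (hψ0 _), ENNReal.ofReal_mul' (sq_nonneg _)]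
  have hneg' : ∫⁻ u, ENNReal.ofReal (-F u) ≤
      (∫⁻ w, ENNReal.ofReal (φ w)) * ENNReal.ofReal D := by
    calc _ = ∫⁻ w, ENNReal.ofReal (φ w) * ∫⁻ v,
          ENNReal.ofReal (-K (-v)) * ENNReal.ofReal (g v (dilate r⁻¹ w) ^ 2) := by
          rw [← lintegral_rescaledTest_mul_prod hr.1 hφ.contDiff.continuous.measurable
            (hX (fun v => -K (-v)) (hKm.comp measurable_neg).neg)]
          refine lintegral_congr fun u => ?_
          rw [hFeq, ← mul_neg, ← neg_mul, ENNReal.ofReal_mul (hψ0 _),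
            ENNReal.ofReal_mul' (sq_nonneg _)]
      _ ≤ ∫⁻ w, ENNReal.ofReal (φ w) * ENNReal.ofReal D := by
          refine lintegral_mono fun w => ?_
          by_cases hw : φ w = 0
          · rw [hw, ENNReal.ofReal_zero, zero_mul, zero_mul]
          · have h1 : parabolicNorm (dilate r⁻¹ w) ≤ 1 := by
              rw [parabolicNorm_dilate (inv_pos.2 hr.1), div_inv_eq_mul]
              exact mul_le_one₀ (hφ.parabolicNorm_le hw) hr.1.le hr.2
            gcongr
            exact hneg ε hε _ (norm_le_one_of_parabolicNorm_le_one h1)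
      _ = _ := lintegral_mul_const' _ _ ENNReal.ofReal_ne_top
  have hsplit := integral_eq_lintegral_pos_part_sub_lintegral_neg_part hFint
  have hposlt := hFint.lintegral_lt_top
  have hneglt : ∫⁻ u, ENNReal.ofReal (-F u) < ⊤ := hFint.neg.lintegral_lt_top
  rw [← hpos, ← ENNReal.ofReal_toReal hposlt.ne]
  calc _ ≤ ENNReal.ofReal (|∫ u, F u| + (∫⁻ u, ENNReal.ofReal (-F u)).toReal) := by
        refine ENNReal.ofReal_le_ofReal ?_
        have := le_abs_self (∫ u, F u)
        linarith
    _ ≤ ENNReal.ofReal |∫ u, F u| + ∫⁻ u, ENNReal.ofReal (-F u) := by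
        rw [ENNReal.ofReal_add (abs_nonneg _) ENNReal.toReal_nonneg,
          ENNReal.ofReal_toReal hneglt.ne]
    _ ≤ _ := by gcongr

/-- The pairwise contraction is unbounded along every sequence `ε → 0`, `r → 0`. -/
theorem not_bounded_integral_rootedIntegrand (hK : IsTruncatedHeatKernel K)
    (hζ : IsNoiseFamily P ζ) {φ : SpaceTime → ℝ} (hφ : IsTestFunction φ) (hφ0 : ∀ z, 0 ≤ φ z)
    (hφ1 : ∀ z ∈ Metric.ball (0 : SpaceTime) (1 / 10), 0 < φ z) {ε r : ℕ → ℝ}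
    (hε : ∀ n, ε n ∈ Ioo (0 : ℝ) 1) (hr : ∀ n, r n ∈ Ioc (0 : ℝ) 1)
    (hε0 : Tendsto ε atTop (nhds 0)) (hr0 : Tendsto r atTop (nhds 0)) :
    ¬ ∀ n, |∫ u, rootedIntegrand P (rescaledNoise (ε n) (ζ (ε n))) K {(1, 1), (1, 1)}
      (rescaledTest (r n) φ) u| ≤ 1 := by
  intro hle
  obtain ⟨D, hD, hpos⟩ := exists_lintegral_posPart_le hK hζ hφ hφ0
  have hKm := measurable_of_isTruncatedHeatKernel hK
  have hφm : Measurable φ := hφ.contDiff.continuous.measurable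
  set f : ℕ → SpaceTime × SpaceTime → ENNReal := fun n u => ENNReal.ofReal (φ u.2) *
    (ENNReal.ofReal (K (-u.1)) * ENNReal.ofReal
      (blockKernel P (rescaledNoise (ε n) (ζ (ε n))) K (1, 1) u.1 (dilate (r n)⁻¹ u.2) ^ 2)) with hf
  have hfm : ∀ n, Measurable (f n) := by
    intro n
    have h1 : Measurable fun u : SpaceTime × SpaceTime => (u.1, dilate (r n)⁻¹ u.2) :=
      measurable_fst.prodMk ((continuous_dilate _).measurable.comp measurable_snd)
    exact (hφm.comp measurable_snd).ennreal_ofReal.mul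
      ((hKm.comp measurable_fst.neg).ennreal_ofReal.mul
        (((measurable_blockKernel hK hζ (hε n) (1, 1)).comp h1).pow_const 2).ennreal_ofReal)
  have hbound : ∀ n, ∫⁻ u, f n u ≤ 1 + D := by
    intro n
    rw [Measure.volume_eq_prod, lintegral_prod_symm' _ (hfm n)]
    simp only [hf]
    simp_rw [lintegral_const_mul' _ _ ENNReal.ofReal_ne_top]
    refine (hpos (ε n) (hε n) (r n) (hr n)).trans ?_
    gcongr
    exact ENNReal.ofReal_le_one.2 (hle n)
  have hlim : ∀ w, ∀ᵐ v : SpaceTime, liminf (fun n => f n (v, w)) atTop = ENNReal.ofReal (φ w) *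
      (ENNReal.ofReal (K (-v)) * ENNReal.ofReal (periodicCorrelation K v ^ 2)) := by
    intro w
    filter_upwards [ae_torusSize_sub_pos 0] with v hv
    rw [sub_zero] at hv
    have hdil : Tendsto (fun n => dilate (r n)⁻¹ w) atTop (nhds 0) := by
      have h1 : ∀ n, dilate (r n)⁻¹ w = (r n ^ 2 * w.1, r n • w.2) := fun n => by
        refine Prod.ext ?_ (funext fun i => ?_) <;> simp [dilate, mul_comm]
      simp_rw [h1]
      have h2 : Tendsto (fun n => (r n ^ 2 * w.1, r n • w.2)) atTop
          (nhds ((0 : ℝ) ^ 2 * w.1, (0 : ℝ) • w.2)) :=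
        ((hr0.pow 2).mul_const _).prodMk_nhds (hr0.smul_const _)
      have h3 : ((0 : ℝ) ^ 2 * w.1, (0 : ℝ) • w.2) = (0 : SpaceTime) := by
        simp [Prod.ext_iff]
      rwa [h3] at h2
    have hz : Tendsto (fun n => v - dilate (r n)⁻¹ w) atTop (nhds v) := by
      simpa using hdil.const_sub v
    have h3 := tendsto_blockKernel_covariance hK hζ hε hε0 hz hv
    simp_rw [blockKernel_sub hζ (hε _)] at h3
    refine Tendsto.liminf_eq (ENNReal.Tendsto.const_mul (ENNReal.Tendsto.const_mul
      (ENNReal.tendsto_ofReal (h3.pow 2)) (Or.inr ENNReal.ofReal_ne_top))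
      (Or.inr ENNReal.ofReal_ne_top))
  have hfatou := lintegral_liminf_le (u := atTop)
    (μ := (volume : Measure (SpaceTime × SpaceTime))) hfm
  have htop : ∫⁻ u, liminf (fun n => f n u) atTop = ⊤ := by
    rw [Measure.volume_eq_prod, lintegral_prod_symm' _ (Measurable.liminf hfm)]
    simp_rw [lintegral_congr_ae (hlim _), lintegral_const_mul' _ _ ENNReal.ofReal_ne_top,
      lintegral_kernel_mul_periodicCorrelation_sq hK]
    refine top_le_iff.1 ?_
    calc (⊤ : ENNReal) = ∫⁻ _ in Metric.ball (0 : SpaceTime) (1 / 10), ⊤ := by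
          rw [setLIntegral_const, ENNReal.top_mul]
          exact (Metric.measure_ball_pos volume _ (by norm_num)).ne'
      _ ≤ ∫⁻ w in Metric.ball (0 : SpaceTime) (1 / 10), ENNReal.ofReal (φ w) * ⊤ := by
          refine setLIntegral_mono' Metric.isOpen_ball.measurableSet fun w hw => ?_
          rw [ENNReal.mul_top]
          simpa using hφ1 w hw
      _ ≤ _ := setLIntegral_le_lintegral _ _
  rw [htop] at hfatou
  have h1 : liminf (fun n => ∫⁻ u, f n u) atTop ≤ 1 + D :=
    liminf_le_of_le (by isBoundedDefault) fun b hb => by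
      obtain ⟨n, hn⟩ := hb.exists
      exact hn.trans (hbound n)
  exact absurd (hfatou.trans h1) (not_le.2 (ENNReal.add_lt_top.2
    ⟨ENNReal.one_lt_top, lt_top_iff_ne_top.2 hD⟩))

theorem not_abs_rootedGraph_le (hK : IsTruncatedHeatKernel K) (hζ : IsNoiseFamily P ζ)
    (C δ : ℝ) {θ : ℝ} (hθ : 0 < θ) :
    ¬ ∀ ε ∈ Ioo (0 : ℝ) 1, ∀ r ∈ Ioc (0 : ℝ) 1, ∀ φ : SpaceTime → ℝ, IsTestFunction φ →
      |rootedGraph P (rescaledNoise ε (ζ ε)) K ε 2 2 {(1, 1), (1, 1)} (rescaledTest r φ)| ≤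
        C * ε ^ θ * r ^ (-δ) := by
  intro h
  obtain ⟨φ, hφ, hφ0, hφ1⟩ := exists_isTestFunction_pos
  have hr : ∀ n : ℕ, (1 / ((n : ℝ) + 1)) ∈ Ioc (0 : ℝ) 1 := fun n =>
    ⟨by positivity, by
      rw [div_le_one (by positivity)]
      linarith [n.cast_nonneg (α := ℝ)]⟩
  -- `ε` is chosen so small in terms of `r` that the factor `r ^ (-δ)` is compensated.
  have hex : ∀ n : ℕ, ∃ e : ℝ, e ∈ Ioo (0 : ℝ) (1 / ((n : ℝ) + 1)) ∧
      C * e ^ θ * (1 / ((n : ℝ) + 1)) ^ (-δ) ≤ 1 := by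
    intro n
    have h1 : Tendsto (fun e : ℝ => C * e ^ θ * (1 / ((n : ℝ) + 1)) ^ (-δ)) (nhdsWithin 0 (Ioi 0))
        (nhds (C * (0 : ℝ) ^ θ * (1 / ((n : ℝ) + 1)) ^ (-δ))) :=
      (((Real.continuousAt_rpow_const 0 θ (Or.inr hθ.le)).tendsto.const_mul C).mul_const
        _).mono_left nhdsWithin_le_nhds
    rw [Real.zero_rpow hθ.ne', mul_zero, zero_mul] at h1
    exact (Filter.Eventually.and (Ioo_mem_nhdsGT (hr n).1)
      (h1.eventually (ge_mem_nhds one_pos))).exists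
  choose ε hε hεC using hex
  have hε1 : ∀ n, ε n ∈ Ioo (0 : ℝ) 1 := fun n => ⟨(hε n).1, (hε n).2.trans_le (hr n).2⟩
  have hr0 : Tendsto (fun n : ℕ => 1 / ((n : ℝ) + 1)) atTop (nhds 0) :=
    tendsto_one_div_add_atTop_nhds_zero_nat
  refine not_bounded_integral_rootedIntegrand hK hζ hφ hφ0 hφ1 hε1 hr
    (squeeze_zero (fun n => (hε n).1.le) (fun n => (hε n).2.le) hr0) hr0 fun n => ?_
  have h1 := (h (ε n) (hε1 n) _ (hr n) φ hφ).trans (hεC n)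
  rw [rootedGraph] at h1
  norm_num at h1
  simpa using h1

end Noise

/-! ### The zeroth chaos -/

theorem proposition4p9 (k l : ℕ) (hk : 1 ≤ k) (hl : 2 ≤ l) (hkl : Even (k + l))
    (π : Multiset (ℕ × ℕ)) (hπ : IsPairing k l π) (δ : ℝ) (hδ : 0 < δ) :
    (∃ θ : ℝ, 0 ≤ θ ∧ (θ = 0 ↔ k = 2 ∧ l = 2 ∧ π = {(1, 1), (1, 1)}) ∧
      ∀ (K : SpaceTime → ℝ), IsTruncatedHeatKernel K →
      ∀ (Ω : Type*) [MeasurableSpace Ω] (P : Measure Ω) [IsProbabilityMeasure P]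
        (ζ : ℝ → SpaceTime → Ω → ℝ), IsNoiseFamily P ζ →
      ∃ C : ℝ, ∀ ε ∈ Ioo (0 : ℝ) 1, ∀ r ∈ Ioc (0 : ℝ) 1, ∀ φ : SpaceTime → ℝ, IsTestFunction φ →
        GraphsConverge P (rescaledNoise ε (ζ ε)) K π (rescaledTest r φ) ∧
        renormalisedZerothChaos P (rescaledNoise ε (ζ ε)) K ε k l π (rescaledTest r φ) =
          -rootedGraph P (rescaledNoise ε (ζ ε)) K ε k l π (rescaledTest r φ) ∧
        |rootedGraph P (rescaledNoise ε (ζ ε)) K ε k l π (rescaledTest r φ)| ≤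
          C * ε ^ θ * r ^ (-δ)) ∧
    (k = 2 ∧ l = 2 ∧ π = {(1, 1), (1, 1)} →
      ∀ (K : SpaceTime → ℝ), IsTruncatedHeatKernel K →
      ∀ (Ω : Type*) [MeasurableSpace Ω] (P : Measure Ω) [IsProbabilityMeasure P]
        (ζ : ℝ → SpaceTime → Ω → ℝ), IsNoiseFamily P ζ →
      ∀ θ : ℝ, 0 < θ →
      ¬ ∃ C : ℝ, ∀ ε ∈ Ioo (0 : ℝ) 1, ∀ r ∈ Ioc (0 : ℝ) 1, ∀ φ : SpaceTime → ℝ,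
        IsTestFunction φ →
        |rootedGraph P (rescaledNoise ε (ζ ε)) K ε k l π (rescaledTest r φ)| ≤
          C * ε ^ θ * r ^ (-δ)) := by
  constructor
  · by_cases hpair : k = 2 ∧ l = 2 ∧ π = {(1, 1), (1, 1)}
    -- The order of the cloud is exactly `2`, and nothing is left to gain from `ε`.
    · refine ⟨0, le_rfl, by simpa using hpair, fun K hK Ω _ P _ ζ hζ => ?_⟩
      have hsum : 2 ≤ (π.map blockOrder).sum := by
        rw [hpair.2.2, sum_blockOrder_pair]
      obtain ⟨C, hC, h⟩ := exists_abs_rootedGraph_le hK hζ hπ (κ := min δ (1 / 2)) (A := 2)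
        (by positivity) (by linarith [min_le_right δ (1 / 2)]) (by norm_num)
        (by linarith [(by positivity : 0 < min δ (1 / 2))]) hsum
      refine ⟨C, fun ε hε r hr φ hφ => ⟨graphsConverge hK hζ hε π (integrable_rescaledTest hφ hr),
        renormalisedZerothChaos_eq hK hζ hε k l π (integrable_rescaledTest hφ hr), ?_⟩⟩
      have h1 := h ε hε r hr φ hφ
      rw [sub_self] at h1
      refine h1.trans (mul_le_mul_of_nonneg_left ?_ (mul_nonneg hC (Real.rpow_nonneg hε.1.le _)))
      exact Real.rpow_le_rpow_of_exponent_ge hr.1 hr.2 (neg_le_neg (min_le_left _ _))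
    -- The order of the cloud is at least `5 / 2`, so that it can be used with order `2 + κ`: the
    -- gain in `ε` and the loss in `r` are both of order `κ`.
    · have hκ : 0 < min δ (1 / 2) := by positivity
      refine ⟨min δ (1 / 2), hκ.le, ⟨fun h => absurd h hκ.ne', fun h => absurd h hpair⟩,
        fun K hK Ω _ P _ ζ hζ => ?_⟩
      have hsum := le_sum_blockOrder hl hπ hpair
      obtain ⟨C, hC, h⟩ := exists_abs_rootedGraph_le hK hζ hπ (κ := min δ (1 / 2))
        (A := 2 + min δ (1 / 2)) hκ (by linarith [min_le_right δ (1 / 2)]) (by linarith) le_rfl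
        (by linarith [min_le_right δ (1 / 2)])
      refine ⟨C, fun ε hε r hr φ hφ => ⟨graphsConverge hK hζ hε π (integrable_rescaledTest hφ hr),
        renormalisedZerothChaos_eq hK hζ hε k l π (integrable_rescaledTest hφ hr), ?_⟩⟩
      have h1 := h ε hε r hr φ hφ
      rw [add_sub_cancel_left] at h1
      refine h1.trans (mul_le_mul_of_nonneg_left ?_ (mul_nonneg hC (Real.rpow_nonneg hε.1.le _)))
      exact Real.rpow_le_rpow_of_exponent_ge hr.1 hr.2 (neg_le_neg (min_le_left _ _))
  · rintro ⟨rfl, rfl, rfl⟩ K hK Ω _ P _ ζ hζ θ hθ ⟨C, hC⟩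
    exact not_abs_rootedGraph_le hK hζ C δ hθ hC
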